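/- Let $S$ be a closed connected Riemann surface of negative Euler characteristic $\chi(S)$ (the number $V-E+F$ of any smooth triangulation of $S$), and let $q$ be a holomorphic cubic differential on $S$, written $q(z)\,dz^3$ in a local coordinate. Let $f:\widetilde S\to\mathbb R^3$ be a hyperbolic affine sphere centred at the origin, defined on the universal cover of $S$ and equivariant under a homomorphism $\rho$ from the deck group $\pi_1(S)$ to $\mathrm{SL}(3,\mathbb R)$. That is, $f$ is a smooth immersion transverse to its position vector such that $$D_{f_*Y}f_*Z=f_*(\nabla_YZ)+\tilde h(Y,Z)\,f ,\qquad \det(f_*Y,f_*Z,f)^2=\tilde h(Y,Y)\tilde h(Z,Z)-\tilde h(Y,Z)^2 ,$$ where $D$ is the flat connection of $\mathbb R^3$, $\nabla$ is the Blaschke connection and the Blaschke metric $\tilde h$ is positive definite. Suppose that $\tilde h$ is conformal, and hence descends to a conformal metric $h$ on $S$, written $h=e^{\psi}|dz|^2$, and that the Pick differential of $f$ is the lift of $q$, i.e. $q(z)=e^{\psi}\,C^{\bar 1}_{11}$, where $C^{\bar 1}_{11}$ is the $\partial_{\bar z}$-component of $\nabla_{\partial_z}\partial_z-\hat\nabla_{\partial_z}\partial_z$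 and $\hat\nabla$ is the Levi-Civita connection of $\tilde h$. Then $$2^{\frac13}\,\|q\|\;\le\;\mathrm{Area}(S,h)\;\le\;2^{\frac13}\,\|q\|+2\pi|\chi(S)| ,$$ where $\|q\|=\int_S|q|^{2/3}$ is the area of the flat metric $|q(z)|^{2/3}|dz|^2$ (with conical singularities at the zeros of $q$); both areas are finite. -/

import Mathlib

open scoped Manifold ContDiff Topology ENNReal ComplexConjugate
open MeasureTheory

noncomputable section

namespace AffineSphere

/-! ### Tensors on a Riemann surface, given by their coefficients in the charts -/

section Tensors

variable (S : Type*) [TopologicalSpace S] [ChartedSpace ℂ S]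

/-- A smooth Riemannian metric `λ(z) |dz|²` in the conformal class of the Riemann surface `S`:
a positive smooth coefficient `λ` in every chart of the atlas, with the transformation rule
`λ(z) |dz|² = λ'(w) |dw|²`. (Values at non-charts or off the target of a chart play no role.) -/
structure ConformalMetric where
  coeff : OpenPartialHomeomorph S ℂ → ℂ → ℝ
  pos : ∀ e ∈ atlas ℂ S, ∀ z ∈ e.target, 0 < coeff e z
  smooth : ∀ e ∈ atlas ℂ S, ContDiffOn ℝ ∞ (coeff e) e.target
  transform : ∀ e ∈ atlas ℂ S, ∀ e' ∈ atlas ℂ S, ∀ z ∈ (e.symm.trans e').source,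
    coeff e z = coeff e' (e' (e.symm z)) * ‖deriv (fun w => e' (e.symm w)) z‖ ^ 2

/-- A holomorphic cubic differential on the Riemann surface `S`: a holomorphic coefficient `q(z)`
in every chart, with the transformation rule `q(z) dz³ = q'(w) dw³`. -/
structure CubicDifferential where
  coeff : OpenPartialHomeomorph S ℂ → ℂ → ℂ
  holo : ∀ e ∈ atlas ℂ S, DifferentiableOn ℂ (coeff e) e.target
  transform : ∀ e ∈ atlas ℂ S, ∀ e' ∈ atlas ℂ S, ∀ z ∈ (e.symm.trans e').source,
    coeff e z = coeff e' (e' (e.symm z)) * deriv (fun w => e' (e.symm w)) z ^ 3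

variable {S}

/-- The measure on `S` equal to `d(z) dx dy` in every chart. In the complete lattice of measures,
the supremum of measures on the chart domains that agree on overlaps is the glued measure. -/
def areaMeasure [MeasurableSpace S] (d : OpenPartialHomeomorph S ℂ → ℂ → ℝ) : Measure S :=
  ⨆ e ∈ atlas ℂ S,
    Measure.map e.symm ((volume.restrict e.target).withDensity fun z => ENNReal.ofReal (d e z))

/-- `Area(S, h)`. -/
def ConformalMetric.area [MeasurableSpace S] (h : ConformalMetric S) : ℝ≥0∞ :=
  areaMeasure h.coeff Set.univ

/-- `‖q‖`, the area of the flat metric `|q|^{2/3}`. -/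
def CubicDifferential.flatArea [MeasurableSpace S] (q : CubicDifferential S) : ℝ≥0∞ :=
  areaMeasure (S := S) (fun e z => ‖q.coeff e z‖ ^ (2 / 3 : ℝ)) Set.univ

variable {X : Type*} [TopologicalSpace X] [ChartedSpace ℂ X]

/-- `h' = p^* h` for a holomorphic map `p : X → S`. -/
def ConformalMetric.IsPullback (p : X → S) (h' : ConformalMetric X) (h : ConformalMetric S) :
    Prop :=
  ∀ c ∈ atlas ℂ X, ∀ e ∈ atlas ℂ S, ∀ z ∈ c.target, p (c.symm z) ∈ e.source →
    h'.coeff c z = h.coeff e (e (p (c.symm z))) * ‖deriv (fun w => e (p (c.symm w))) z‖ ^ 2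

/-- `q' = p^* q` for a holomorphic map `p : X → S`. -/
def CubicDifferential.IsPullback (p : X → S) (q' : CubicDifferential X)
    (q : CubicDifferential S) : Prop :=
  ∀ c ∈ atlas ℂ X, ∀ e ∈ atlas ℂ S, ∀ z ∈ c.target, p (c.symm z) ∈ e.source →
    q'.coeff c z = q.coeff e (e (p (c.symm z))) * deriv (fun w => e (p (c.symm w))) z ^ 3

end Tensors

/-! ### Hyperbolic affine spheres -/

/-- `F : U → ℝ³` is a hyperbolic affine sphere with affine normal `ξ = F`, Blaschke metric `g` and
Blaschke connection `∇_v w = D_v w + Γ(v, w)`. The splitting of the flat connection is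
`D_{F_* v} F_* w = F_* (∇_v w) + g(v, w) ξ`, the form `g` is symmetric and positive definite, and
`det(F_* v, F_* w, ξ)² = g(v, v) g(w, w) - g(v, w)²`. The remaining conditions `τ = 0` and
`B = -id` hold for `ξ = F` since `D_v F = F_* v`. In particular `F` is an immersion transverse to
its position vector. -/
structure IsHyperbolicAffineSphere (F : ℂ → Fin 3 → ℝ) (U : Set ℂ)
    (g : ℂ → ℂ →ₗ[ℝ] ℂ →ₗ[ℝ] ℝ) (Γ : ℂ → ℂ →ₗ[ℝ] ℂ →ₗ[ℝ] ℂ) : Prop where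
  smooth : ContDiffOn ℝ ∞ F U
  symm : ∀ z ∈ U, ∀ v w, g z v w = g z w v
  pos : ∀ z ∈ U, ∀ v, v ≠ 0 → 0 < g z v v
  split : ∀ z ∈ U, ∀ v w,
    fderiv ℝ (fderiv ℝ F) z v w = fderiv ℝ F z (Γ z v w) + g z v w • F z
  volume : ∀ z ∈ U, ∀ v w,
    (Matrix.of ![fderiv ℝ F z v, fderiv ℝ F z w, F z]).det ^ 2 =
      g z v v * g z w w - g z v w ^ 2

/-- The Christoffel form `(v, w) ↦ ψ_z v w` of the Levi-Civita connection of
`λ |dz|² = e^ψ |dz|²`, where `ψ_z = (ψ_x - i ψ_y) / 2`. -/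
def leviCivita (lam : ℂ → ℝ) (z v w : ℂ) : ℂ :=
  ((fderiv ℝ (fun ζ => Real.log (lam ζ)) z 1 : ℝ) -
    Complex.I * (fderiv ℝ (fun ζ => Real.log (lam ζ)) z Complex.I : ℝ)) / 2 * v * w

/-- For a real bilinear `A : ℂ × ℂ → ℂ`, the `∂_{\bar z}`-component of the complex bilinear
extension of `A` at `(∂_z, ∂_z)`. Here `a ∈ ℂ` stands for the real tangent vector
`a ∂_z + \bar a ∂_{\bar z}`, and `∂_z = (1 - i · I) / 2` for the tangent vectors `1` and `I`. -/
def zbarComponent (A : ℂ → ℂ → ℂ) : ℂ :=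
  (conj (A 1 1) - conj (A Complex.I Complex.I)
    - Complex.I * (conj (A 1 Complex.I) + conj (A Complex.I 1))) / 4

/-- `f : X → ℝ³` is a hyperbolic affine sphere (centred at the origin) whose Blaschke metric is the
conformal metric `h` and whose Pick differential is `q`: in every chart `f` has Blaschke metric
`λ |dz|² = λ Re(v \bar w)`, and `q = λ C`, where `C` is the `∂_{\bar z}`-component of
`∇_{∂_z} ∂_z - ∇̂_{∂_z} ∂_z` for the Blaschke connection `∇` and the Levi-Civita connection `∇̂`
of the Blaschke metric. -/
def HasBlaschkePick {X : Type*} [TopologicalSpace X] [ChartedSpace ℂ X] (f : X → Fin 3 → ℝ)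
    (h : ConformalMetric X) (q : CubicDifferential X) : Prop :=
  ∀ c ∈ atlas ℂ X, ∃ (g : ℂ → ℂ →ₗ[ℝ] ℂ →ₗ[ℝ] ℝ) (Γ : ℂ → ℂ →ₗ[ℝ] ℂ →ₗ[ℝ] ℂ),
    IsHyperbolicAffineSphere (fun z => f (c.symm z)) c.target g Γ ∧
    (∀ z ∈ c.target, ∀ v w, g z v w = h.coeff c z * (v * conj w).re) ∧
    ∀ z ∈ c.target, q.coeff c z =
      (h.coeff c z : ℂ) * zbarComponent (fun v w => Γ z v w - leviCivita (h.coeff c) z v w)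

/-- The group of deck transformations of `p : X → S`. -/
def deckGroup {X S : Type*} [TopologicalSpace X] (p : X → S) : Subgroup (X ≃ₜ X) where
  carrier := {φ | ∀ x, p (φ x) = p x}
  mul_mem' {a b} ha hb x := (ha (b x)).trans (hb x)
  one_mem' _ := rfl
  inv_mem' {a} ha x := by
    have := ha (a⁻¹ x)
    rw [show a (a⁻¹ x) = x from a.apply_symm_apply x] at this
    exact this.symm

/-- `(h, q)` on the Riemann surface `S` are the Blaschke metric and the Pick differential of the
quotient of an equivariant hyperbolic affine sphere: there is a hyperbolic affine sphere `f` on the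
universal cover `p : X → S`, equivariant under a representation of the deck group in `SL(3, ℝ)`,
whose Blaschke metric and Pick differential are the lifts of `h` and `q`. -/
structure IsQuotientAffineSphere {X S : Type*}
    [TopologicalSpace X] [ChartedSpace ℂ X] [TopologicalSpace S] [ChartedSpace ℂ S]
    (p : X → S) (f : X → Fin 3 → ℝ) (ρ : deckGroup p →* Matrix.SpecialLinearGroup (Fin 3) ℝ)
    (h : ConformalMetric S) (q : CubicDifferential S) : Prop where
  covering : IsCoveringMap p
  holo : MDifferentiable 𝓘(ℂ) 𝓘(ℂ) p
  equivariant : ∀ (φ : deckGroup p) (x : X),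
    f (φ.1 x) = Matrix.mulVec (ρ φ : Matrix (Fin 3) (Fin 3) ℝ) (f x)
  blaschke : ∃ (h' : ConformalMetric X) (q' : CubicDifferential X),
    h'.IsPullback p h ∧ q'.IsPullback p q ∧ HasBlaschkePick f h' q'

/-! ### The Euler characteristic -/

/-- The closed simplex spanned by a set `t` of vertices, in barycentric coordinates. -/
def simplex {n : ℕ} (t : Finset (Fin n)) : Set (Fin n → ℝ) :=
  {x | (∀ i, 0 ≤ x i) ∧ (∑ i, x i = 1) ∧ ∀ i, i ∉ t → x i = 0}

/-- A smooth triangulation of a closed surface `S`: a finite simplicial complex with vertex set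
`Fin n`, given by its triangles, and a homeomorphism `φ` of its geometric realization onto `S`,
whose restriction to each closed triangle is a smooth immersion (near each point of the triangle,
`φ` read in a chart is the restriction of a smooth map with injective differential along the
triangle). -/
structure SmoothTriangulation (S : Type*) [TopologicalSpace S] [ChartedSpace ℂ S] where
  n : ℕ
  triangles : Finset (Finset (Fin n))
  card_eq : ∀ t ∈ triangles, t.card = 3
  vertex_mem : ∀ i : Fin n, ∃ t ∈ triangles, i ∈ t
  φ : (Fin n → ℝ) → S
  continuousOn : ContinuousOn φ (⋃ t ∈ triangles, simplex t)
  bijOn : Set.BijOn φ (⋃ t ∈ triangles, simplex t) Set.univ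
  smooth : ∀ t ∈ triangles, ∀ x ∈ simplex t, ∃ G : (Fin n → ℝ) → ℂ,
    ContDiffAt ℝ ∞ G x ∧
    (∀ᶠ y in 𝓝[simplex t] x, G y = chartAt ℂ (φ x) (φ y)) ∧
    ∀ v : Fin n → ℝ, ∑ i, v i = 0 → (∀ i, i ∉ t → v i = 0) → fderiv ℝ G x v = 0 → v = 0

namespace SmoothTriangulation

variable {S : Type*} [TopologicalSpace S] [ChartedSpace ℂ S] (T : SmoothTriangulation S)

/-- The edges of the triangulation. -/
def edges : Finset (Finset (Fin T.n)) :=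
  T.triangles.biUnion fun t => t.powersetCard 2

/-- The Euler characteristic `χ(S) = V - E + F`, computed from a triangulation. -/
def eulerChar : ℤ :=
  (T.n : ℤ) - T.edges.card + T.triangles.card

end SmoothTriangulation

end AffineSphere

end

noncomputable section

namespace AffineSphere

/-! ### Wirtinger derivatives -/

/-! Write `h = λ |dz|²` and let `K` be its curvature. In a chart, `dbar2 (wz (log λ))` is half the
Laplacian of `log λ`, which is `-K λ`. The structure equations of a hyperbolic affine sphere force
Wang's equation `-K λ = λ - 2|q|²/λ²` (`wang_equation`). Both sides are coefficients of 2-forms, so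
the equation descends from the universal cover to `S` (`IsQuotientAffineSphere.curv_eq`).

The function `2|q|²/λ³` is well defined on the compact surface and attains its maximum. If `q` is
nonzero there, `log |q|²` is harmonic nearby, so the Laplacian of `log λ` is nonnegative at that
point and Wang's equation says that the maximum is at most `1`. Hence `2|q|² ≤ λ³` everywhere
(`IsQuotientAffineSphere.two_mul_norm_sq_le`). In other words `K ≤ 0`, and `a := 2^(1/3)|q|^(2/3) ≤
λ`; integrating the latter gives the lower bound on the area. For the upper bound, `λ = 2|q|²/λ² +
(-K λ)`, where `2|q|²/λ² = a³/λ² ≤ a`, and the integral of `-K dA` is controlled by `2π|χ|` through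
Gauss-Bonnet.

Gauss-Bonnet is proved from the triangulation. On each triangle, the pushed-forward coordinate
vector `τ_* 1` is a complex frame, and the exterior derivative of the imaginary part of its
connection form is the pull-back of `-K dA`. Green's theorem (`green_triangle`) turns the curvature
integral into boundary integrals. Comparing the frame with the tangent of each side turns these into
total rotations of the sides plus differences of arguments, and the latter assemble into `π` minus
the angle sum (`triSign_mul_integral`). Summing over triangles, the rotations cancel because every
edge has exactly one triangle on each side (`exists_two_triangles`), the angles at each vertex add
up to `2π` (`sum_angle`), and `3F = 2E` produces `χ` (`gauss_bonnet`). The two combinatorial facts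
rest on the tangent cones of the triangles at a point: the closed cones cover the plane and the open
cones are disjoint.

Since the densities integrated over triangles are nonnegative, it is enough to bound the area
measure above by the sum over triangles (`areaMeasure_le_sum_triangles`); overlaps along edges need
no discussion. The same bound gives finiteness. -/

/-- The Wirtinger derivative `∂u/∂z = (u_x - i u_y) / 2` of a real function. -/
def wz (u : ℂ → ℝ) (z : ℂ) : ℂ :=
  ((fderiv ℝ u z 1 : ℝ) - Complex.I * (fderiv ℝ u z Complex.I : ℝ)) / 2

/-- Twice the Wirtinger derivative `∂φ/∂\bar z`. -/
def dbar2 (φ : ℂ → ℂ) (z : ℂ) : ℂ :=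
  fderiv ℝ φ z 1 + Complex.I * fderiv ℝ φ z Complex.I

theorem two_le_infty : @LE.le (WithTop ℕ∞) _ 2 ∞ :=
  WithTop.coe_le_coe.2 (le_top : (2 : ℕ∞) ≤ ⊤)

theorem real_linear_apply {E : Type*} [NormedAddCommGroup E] [NormedSpace ℝ E] (L : ℂ →L[ℝ] E)
    (v : ℂ) : L v = v.re • L 1 + v.im • L Complex.I := by
  conv_lhs => rw [← Complex.re_add_im v]
  rw [map_add, ← map_smul, ← map_smul]
  simp

theorem fderiv_eq_re_wz (u : ℂ → ℝ) (z v : ℂ) : fderiv ℝ u z v = 2 * (wz u z * v).re := by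
  rw [real_linear_apply]
  simp [wz]
  ring

theorem wz_eq_of_fderiv {u : ℂ → ℝ} {z c : ℂ} (h : ∀ v, fderiv ℝ u z v = 2 * (c * v).re) :
    wz u z = c := by
  rw [wz, h, h]
  apply Complex.ext <;> simp

theorem wz_congr {u v : ℂ → ℝ} {z : ℂ} (h : u =ᶠ[𝓝 z] v) : wz u z = wz v z := by
  simp only [wz, h.fderiv_eq]

theorem dbar2_congr {u v : ℂ → ℂ} {z : ℂ} (h : u =ᶠ[𝓝 z] v) : dbar2 u z = dbar2 v z := by
  simp only [dbar2, h.fderiv_eq]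

theorem wz_comp {u : ℂ → ℝ} {g : ℂ → ℂ} {z : ℂ} (hg : DifferentiableAt ℂ g z)
    (hu : DifferentiableAt ℝ u (g z)) : wz (fun w => u (g w)) z = wz u (g z) * deriv g z := by
  apply wz_eq_of_fderiv
  intro v
  have h1 : HasFDerivAt g _ z := hg.hasDerivAt.hasFDerivAt.restrictScalars ℝ
  have h2 := hu.hasFDerivAt.comp z h1
  have h3 : fderiv ℝ (fun w => u (g w)) z = _ := h2.fderiv
  rw [h3]
  simp only [ContinuousLinearMap.comp_apply]
  rw [fderiv_eq_re_wz]
  simp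
  ring

theorem wz_add {u v : ℂ → ℝ} {z : ℂ} (hu : DifferentiableAt ℝ u z) (hv : DifferentiableAt ℝ v z) :
    wz (fun w => u w + v w) z = wz u z + wz v z := by
  apply wz_eq_of_fderiv
  intro w
  have h3 : fderiv ℝ (fun w => u w + v w) z = _ := (hu.hasFDerivAt.add hv.hasFDerivAt).fderiv
  rw [h3, add_apply, fderiv_eq_re_wz, fderiv_eq_re_wz, add_mul, Complex.add_re]
  ring

theorem wz_const_mul {u : ℂ → ℝ} {z : ℂ} (a : ℝ) (hu : DifferentiableAt ℝ u z) :
    wz (fun w => a * u w) z = a * wz u z := by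
  apply wz_eq_of_fderiv
  intro w
  have h3 : fderiv ℝ (fun w => a * u w) z = _ := (hu.hasFDerivAt.const_mul a).fderiv
  rw [h3, smul_apply, fderiv_eq_re_wz]
  simp
  ring

/-- Locally `log |g|² = log g + log (conj g)`, and only the first summand has a `∂_z`-derivative.
The result is holomorphic wherever `g` is holomorphic and nonzero, so `log |g|²` contributes nothing
to curvature. -/
theorem hasFDerivAt_log_norm_sq {g : ℂ → ℂ} {z : ℂ} (hg : DifferentiableAt ℂ g z) (h0 : g z ≠ 0) :
    DifferentiableAt ℝ (fun w => Real.log (‖g w‖ ^ 2)) z ∧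
      wz (fun w => Real.log (‖g w‖ ^ 2)) z = deriv g z / g z := by
  have h1 : HasFDerivAt g _ z := hg.hasDerivAt.hasFDerivAt.restrictScalars ℝ
  have h2 := h1.norm_sq
  have hn : ‖g z‖ ^ 2 ≠ 0 := by simpa using h0
  have h3 := h2.log hn
  refine ⟨h3.differentiableAt, wz_eq_of_fderiv fun v => ?_⟩
  have h4 : fderiv ℝ (fun w => Real.log (‖g w‖ ^ 2)) z = _ := h3.fderiv
  rw [h4]
  have hc : deriv g z / g z = deriv g z * conj (g z) / (‖g z‖ ^ 2 : ℝ) := by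
    rw [Complex.sq_norm, Complex.normSq_eq_conj_mul_self]
    have : conj (g z) ≠ 0 := by simpa using h0
    field_simp
  rw [hc]
  have : deriv g z * conj (g z) / ((‖g z‖ ^ 2 : ℝ) : ℂ) * v
    = ((‖g z‖ ^ 2)⁻¹ : ℝ) * (deriv g z * conj (g z) * v) := by
      push_cast; field_simp
  rw [this, Complex.re_ofReal_mul]
  simp [Complex.inner]
  ring

theorem dbar2_of_differentiableAt {g : ℂ → ℂ} {z : ℂ} (hg : DifferentiableAt ℂ g z) :
    dbar2 g z = 0 := by
  have h1 : HasFDerivAt g _ z := hg.hasDerivAt.hasFDerivAt.restrictScalars ℝ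
  rw [dbar2, h1.fderiv]
  simp [← mul_assoc]

theorem dbar2_add {u v : ℂ → ℂ} {z : ℂ} (hu : DifferentiableAt ℝ u z) (hv : DifferentiableAt ℝ v z) :
    dbar2 (fun w => u w + v w) z = dbar2 u z + dbar2 v z := by
  have h3 : fderiv ℝ (fun w => u w + v w) z = _ := (hu.hasFDerivAt.add hv.hasFDerivAt).fderiv
  simp only [dbar2, h3, add_apply]
  ring

theorem dbar2_const_mul {u : ℂ → ℂ} {z : ℂ} (a : ℂ) (hu : DifferentiableAt ℝ u z) :
    dbar2 (fun w => a * u w) z = a * dbar2 u z := by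
  have h3 : fderiv ℝ (fun w => a * u w) z = _ := (hu.hasFDerivAt.const_mul a).fderiv
  simp only [dbar2, h3, smul_apply, smul_eq_mul]
  ring

/-- For holomorphic `g` and `G`, the operator sees only the antiholomorphic variation of `φ`, which
picks up `conj g'`. With `G = g'` the factors combine to `|g'|²`. -/
theorem dbar2_comp_mul {φ g G : ℂ → ℂ} {z : ℂ} (hg : DifferentiableAt ℂ g z)
    (hG : DifferentiableAt ℂ G z) (hφ : DifferentiableAt ℝ φ (g z)) :
    dbar2 (fun w => φ (g w) * G w) z = dbar2 φ (g z) * conj (deriv g z) * G z := by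
  have h1 : HasFDerivAt g _ z := hg.hasDerivAt.hasFDerivAt.restrictScalars ℝ
  have h1' : HasFDerivAt G _ z := hG.hasDerivAt.hasFDerivAt.restrictScalars ℝ
  have h2 := (hφ.hasFDerivAt.comp z h1).mul h1'
  have h3 : fderiv ℝ (fun w => φ (g w) * G w) z = _ := h2.fderiv
  simp only [dbar2, h3]
  simp only [add_apply, smul_apply, 
    ContinuousLinearMap.comp_apply, smul_eq_mul, ContinuousLinearMap.coe_restrictScalars',
    Function.comp_apply, ContinuousLinearMap.toSpanSingleton_apply, one_mul]
  rw [real_linear_apply _ (deriv g z), real_linear_apply _ (Complex.I * deriv g z)]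
  have hI := Complex.I_mul_I
  simp only [Complex.real_smul]
  have e : conj (deriv g z) = (deriv g z).re - (deriv g z).im * Complex.I := by
    apply Complex.ext <;> simp
  rw [e]
  simp only [Complex.mul_re, Complex.mul_im, Complex.I_re, Complex.I_im]
  push_cast
  linear_combination (φ (g z) * deriv G z - (fderiv ℝ φ (g z)) Complex.I * G z * (deriv g z).im * (-1)) * hI

theorem contDiffAt_wz {u : ℂ → ℝ} {z : ℂ} (hu : ContDiffAt ℝ ∞ u z) : ContDiffAt ℝ ∞ (wz u) z := by
  have h1 : ContDiffAt ℝ ∞ (fderiv ℝ u) z := hu.fderiv_right (by simp)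
  have h2 : ∀ v, ContDiffAt ℝ ∞ (fun w => ((fderiv ℝ u w v : ℝ) : ℂ)) z := fun v =>
    Complex.ofRealCLM.contDiff.contDiffAt.comp z (h1.clm_apply contDiffAt_const)
  exact ((h2 1).sub (contDiffAt_const.mul (h2 Complex.I))).div_const 2

theorem dbar2_wz {u : ℂ → ℝ} {z : ℂ} (hu : ContDiffAt ℝ ∞ u z) :
    dbar2 (wz u) z =
      ((fderiv ℝ (fun w => fderiv ℝ u w 1) z 1 +
        fderiv ℝ (fun w => fderiv ℝ u w Complex.I) z Complex.I : ℝ) : ℂ) / 2 := by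
  have h1 : ContDiffAt ℝ ∞ (fderiv ℝ u) z := hu.fderiv_right (by simp)
  have h1' : DifferentiableAt ℝ (fderiv ℝ u) z := h1.differentiableAt (by simp)
  have h2 : ∀ v, HasFDerivAt (fun w => fderiv ℝ u w v) 
      ((fderiv ℝ (fderiv ℝ u) z).flip v) z := fun v => by
    have := h1'.hasFDerivAt.clm_apply (hasFDerivAt_const v z)
    simpa using this
  have h3 : ∀ v, HasFDerivAt (fun w => ((fderiv ℝ u w v : ℝ) : ℂ)) _ z := fun v =>
    Complex.ofRealCLM.hasFDerivAt.comp z (h2 v)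
  have h4 : HasFDerivAt (wz u) _ z :=
    (((h3 1).sub ((h3 Complex.I).const_mul Complex.I)).mul_const (2⁻¹ : ℂ)).congr_of_eventuallyEq
      (Filter.Eventually.of_forall fun w => by simp [wz, div_eq_mul_inv])
  -- Symmetry of the second derivative removes the imaginary part, leaving half the Laplacian.
  have hs : fderiv ℝ (fderiv ℝ u) z Complex.I 1 = fderiv ℝ (fderiv ℝ u) z 1 Complex.I :=
    (hu.isSymmSndFDerivAt (by simpa using two_le_infty)).eq _ _
  rw [dbar2, h4.fderiv, (h2 1).fderiv, (h2 Complex.I).fderiv]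
  simp [hs]
  linear_combination (-1/2 * (fderiv ℝ (fderiv ℝ u) z Complex.I Complex.I : ℂ)) * Complex.I_mul_I

/-! ### The structure equation of a hyperbolic affine sphere -/

/-- The determinant of three vectors of `ℝ³`. -/
def det3 (u v w : Fin 3 → ℝ) : ℝ :=
  u 0 * (v 1 * w 2 - v 2 * w 1) - u 1 * (v 0 * w 2 - v 2 * w 0) + u 2 * (v 0 * w 1 - v 1 * w 0)

theorem det_of_eq_det3 (u v w : Fin 3 → ℝ) : (Matrix.of ![u, v, w]).det = det3 u v w := by
  simp [Matrix.det_fin_three, det3]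
  ring

theorem fderiv_det3 {A B C : ℂ → Fin 3 → ℝ} {z : ℂ} (hA : DifferentiableAt ℝ A z)
    (hB : DifferentiableAt ℝ B z) (hC : DifferentiableAt ℝ C z) (v : ℂ) :
    fderiv ℝ (fun w => det3 (A w) (B w) (C w)) z v =
      det3 (fderiv ℝ A z v) (B z) (C z) + det3 (A z) (fderiv ℝ B z v) (C z) +
        det3 (A z) (B z) (fderiv ℝ C z v) := by
  have a := hasFDerivAt_pi'.1 hA.hasFDerivAt
  have b := hasFDerivAt_pi'.1 hB.hasFDerivAt
  have c := hasFDerivAt_pi'.1 hC.hasFDerivAt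
  have h := ((((a 0).mul (((b 1).mul (c 2)).sub ((b 2).mul (c 1)))).sub
    ((a 1).mul (((b 0).mul (c 2)).sub ((b 2).mul (c 0))))).add
    ((a 2).mul (((b 0).mul (c 1)).sub ((b 1).mul (c 0)))))
  have h' : fderiv ℝ (fun w => det3 (A w) (B w) (C w)) z = _ := h.fderiv
  rw [h']
  simp [det3]
  ring

/-- The directional derivative of a map as a function of the base point. -/
def dirDeriv {E : Type*} [NormedAddCommGroup E] [NormedSpace ℝ E] (F : ℂ → E) (v z : ℂ) : E :=
  fderiv ℝ F z v

section DirDeriv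

variable {E : Type*} [NormedAddCommGroup E] [NormedSpace ℝ E] {F : ℂ → E} {z : ℂ}

theorem contDiffAt_dirDeriv_of_le {m n : WithTop ℕ∞} (hF : ContDiffAt ℝ n F z) (hmn : m + 1 ≤ n)
    (v : ℂ) : ContDiffAt ℝ m (dirDeriv F v) z :=
  (hF.fderiv_right hmn).clm_apply contDiffAt_const

theorem contDiffAt_dirDeriv (hF : ContDiffAt ℝ ∞ F z) (v : ℂ) :
    ContDiffAt ℝ ∞ (dirDeriv F v) z :=
  contDiffAt_dirDeriv_of_le hF (by simp) v

theorem dirDeriv_dirDeriv_of_two (hF : ContDiffAt ℝ 2 F z) (v w : ℂ) :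
    dirDeriv (dirDeriv F w) v z = fderiv ℝ (fderiv ℝ F) z v w := by
  have h1 : DifferentiableAt ℝ (fderiv ℝ F) z :=
    (hF.fderiv_right (m := 1) (by norm_num)).differentiableAt (by simp)
  have h2 : fderiv ℝ (dirDeriv F w) z = _ :=
    (h1.hasFDerivAt.clm_apply (hasFDerivAt_const w z)).fderiv
  rw [dirDeriv, h2]
  simp

theorem dirDeriv_dirDeriv (hF : ContDiffAt ℝ ∞ F z) (v w : ℂ) :
    dirDeriv (dirDeriv F w) v z = fderiv ℝ (fderiv ℝ F) z v w :=
  dirDeriv_dirDeriv_of_two (hF.of_le two_le_infty) v w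

theorem dirDeriv_comm_of_two (hF : ContDiffAt ℝ 2 F z) (v w : ℂ) :
    dirDeriv (dirDeriv F w) v z = dirDeriv (dirDeriv F v) w z := by
  rw [dirDeriv_dirDeriv_of_two hF, dirDeriv_dirDeriv_of_two hF]
  exact (hF.isSymmSndFDerivAt (by simp)).eq _ _

theorem dirDeriv_comm (hF : ContDiffAt ℝ ∞ F z) (v w : ℂ) :
    dirDeriv (dirDeriv F w) v z = dirDeriv (dirDeriv F v) w z :=
  dirDeriv_comm_of_two (hF.of_le two_le_infty) v w

theorem dirDeriv_apply (v z : ℂ) :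
    dirDeriv F v z = v.re • dirDeriv F 1 z + v.im • dirDeriv F Complex.I z :=
  real_linear_apply _ _

theorem dirDeriv_congr {F G : ℂ → E} (h : F =ᶠ[𝓝 z] G) (v : ℂ) :
    dirDeriv F v z = dirDeriv G v z := by
  simp only [dirDeriv, h.fderiv_eq]

end DirDeriv

section Structure

variable {F : ℂ → Fin 3 → ℝ} {U : Set ℂ} {g : ℂ → ℂ →ₗ[ℝ] ℂ →ₗ[ℝ] ℝ}
  {Γ : ℂ → ℂ →ₗ[ℝ] ℂ →ₗ[ℝ] ℂ} {lam : ℂ → ℝ}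

/-- The frame determinant of an affine sphere. -/
def frameDet (F : ℂ → Fin 3 → ℝ) (z : ℂ) : ℝ :=
  det3 (dirDeriv F 1 z) (dirDeriv F Complex.I z) (F z)

theorem frameDet_sq (hF : IsHyperbolicAffineSphere F U g Γ)
    (hg : ∀ z ∈ U, ∀ v w, g z v w = lam z * (v * conj w).re) {z : ℂ} (hz : z ∈ U) :
    frameDet F z ^ 2 = lam z ^ 2 := by
  have := hF.volume z hz 1 Complex.I
  rw [det_of_eq_det3, hg z hz, hg z hz, hg z hz] at this
  rw [frameDet, dirDeriv, dirDeriv, this]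
  simp
  ring

theorem dirDeriv_structure (hU : IsOpen U) (hF : IsHyperbolicAffineSphere F U g Γ)
    (hg : ∀ z ∈ U, ∀ v w, g z v w = lam z * (v * conj w).re) {z : ℂ} (hz : z ∈ U) (v w : ℂ) :
    dirDeriv (dirDeriv F w) v z = (Γ z v w).re • dirDeriv F 1 z +
      (Γ z v w).im • dirDeriv F Complex.I z + (lam z * (v * conj w).re) • F z := by
  rw [dirDeriv_dirDeriv (hF.smooth.contDiffAt (hU.mem_nhds hz)), hF.split z hz, hg z hz]
  congr 1
  exact dirDeriv_apply _ _

/-- This makes `F_x, F_y, F` a basis of `ℝ³`, so coefficients in the structure equation can be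
compared by Cramer's rule. -/
theorem frameDet_ne_zero (hF : IsHyperbolicAffineSphere F U g Γ)
    (hg : ∀ z ∈ U, ∀ v w, g z v w = lam z * (v * conj w).re) (hpos : ∀ z ∈ U, 0 < lam z)
    {z : ℂ} (hz : z ∈ U) : frameDet F z ≠ 0 := by
  intro h
  have := frameDet_sq hF hg hz
  have := hpos z hz
  rw [h] at *
  nlinarith

/-- The Blaschke connection is torsion-free because the mixed second derivatives of `F` agree and
the frame is independent. -/
theorem blaschke_symm (hU : IsOpen U) (hF : IsHyperbolicAffineSphere F U g Γ)
    (hg : ∀ z ∈ U, ∀ v w, g z v w = lam z * (v * conj w).re) (hpos : ∀ z ∈ U, 0 < lam z)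
    {z : ℂ} (hz : z ∈ U) : Γ z Complex.I 1 = Γ z 1 Complex.I := by
  have hs := hF.smooth.contDiffAt (hU.mem_nhds hz)
  have h1 := dirDeriv_structure hU hF hg hz Complex.I 1
  have h2 := dirDeriv_structure hU hF hg hz 1 Complex.I
  rw [dirDeriv_comm hs, h2] at h1
  have hD := frameDet_ne_zero hF hg hpos hz
  simp only [map_one, mul_one, Complex.I_re, one_mul, Complex.conj_I, Complex.neg_re, neg_zero,
    mul_zero, zero_smul, add_zero] at h1
  apply Complex.ext
  · apply mul_right_cancel₀ hD
    -- The determinant against the other two frame vectors isolates the coefficient of `F_x`.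
    have := congrArg (fun x => det3 x (dirDeriv F Complex.I z) (F z)) h1
    simp only [det3, Pi.add_apply, Pi.smul_apply, smul_eq_mul] at this
    rw [frameDet, det3]
    linear_combination -this
  · apply mul_right_cancel₀ hD
    have := congrArg (fun x => det3 (dirDeriv F 1 z) x (F z)) h1
    simp only [det3, Pi.add_apply, Pi.smul_apply, smul_eq_mul] at this
    rw [frameDet, det3]
    linear_combination -this

theorem differentiableAt_frameDet {F : ℂ → Fin 3 → ℝ} {z : ℂ} (hs : ContDiffAt ℝ ∞ F z) :
    DifferentiableAt ℝ (frameDet F) z := by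
  have a := differentiableAt_pi.1 ((contDiffAt_dirDeriv hs 1).differentiableAt (by simp))
  have b := differentiableAt_pi.1 ((contDiffAt_dirDeriv hs Complex.I).differentiableAt (by simp))
  have c := differentiableAt_pi.1 (hs.differentiableAt (by simp))
  unfold frameDet det3
  fun_prop

/-- The logarithmic derivative of a frame determinant is the trace of the connection matrix. The
third row adds nothing, since `D_v F = F_* v` has no component along `F`. -/
theorem dirDeriv_frameDet (hU : IsOpen U) (hF : IsHyperbolicAffineSphere F U g Γ)
    (hg : ∀ z ∈ U, ∀ v w, g z v w = lam z * (v * conj w).re) {z : ℂ} (hz : z ∈ U) (v : ℂ) :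
    dirDeriv (frameDet F) v z =
      ((Γ z v 1).re + (Γ z v Complex.I).im) * frameDet F z := by
  have hs := hF.smooth.contDiffAt (hU.mem_nhds hz)
  have h1 := contDiffAt_dirDeriv hs 1
  have h2 := contDiffAt_dirDeriv hs Complex.I
  have h : dirDeriv (frameDet F) v z = _ := fderiv_det3 (h1.differentiableAt (by simp))
    (h2.differentiableAt (by simp)) (hs.differentiableAt (by simp)) v
  have e1 := dirDeriv_structure hU hF hg hz v 1
  have e2 := dirDeriv_structure hU hF hg hz v Complex.I
  have e3 := dirDeriv_apply (F := F) v z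
  simp only [dirDeriv] at e1 e2 e3
  rw [h, e1, e2, e3, frameDet]
  simp only [dirDeriv, det3, Pi.add_apply, Pi.smul_apply, smul_eq_mul]
  ring

/-- This is apolarity: differentiating `frameDet² = λ²` shows that the Blaschke connection preserves
the area form of the Blaschke metric. -/
theorem blaschke_trace (hU : IsOpen U) (hF : IsHyperbolicAffineSphere F U g Γ)
    (hg : ∀ z ∈ U, ∀ v w, g z v w = lam z * (v * conj w).re) (hpos : ∀ z ∈ U, 0 < lam z)
    (hlam : ContDiffOn ℝ ∞ lam U) {z : ℂ} (hz : z ∈ U) (v : ℂ) :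
    dirDeriv lam v z = ((Γ z v 1).re + (Γ z v Complex.I).im) * lam z := by
  have hs := hF.smooth.contDiffAt (hU.mem_nhds hz)
  have hl := (hlam.contDiffAt (hU.mem_nhds hz)).differentiableAt (by simp)
  have hD := frameDet_ne_zero hF hg hpos hz
  have hd := differentiableAt_frameDet hs
  have hev : (fun w => frameDet F w * frameDet F w) =ᶠ[𝓝 z] fun w => lam w * lam w := by
    filter_upwards [hU.mem_nhds hz] with w hw
    have := frameDet_sq hF hg hw
    linear_combination this
  have h1 : fderiv ℝ (fun w => frameDet F w * frameDet F w) z = _ :=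
    (hd.hasFDerivAt.mul hd.hasFDerivAt).fderiv
  have h2 : fderiv ℝ (fun w => lam w * lam w) z = _ := (hl.hasFDerivAt.mul hl.hasFDerivAt).fderiv
  have h3 := congrArg (fun L => L v) (h1.symm.trans (hev.fderiv_eq.trans h2))
  have h4 := dirDeriv_frameDet hU hF hg hz v
  have h5 := frameDet_sq hF hg hz
  simp only [add_apply, smul_apply, smul_eq_mul] at h3
  rw [dirDeriv] at h4 ⊢
  rw [h4] at h3
  apply mul_left_cancel₀ (hpos z hz).ne'
  linear_combination -h3 / 2 + ((Γ z v 1).re + (Γ z v Complex.I).im) * h5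

theorem dirDeriv_mul {A : Type*} [NormedCommRing A] [NormedAlgebra ℝ A] {u v : ℂ → A} {z : ℂ} (hu : DifferentiableAt ℝ u z)
    (hv : DifferentiableAt ℝ v z) (w : ℂ) :
    dirDeriv (fun x => u x * v x) w z = u z * dirDeriv v w z + v z * dirDeriv u w z := by
  have h : fderiv ℝ (fun x => u x * v x) z = _ := (hu.hasFDerivAt.mul hv.hasFDerivAt).fderiv
  simp only [dirDeriv, h, add_apply, smul_apply, smul_eq_mul]

/-- The Codazzi equations. -/
theorem blaschke_codazzi (hU : IsOpen U) (hF : IsHyperbolicAffineSphere F U g Γ)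
    (hg : ∀ z ∈ U, ∀ v w, g z v w = lam z * (v * conj w).re) (hpos : ∀ z ∈ U, 0 < lam z)
    (hlam : ContDiffOn ℝ ∞ lam U) {z : ℂ} (hz : z ∈ U) :
    dirDeriv lam Complex.I z = ((Γ z 1 Complex.I).re - (Γ z 1 1).im) * lam z ∧
    dirDeriv lam 1 z = ((Γ z 1 Complex.I).im - (Γ z Complex.I Complex.I).re) * lam z := by
  have hs := hF.smooth.contDiffAt (hU.mem_nhds hz)
  have hl := (hlam.contDiffAt (hU.mem_nhds hz)).differentiableAt (by simp)
  have hD := frameDet_ne_zero hF hg hpos hz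
  have hd := differentiableAt_frameDet hs
  have hsymm := blaschke_symm hU hF hg hpos hz
  have s1 := contDiffAt_dirDeriv hs 1
  have s2 := contDiffAt_dirDeriv hs Complex.I
  have d1 := s1.differentiableAt (by simp)
  have d2 := s2.differentiableAt (by simp)
  have d11 := (contDiffAt_dirDeriv s1 1).differentiableAt (by simp)
  have d12 := (contDiffAt_dirDeriv s2 1).differentiableAt (by simp)
  have d22 := (contDiffAt_dirDeriv s2 Complex.I).differentiableAt (by simp)
  -- The determinant with `F_x` and `F_y` extracts the component along `F` of a second derivative,
  -- which is the metric coefficient times `frameDet`. Differentiating these identities and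
  -- comparing third derivatives of `F` yields the Codazzi equations.
  have e11 : ∀ w ∈ U, det3 (dirDeriv F 1 w) (dirDeriv F Complex.I w)
      (dirDeriv (dirDeriv F 1) 1 w) = lam w * frameDet F w := fun w hw => by
    rw [dirDeriv_structure hU hF hg hw, frameDet]
    simp only [det3, Pi.add_apply, Pi.smul_apply, smul_eq_mul, map_one, mul_one, Complex.one_re]
    ring
  have e12 : ∀ w ∈ U, det3 (dirDeriv F 1 w) (dirDeriv F Complex.I w)
      (dirDeriv (dirDeriv F Complex.I) 1 w) = 0 := fun w hw => by
    rw [dirDeriv_structure hU hF hg hw]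
    simp only [det3, Pi.add_apply, Pi.smul_apply, smul_eq_mul, Complex.conj_I, one_mul,
      Complex.neg_re, Complex.I_re]
    ring
  have e22 : ∀ w ∈ U, det3 (dirDeriv F 1 w) (dirDeriv F Complex.I w)
      (dirDeriv (dirDeriv F Complex.I) Complex.I w) = lam w * frameDet F w := fun w hw => by
    rw [dirDeriv_structure hU hF hg hw, frameDet]
    simp only [det3, Pi.add_apply, Pi.smul_apply, smul_eq_mul, Complex.conj_I, mul_neg,
      Complex.I_mul_I, neg_neg, Complex.one_re]
    ring
  have ev {P Q : ℂ → ℝ} (h : ∀ w ∈ U, P w = Q w) (v : ℂ) : dirDeriv P v z = dirDeriv Q v z :=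
    dirDeriv_congr (Filter.eventually_of_mem (hU.mem_nhds hz) h) v
  have f11 := (fderiv_det3 d1 d2 d11 Complex.I).symm.trans (ev e11 Complex.I)
  have f12 := (fderiv_det3 d1 d2 d12 1).symm.trans (ev e12 1)
  have f12' := (fderiv_det3 d1 d2 d12 Complex.I).symm.trans (ev e12 Complex.I)
  have f22 := (fderiv_det3 d1 d2 d22 1).symm.trans (ev e22 1)
  rw [dirDeriv_mul hl hd, dirDeriv_frameDet hU hF hg hz] at f11 f22
  have z0 (v : ℂ) : dirDeriv (fun _ : ℂ => (0 : ℝ)) v z = 0 := by simp [dirDeriv]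
  rw [z0] at f12 f12'
  have t1 : fderiv ℝ (dirDeriv (dirDeriv F 1) 1) z Complex.I =
      fderiv ℝ (dirDeriv (dirDeriv F Complex.I) 1) z 1 := by
    have h1 := dirDeriv_comm s1 1 Complex.I
    have h3 : dirDeriv (dirDeriv F 1) Complex.I =ᶠ[𝓝 z] dirDeriv (dirDeriv F Complex.I) 1 := by
      filter_upwards [hU.mem_nhds hz] with w hw
      exact dirDeriv_comm (hF.smooth.contDiffAt (hU.mem_nhds hw)) _ _
    rw [dirDeriv_congr h3] at h1
    exact h1.symm
  have t2 : fderiv ℝ (dirDeriv (dirDeriv F Complex.I) 1) z Complex.I =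
      fderiv ℝ (dirDeriv (dirDeriv F Complex.I) Complex.I) z 1 :=
    dirDeriv_comm s2 Complex.I 1
  have y11 := dirDeriv_structure hU hF hg hz 1 1
  have y12 := dirDeriv_structure hU hF hg hz 1 Complex.I
  have y21 := dirDeriv_structure hU hF hg hz Complex.I 1
  have y22 := dirDeriv_structure hU hF hg hz Complex.I Complex.I
  simp only [map_one, mul_one, Complex.one_re, Complex.conj_I, one_mul, Complex.neg_re,
    Complex.I_re, neg_zero, mul_zero, mul_neg, Complex.I_mul_I, neg_neg] at y11 y12 y21 y22
  rw [hsymm] at y21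
  change det3 (dirDeriv (dirDeriv F 1) Complex.I z) _ _ +
    det3 _ (dirDeriv (dirDeriv F Complex.I) Complex.I z) _ + _ = _ at f11
  change det3 (dirDeriv (dirDeriv F 1) 1 z) _ _ +
    det3 _ (dirDeriv (dirDeriv F Complex.I) 1 z) _ + _ = _ at f12
  change det3 (dirDeriv (dirDeriv F 1) Complex.I z) _ _ +
    det3 _ (dirDeriv (dirDeriv F Complex.I) Complex.I z) _ + _ = _ at f12'
  change det3 (dirDeriv (dirDeriv F 1) 1 z) _ _ +
    det3 _ (dirDeriv (dirDeriv F Complex.I) 1 z) _ + _ = _ at f22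
  rw [t1, y11, y21, y22] at f11
  rw [y11, y12] at f12
  rw [t2, y12, y21, y22] at f12'
  rw [y11, y12, y22] at f22
  rw [hsymm] at f11
  rw [frameDet] at f11 f22
  simp only [det3, Pi.add_apply, Pi.smul_apply, smul_eq_mul] at f11 f12 f12' f22
  constructor
  · apply mul_right_cancel₀ hD
    simp only [frameDet, det3]
    -- By `t1` both equations contain the same determinant with a third derivative, so it drops out
    -- of the difference.
    linear_combination f12 - f11
  · apply mul_right_cancel₀ hD
    simp only [frameDet, det3]
    linear_combination f12' - f22

theorem dirDeriv_log (hU : IsOpen U) (hpos : ∀ z ∈ U, 0 < lam z) (hlam : ContDiffOn ℝ ∞ lam U)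
    {z : ℂ} (hz : z ∈ U) (v : ℂ) :
    dirDeriv (fun w => Real.log (lam w)) v z * lam z = dirDeriv lam v z := by
  have hl := (hlam.contDiffAt (hU.mem_nhds hz)).differentiableAt (by simp)
  have h : fderiv ℝ (fun w => Real.log (lam w)) z = _ := (hl.hasFDerivAt.log (hpos z hz).ne').fderiv
  simp only [dirDeriv, h, smul_apply, smul_eq_mul]
  have := (hpos z hz).ne'
  field_simp

/-- The components of the Blaschke connection of an affine sphere, in terms of the conformal
factor and the two components of `Γ(1, 1)`. -/
theorem blaschke_components (hU : IsOpen U) (hF : IsHyperbolicAffineSphere F U g Γ)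
    (hg : ∀ z ∈ U, ∀ v w, g z v w = lam z * (v * conj w).re) (hpos : ∀ z ∈ U, 0 < lam z)
    (hlam : ContDiffOn ℝ ∞ lam U) {z : ℂ} (hz : z ∈ U) :
    (Γ z 1 Complex.I).re = dirDeriv (fun w => Real.log (lam w)) Complex.I z + (Γ z 1 1).im ∧
    (Γ z 1 Complex.I).im = dirDeriv (fun w => Real.log (lam w)) 1 z - (Γ z 1 1).re ∧
    (Γ z Complex.I Complex.I).re = -(Γ z 1 1).re ∧
    (Γ z Complex.I Complex.I).im = -(Γ z 1 1).im := by
  have h1 := blaschke_trace hU hF hg hpos hlam hz 1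
  have h2 := blaschke_trace hU hF hg hpos hlam hz Complex.I
  obtain ⟨h3, h4⟩ := blaschke_codazzi hU hF hg hpos hlam hz
  rw [← dirDeriv_log hU hpos hlam hz] at h1 h2 h3 h4
  have hl := (hpos z hz).ne'
  replace h1 := mul_right_cancel₀ hl h1
  replace h2 := mul_right_cancel₀ hl h2
  replace h3 := mul_right_cancel₀ hl h3
  replace h4 := mul_right_cancel₀ hl h4
  rw [blaschke_symm hU hF hg hpos hz] at h2
  refine ⟨?_, ?_, ?_, ?_⟩ <;> linarith

/-- The trace `Γ(1,1) + Γ(i,i)` vanishes, so the trace of the structure equation has only its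
component along `F`. -/
theorem laplacian_affine_sphere (hU : IsOpen U) (hF : IsHyperbolicAffineSphere F U g Γ)
    (hg : ∀ z ∈ U, ∀ v w, g z v w = lam z * (v * conj w).re) (hpos : ∀ z ∈ U, 0 < lam z)
    (hlam : ContDiffOn ℝ ∞ lam U) {z : ℂ} (hz : z ∈ U) :
    dirDeriv (dirDeriv F 1) 1 z + dirDeriv (dirDeriv F Complex.I) Complex.I z =
      (2 * lam z) • F z := by
  obtain ⟨-, -, h3, h4⟩ := blaschke_components hU hF hg hpos hlam hz
  rw [dirDeriv_structure hU hF hg hz, dirDeriv_structure hU hF hg hz, h3, h4]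
  ext i
  simp
  ring

/-- This eliminates the third derivatives of `F` from the Laplacian of the frame determinant. -/
theorem laplacian_affine_sphere_deriv (hU : IsOpen U) (hF : IsHyperbolicAffineSphere F U g Γ)
    (hg : ∀ z ∈ U, ∀ v w, g z v w = lam z * (v * conj w).re) (hpos : ∀ z ∈ U, 0 < lam z)
    (hlam : ContDiffOn ℝ ∞ lam U) {z : ℂ} (hz : z ∈ U) (v : ℂ) :
    dirDeriv (dirDeriv (dirDeriv F 1) 1) v z +
      dirDeriv (dirDeriv (dirDeriv F Complex.I) Complex.I) v z =
      (2 * lam z) • dirDeriv F v z + (2 * dirDeriv lam v z) • F z := by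
  have hs := hF.smooth.contDiffAt (hU.mem_nhds hz)
  have hl := (hlam.contDiffAt (hU.mem_nhds hz)).differentiableAt (by simp)
  have d11 := (contDiffAt_dirDeriv (contDiffAt_dirDeriv hs 1) 1).differentiableAt (by simp)
  have d22 := (contDiffAt_dirDeriv (contDiffAt_dirDeriv hs Complex.I)
    Complex.I).differentiableAt (by simp)
  have hev : (fun w => dirDeriv (dirDeriv F 1) 1 w + dirDeriv (dirDeriv F Complex.I) Complex.I w)
      =ᶠ[𝓝 z] fun w => (2 * lam w) • F w := by
    filter_upwards [hU.mem_nhds hz] with w hw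
    exact laplacian_affine_sphere hU hF hg hpos hlam hw
  have h1 : fderiv ℝ (fun w => dirDeriv (dirDeriv F 1) 1 w +
      dirDeriv (dirDeriv F Complex.I) Complex.I w) z = _ :=
    (d11.hasFDerivAt.add d22.hasFDerivAt).fderiv
  have h2 : fderiv ℝ (fun w => (2 * lam w) • F w) z = _ :=
    ((hl.hasFDerivAt.const_mul 2).smul (hs.differentiableAt (by simp)).hasFDerivAt).fderiv
  have h3 := congrArg (fun L => L v) (h1.symm.trans (hev.fderiv_eq.trans h2))
  simpa [dirDeriv] using h3

theorem dirDeriv_add {E : Type*} [NormedAddCommGroup E] [NormedSpace ℝ E] {u v : ℂ → E} {z : ℂ} (hu : DifferentiableAt ℝ u z)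
    (hv : DifferentiableAt ℝ v z) (w : ℂ) :
    dirDeriv (fun x => u x + v x) w z = dirDeriv u w z + dirDeriv v w z := by
  have h : fderiv ℝ (fun x => u x + v x) z = _ := (hu.hasFDerivAt.add hv.hasFDerivAt).fderiv
  simp only [dirDeriv, h, add_apply]

theorem differentiableAt_det3 {A B C : ℂ → Fin 3 → ℝ} {z : ℂ} (hA : DifferentiableAt ℝ A z)
    (hB : DifferentiableAt ℝ B z) (hC : DifferentiableAt ℝ C z) :
    DifferentiableAt ℝ (fun w => det3 (A w) (B w) (C w)) z := by
  have a := differentiableAt_pi.1 hA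
  have b := differentiableAt_pi.1 hB
  have c := differentiableAt_pi.1 hC
  unfold det3
  fun_prop

/-- The second derivatives of the frame determinant. -/
theorem dirDeriv_dirDeriv_frameDet {F : ℂ → Fin 3 → ℝ} {z : ℂ}
    (hs : ∀ᶠ w in 𝓝 z, ContDiffAt ℝ ∞ F w) (v : ℂ) :
    dirDeriv (dirDeriv (frameDet F) v) v z =
      det3 (dirDeriv (dirDeriv (dirDeriv F 1) v) v z) (dirDeriv F Complex.I z) (F z) +
      2 * det3 (dirDeriv (dirDeriv F 1) v z) (dirDeriv (dirDeriv F Complex.I) v z) (F z) +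
      2 * det3 (dirDeriv (dirDeriv F 1) v z) (dirDeriv F Complex.I z) (dirDeriv F v z) +
      det3 (dirDeriv F 1 z) (dirDeriv (dirDeriv (dirDeriv F Complex.I) v) v z) (F z) +
      2 * det3 (dirDeriv F 1 z) (dirDeriv (dirDeriv F Complex.I) v z) (dirDeriv F v z) +
      det3 (dirDeriv F 1 z) (dirDeriv F Complex.I z) (dirDeriv (dirDeriv F v) v z) := by
  have hz := hs.self_of_nhds
  have s1 := contDiffAt_dirDeriv hz 1
  have s2 := contDiffAt_dirDeriv hz Complex.I
  have d0 := hz.differentiableAt (by simp)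
  have d1 := s1.differentiableAt (by simp)
  have d2 := s2.differentiableAt (by simp)
  have dv := (contDiffAt_dirDeriv hz v).differentiableAt (by simp)
  have d1v := (contDiffAt_dirDeriv s1 v).differentiableAt (by simp)
  have d2v := (contDiffAt_dirDeriv s2 v).differentiableAt (by simp)
  have hev : dirDeriv (frameDet F) v =ᶠ[𝓝 z] fun w =>
      det3 (dirDeriv (dirDeriv F 1) v w) (dirDeriv F Complex.I w) (F w) +
      det3 (dirDeriv F 1 w) (dirDeriv (dirDeriv F Complex.I) v w) (F w) +
      det3 (dirDeriv F 1 w) (dirDeriv F Complex.I w) (dirDeriv F v w) := by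
    filter_upwards [hs] with w hw
    exact fderiv_det3 ((contDiffAt_dirDeriv hw 1).differentiableAt (by simp))
      ((contDiffAt_dirDeriv hw Complex.I).differentiableAt (by simp))
      (hw.differentiableAt (by simp)) v
  rw [dirDeriv_congr hev, dirDeriv_add ((differentiableAt_det3 d1v d2 d0).fun_add
    (differentiableAt_det3 d1 d2v d0)) (differentiableAt_det3 d1 d2 dv),
    dirDeriv_add (differentiableAt_det3 d1v d2 d0) (differentiableAt_det3 d1 d2v d0)]
  have f1 : dirDeriv _ v z = _ := fderiv_det3 d1v d2 d0 v
  have f2 : dirDeriv _ v z = _ := fderiv_det3 d1 d2v d0 v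
  have f3 : dirDeriv _ v z = _ := fderiv_det3 d1 d2 dv v
  rw [f1, f2, f3]
  simp only [dirDeriv]
  ring

/-- Since `frameDet = ±λ`, the Laplacian of `log λ` can be read from that of `frameDet`, which is
also computable by the product rule for determinants. What remains after eliminating third
derivatives is a polynomial in `λ`, the first derivatives of `log λ` and `Γ(1,1)`; the bracket is
the squared length of the difference tensor's one free complex component. -/
theorem laplacian_log_blaschke (hU : IsOpen U) (hF : IsHyperbolicAffineSphere F U g Γ)
    (hg : ∀ z ∈ U, ∀ v w, g z v w = lam z * (v * conj w).re) (hpos : ∀ z ∈ U, 0 < lam z)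
    (hlam : ContDiffOn ℝ ∞ lam U) {z : ℂ} (hz : z ∈ U) :
    dirDeriv (dirDeriv (fun w => Real.log (lam w)) 1) 1 z +
      dirDeriv (dirDeriv (fun w => Real.log (lam w)) Complex.I) Complex.I z =
    2 * lam z - 4 * (((Γ z 1 1).re - dirDeriv (fun w => Real.log (lam w)) 1 z / 2) ^ 2 +
      ((Γ z 1 1).im + dirDeriv (fun w => Real.log (lam w)) Complex.I z / 2) ^ 2) := by
  set psi := fun w => Real.log (lam w) with hpsi
  have hs := hF.smooth.contDiffAt (hU.mem_nhds hz)
  have hev : ∀ᶠ w in 𝓝 z, ContDiffAt ℝ ∞ F w := by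
    filter_upwards [hU.mem_nhds hz] with w hw
    exact hF.smooth.contDiffAt (hU.mem_nhds hw)
  have hp : ContDiffAt ℝ ∞ psi z :=
    (hlam.contDiffAt (hU.mem_nhds hz)).log (hpos z hz).ne'
  have hD := frameDet_ne_zero hF hg hpos hz
  have hd := differentiableAt_frameDet hs
  have hsymm := blaschke_symm hU hF hg hpos hz
  have s1 := contDiffAt_dirDeriv hs 1
  have s2 := contDiffAt_dirDeriv hs Complex.I
  have hlog (v : ℂ) : dirDeriv (frameDet F) v =ᶠ[𝓝 z] fun w => dirDeriv psi v w * frameDet F w := by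
    filter_upwards [hU.mem_nhds hz] with w hw
    rw [dirDeriv_frameDet hU hF hg hw]
    congr 1
    apply mul_right_cancel₀ (hpos w hw).ne'
    rw [dirDeriv_log hU hpos hlam hw, blaschke_trace hU hF hg hpos hlam hw]
  have hL (v : ℂ) : dirDeriv (dirDeriv (frameDet F) v) v z =
      (dirDeriv psi v z ^ 2 + dirDeriv (dirDeriv psi v) v z) * frameDet F z := by
    rw [dirDeriv_congr (hlog v), dirDeriv_mul ((contDiffAt_dirDeriv hp v).differentiableAt
      (by simp)) hd, (hlog v).eq_of_nhds]
    ring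
  have e1 := (hL 1).symm.trans (dirDeriv_dirDeriv_frameDet hev 1)
  have e2 := (hL Complex.I).symm.trans (dirDeriv_dirDeriv_frameDet hev Complex.I)
  have hcomm : dirDeriv (dirDeriv F 1) Complex.I =ᶠ[𝓝 z] dirDeriv (dirDeriv F Complex.I) 1 := by
    filter_upwards [hev] with w hw
    exact dirDeriv_comm hw _ _
  -- Reordering turns `F_xyy` into `∂_x F_yy` and `F_yxx` into `∂_y F_xx`, so that the third
  -- derivatives enter only through `∂_x (ΔF)` and `∂_y (ΔF)`.
  have t1 : dirDeriv (dirDeriv (dirDeriv F 1) Complex.I) Complex.I z =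
      dirDeriv (dirDeriv (dirDeriv F Complex.I) Complex.I) 1 z := by
    rw [dirDeriv_congr hcomm, dirDeriv_comm s2]
  have t2 : dirDeriv (dirDeriv (dirDeriv F Complex.I) 1) 1 z =
      dirDeriv (dirDeriv (dirDeriv F 1) 1) Complex.I z := by
    rw [← dirDeriv_congr hcomm, dirDeriv_comm s1]
  have l1 := laplacian_affine_sphere_deriv hU hF hg hpos hlam hz 1
  have l2 := laplacian_affine_sphere_deriv hU hF hg hpos hlam hz Complex.I
  rw [← eq_sub_iff_add_eq'] at l1 l2
  rw [t2] at e1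
  rw [t1, l1, l2] at e2
  have y11 := dirDeriv_structure hU hF hg hz 1 1
  have y12 := dirDeriv_structure hU hF hg hz 1 Complex.I
  have y21 := dirDeriv_structure hU hF hg hz Complex.I 1
  have y22 := dirDeriv_structure hU hF hg hz Complex.I Complex.I
  obtain ⟨c1, c2, c3, c4⟩ := blaschke_components hU hF hg hpos hlam hz
  simp only [map_one, mul_one, Complex.one_re, Complex.conj_I, one_mul, Complex.neg_re,
    Complex.I_re, neg_zero, mul_zero, mul_neg, Complex.I_mul_I, neg_neg] at y11 y12 y21 y22
  rw [hsymm] at y21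
  rw [c1, c2] at y12 y21
  rw [c3, c4] at y22
  rw [y11, y12] at e1
  rw [y21, y22] at e2
  rw [frameDet] at hD e1 e2
  apply mul_right_cancel₀ hD
  simp only [det3, Pi.add_apply, Pi.smul_apply, Pi.sub_apply, smul_eq_mul] at e1 e2 ⊢
  linear_combination e1 + e2

/-- **Wang's equation** for the Blaschke metric and the Pick differential of a hyperbolic affine
sphere. -/
theorem wang_equation (hU : IsOpen U) (hF : IsHyperbolicAffineSphere F U g Γ)
    (hg : ∀ z ∈ U, ∀ v w, g z v w = lam z * (v * conj w).re) (hpos : ∀ z ∈ U, 0 < lam z)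
    (hlam : ContDiffOn ℝ ∞ lam U) {q : ℂ → ℂ}
    (hq : ∀ z ∈ U, q z =
      (lam z : ℂ) * zbarComponent (fun v w => Γ z v w - leviCivita lam z v w))
    {z : ℂ} (hz : z ∈ U) :
    dbar2 (wz fun w => Real.log (lam w)) z = ((lam z - 2 * ‖q z‖ ^ 2 / lam z ^ 2 : ℝ) : ℂ) := by
  have hp : ContDiffAt ℝ ∞ (fun w => Real.log (lam w)) z :=
    (hlam.contDiffAt (hU.mem_nhds hz)).log (hpos z hz).ne'
  have h0 : (fderiv ℝ (fun w => fderiv ℝ (fun w => Real.log (lam w)) w 1) z 1 +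
      fderiv ℝ (fun w => fderiv ℝ (fun w => Real.log (lam w)) w Complex.I) z Complex.I) = _ :=
    laplacian_log_blaschke hU hF hg hpos hlam hz
  obtain ⟨c1, c2, c3, c4⟩ := blaschke_components hU hF hg hpos hlam hz
  have hsymm := blaschke_symm hU hF hg hpos hz
  -- The squared modulus of this number `C` is the bracket in `laplacian_log_blaschke`. As `|q| =
  -- λ|C|`, half of that Laplacian is `λ - 2|q|²/λ²`.
  have hC : zbarComponent (fun v w => Γ z v w - leviCivita lam z v w) =
      (((Γ z 1 1).re - dirDeriv (fun w => Real.log (lam w)) 1 z / 2 : ℝ) : ℂ) -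
        Complex.I * ((Γ z 1 1).im + dirDeriv (fun w => Real.log (lam w)) Complex.I z / 2 : ℝ) := by
    simp only [zbarComponent, leviCivita]
    simp only [dirDeriv] at c1 c2 c3 c4 ⊢
    rw [hsymm]
    apply Complex.ext
    · simp [c1, c2, c3]
      ring
    · simp [c1, c2, c4]
      ring
  rw [dbar2_wz hp, h0, hq z hz, hC, norm_mul, mul_pow, ← Complex.normSq_eq_norm_sq (_ - _),
    Complex.normSq_apply]
  have hl := (hpos z hz).ne'
  simp only [Complex.norm_real, Real.norm_eq_abs, sq_abs]
  simp
  have hl' : (lam z : ℂ) ≠ 0 := by exact_mod_cast hl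
  field_simp
  ring

end Structure

/-! ### Change of holomorphic coordinates -/

section Coordinates

/-- The inhomogeneous term of the connection transformation law is the `∂_z`-derivative of `log
|g'|²`. -/
theorem wz_log_pullback {lam lam' : ℂ → ℝ} {g : ℂ → ℂ} {z : ℂ} (hg : AnalyticAt ℂ g z)
    (hlam : ContDiffAt ℝ ∞ lam (g z)) (hpos : 0 < lam (g z)) (hg0 : deriv g z ≠ 0)
    (h : ∀ᶠ w in 𝓝 z, lam' w = lam (g w) * ‖deriv g w‖ ^ 2) :
    wz (fun w => Real.log (lam' w)) z =
      wz (fun w => Real.log (lam w)) (g z) * deriv g z + deriv (deriv g) z / deriv g z := by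
  have hd := hg.differentiableAt
  have hd' := hg.deriv.differentiableAt
  have hl : DifferentiableAt ℝ (fun w => Real.log (lam w)) (g z) :=
    (hlam.differentiableAt (by simp)).log hpos.ne'
  have hev : (fun w => Real.log (lam' w)) =ᶠ[𝓝 z]
      fun w => Real.log (lam (g w)) + Real.log (‖deriv g w‖ ^ 2) := by
    have h1 : ∀ᶠ w in 𝓝 z, 0 < lam (g w) :=
      (hlam.continuousAt.comp_of_eq hd.continuousAt rfl).eventually (lt_mem_nhds hpos)
    have h2 : ∀ᶠ w in 𝓝 z, deriv g w ≠ 0 := hd'.continuousAt.eventually_ne hg0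
    filter_upwards [h, h1, h2] with w h h1 h2
    rw [h, Real.log_mul h1.ne' (by simpa using h2)]
  obtain ⟨h3, h4⟩ := hasFDerivAt_log_norm_sq hd' hg0
  have h5 : DifferentiableAt ℝ (fun w => Real.log (lam (g w))) z :=
    hl.comp z (hd.restrictScalars ℝ)
  rw [wz_congr hev, wz_add h5 h3, h4, wz_comp hd hl]

/-- The inhomogeneous term `g''/g'` is holomorphic and is therefore killed: curvature transforms as
a 2-form. -/
theorem dbar2_wz_log_pullback {lam lam' : ℂ → ℝ} {g : ℂ → ℂ} {z : ℂ} (hg : AnalyticAt ℂ g z)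
    (hlam' : ∀ᶠ w in 𝓝 (g z), ContDiffAt ℝ ∞ lam w) (hpos : 0 < lam (g z)) (hg0 : deriv g z ≠ 0)
    (h : ∀ᶠ w in 𝓝 z, lam' w = lam (g w) * ‖deriv g w‖ ^ 2) :
    dbar2 (wz fun w => Real.log (lam' w)) z =
      dbar2 (wz fun w => Real.log (lam w)) (g z) * ((‖deriv g z‖ ^ 2 : ℝ) : ℂ) := by
  have hd := hg.differentiableAt
  have hd' := hg.deriv.differentiableAt
  have hd'' := hg.deriv.deriv.differentiableAt
  have hlam := hlam'.self_of_nhds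
  have hev : (wz fun w => Real.log (lam' w)) =ᶠ[𝓝 z] fun w =>
      wz (fun w => Real.log (lam w)) (g w) * deriv g w + deriv (deriv g) w / deriv g w := by
    have h0 : ∀ᶠ w in 𝓝 z, ContDiffAt ℝ ∞ lam (g w) := hd.continuousAt.eventually hlam'
    have h1 : ∀ᶠ w in 𝓝 z, 0 < lam (g w) :=
      (hlam.continuousAt.comp_of_eq hd.continuousAt rfl).eventually (lt_mem_nhds hpos)
    have h2 : ∀ᶠ w in 𝓝 z, deriv g w ≠ 0 := hd'.continuousAt.eventually_ne hg0
    filter_upwards [h.eventually_nhds, h0, h1, h2, hg.eventually_analyticAt] with w h h0 h1 h2 h3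
    exact wz_log_pullback h3 h0 h1 h2 h
  have hφ : DifferentiableAt ℝ (wz fun w => Real.log (lam w)) (g z) :=
    (contDiffAt_wz (hlam.log hpos.ne')).differentiableAt (by simp)
  have hq : DifferentiableAt ℂ (fun w => deriv (deriv g) w / deriv g w) z := hd''.div hd' hg0
  have hc : DifferentiableAt ℝ (fun w => wz (fun w => Real.log (lam w)) (g w)) z :=
    hφ.comp z (hd.restrictScalars ℝ)
  rw [dbar2_congr hev, dbar2_add (hc.fun_mul
    (hd'.restrictScalars ℝ)) (hq.restrictScalars ℝ), dbar2_of_differentiableAt hq]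
  have := dbar2_comp_mul hd hd' hφ
  rw [this, Complex.sq_norm, Complex.normSq_eq_conj_mul_self]
  ring

end Coordinates

theorem eventually_mem_transition {S : Type*} [TopologicalSpace S]
    {e e' : OpenPartialHomeomorph S ℂ} {z : ℂ}
    (hz : z ∈ (e.symm.trans e').source) : ∀ᶠ w in 𝓝 z, w ∈ (e.symm.trans e').source :=
  (e.symm.trans e').open_source.mem_nhds hz

/-! ### Connection and curvature of a conformal metric in the charts of a surface -/

section Charts

variable {S : Type*} [TopologicalSpace S] [ChartedSpace ℂ S]

/-- A zero of the derivative would make the metric coefficient vanish by its transformation rule,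
against positivity. -/
theorem deriv_transition_ne_zero (h : ConformalMetric S) {e e' : OpenPartialHomeomorph S ℂ}
    (he : e ∈ atlas ℂ S) (he' : e' ∈ atlas ℂ S) {z : ℂ} (hz : z ∈ (e.symm.trans e').source) :
    deriv (fun w => e' (e.symm w)) z ≠ 0 := by
  intro h0
  have h1 : z ∈ e.target ∧ e.symm z ∈ e'.source := by simpa using hz
  have h2 := h.pos e he z h1.1
  rw [h.transform e he e' he' z hz, h0] at h2
  simp at h2

/-- The connection form `ψ_z` of the Levi-Civita connection of a conformal metric, in a chart. -/
def ConformalMetric.conn (h : ConformalMetric S) (e : OpenPartialHomeomorph S ℂ) : ℂ → ℂ :=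
  wz fun w => Real.log (h.coeff e w)

/-- The coefficient of `-K dA`, where `K` is the curvature of a conformal metric. -/
def ConformalMetric.curv (h : ConformalMetric S) (e : OpenPartialHomeomorph S ℂ) (z : ℂ) : ℝ :=
  (dbar2 (h.conn e) z).re

theorem ConformalMetric.contDiffAt (h : ConformalMetric S) {e : OpenPartialHomeomorph S ℂ}
    (he : e ∈ atlas ℂ S) {z : ℂ} (hz : z ∈ e.target) : ContDiffAt ℝ ∞ (h.coeff e) z :=
  (h.smooth e he).contDiffAt (e.open_target.mem_nhds hz)

theorem ConformalMetric.eventually_contDiffAt (h : ConformalMetric S)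
    {e : OpenPartialHomeomorph S ℂ} (he : e ∈ atlas ℂ S) {z : ℂ} (hz : z ∈ e.target) :
    ∀ᶠ w in 𝓝 z, ContDiffAt ℝ ∞ (h.coeff e) w := by
  filter_upwards [e.open_target.mem_nhds hz] with w hw using h.contDiffAt he hw

theorem ConformalMetric.contDiffAt_conn (h : ConformalMetric S) {e : OpenPartialHomeomorph S ℂ}
    (he : e ∈ atlas ℂ S) {z : ℂ} (hz : z ∈ e.target) : ContDiffAt ℝ ∞ (h.conn e) z :=
  contDiffAt_wz ((h.contDiffAt he hz).log (h.pos e he z hz).ne')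

theorem ConformalMetric.dbar2_conn (h : ConformalMetric S) {e : OpenPartialHomeomorph S ℂ}
    (he : e ∈ atlas ℂ S) {z : ℂ} (hz : z ∈ e.target) : dbar2 (h.conn e) z = h.curv e z := by
  rw [curv, conn, dbar2_wz ((h.contDiffAt he hz).log (h.pos e he z hz).ne')]
  apply Complex.ext <;> simp

variable [IsManifold 𝓘(ℂ) ω S]
  {X : Type*} [TopologicalSpace X] [ChartedSpace ℂ X] [IsManifold 𝓘(ℂ) ω X]

theorem analyticAt_written_in_charts {p : X → S} (hp : MDifferentiable 𝓘(ℂ) 𝓘(ℂ) p)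
    {c : OpenPartialHomeomorph X ℂ} (hc : c ∈ atlas ℂ X) {e : OpenPartialHomeomorph S ℂ}
    (he : e ∈ atlas ℂ S) {z : ℂ} (hz : z ∈ c.target) (hpz : p (c.symm z) ∈ e.source) :
    AnalyticAt ℂ (fun w => e (p (c.symm w))) z := by
  have : IsManifold 𝓘(ℂ) 1 S := IsManifold.of_le (n := ω) le_top
  have : IsManifold 𝓘(ℂ) 1 X := IsManifold.of_le (n := ω) le_top
  rw [Complex.analyticAt_iff_eventually_differentiableAt]
  have h1 : ∀ᶠ w in 𝓝 z, w ∈ c.target := c.open_target.mem_nhds hz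
  have h2 : ∀ᶠ w in 𝓝 z, p (c.symm w) ∈ e.source :=
    ((hp.continuous.continuousAt.comp (c.continuousAt_symm hz))).eventually
      (e.open_source.mem_nhds hpz)
  filter_upwards [h1, h2] with w hw hpw
  have := (mdifferentiableWithinAt_iff_of_mem_maximalAtlas (s := Set.univ) (f := p)
    (I := 𝓘(ℂ)) (I' := 𝓘(ℂ)) (x := c.symm w)
    (IsManifold.subset_maximalAtlas hc) (IsManifold.subset_maximalAtlas he)
    (c.map_target hw) hpw).1 (hp _).mdifferentiableWithinAt
  have h3 := this.2
  simp only [mfld_simps, differentiableWithinAt_univ] at h3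
  rw [c.right_inv hw] at h3
  exact h3

theorem analyticAt_transition {e e' : OpenPartialHomeomorph S ℂ} (he : e ∈ atlas ℂ S)
    (he' : e' ∈ atlas ℂ S) {z : ℂ} (hz : z ∈ (e.symm.trans e').source) :
    AnalyticAt ℂ (fun w => e' (e.symm w)) z := by
  have : z ∈ e.target ∧ e.symm z ∈ e'.source := by simpa using hz
  exact analyticAt_written_in_charts (p := id) mdifferentiable_id he he' this.1 this.2

theorem ConformalMetric.conn_transform (h : ConformalMetric S) {e e' : OpenPartialHomeomorph S ℂ}
    (he : e ∈ atlas ℂ S) (he' : e' ∈ atlas ℂ S) {z : ℂ} (hz : z ∈ (e.symm.trans e').source) :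
    h.conn e z = h.conn e' (e' (e.symm z)) * deriv (fun w => e' (e.symm w)) z +
      deriv (deriv (fun w => e' (e.symm w))) z / deriv (fun w => e' (e.symm w)) z := by
  have h1 : z ∈ e.target ∧ e.symm z ∈ e'.source := by simpa using hz
  have h2 := e'.map_source h1.2
  have := wz_log_pullback (analyticAt_transition he he' hz) (h.contDiffAt he' h2)
    (h.pos e' he' _ h2) (deriv_transition_ne_zero h he he' hz) (lam' := h.coeff e) (by
      filter_upwards [eventually_mem_transition hz] with w hw using h.transform e he e' he' w hw)
  exact this

theorem ConformalMetric.curv_transform (h : ConformalMetric S) {e e' : OpenPartialHomeomorph S ℂ}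
    (he : e ∈ atlas ℂ S) (he' : e' ∈ atlas ℂ S) {z : ℂ} (hz : z ∈ (e.symm.trans e').source) :
    h.curv e z = h.curv e' (e' (e.symm z)) * ‖deriv (fun w => e' (e.symm w)) z‖ ^ 2 := by
  have h1 : z ∈ e.target ∧ e.symm z ∈ e'.source := by simpa using hz
  have h2 := e'.map_source h1.2
  have := dbar2_wz_log_pullback (analyticAt_transition he he' hz) (h.eventually_contDiffAt he' h2)
    (h.pos e' he' _ h2) (deriv_transition_ne_zero h he he' hz) (lam' := h.coeff e) (by
      filter_upwards [eventually_mem_transition hz] with w hw using h.transform e he e' he' w hw)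
  change dbar2 (h.conn e) z = dbar2 (h.conn e') _ * _ at this
  rw [h.dbar2_conn he h1.1, h.dbar2_conn he' h2] at this
  exact_mod_cast this

end Charts

theorem surjective_of_isCoveringMap {X S : Type*} [TopologicalSpace X] [TopologicalSpace S]
    [ConnectedSpace S] [Nonempty X] {p : X → S} (hp : IsCoveringMap p) :
    Function.Surjective p := by
  rw [← Set.range_eq_univ]
  refine IsClopen.eq_univ ⟨?_, hp.isOpenMap.isOpen_range⟩ (Set.range_nonempty p)
  rw [← isOpen_compl_iff, isOpen_iff_mem_nhds]
  intro x hx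
  obtain ⟨-, U, hxU, hU, -, H, hH⟩ := hp x
  refine Filter.mem_of_superset (hU.mem_nhds hxU) ?_
  rintro y hy ⟨w, rfl⟩
  -- The discrete factor of the trivialization is the fibre over `x`, so a point over any `y ∈ U`
  -- produces a point over `x`. This makes the complement of the range open.
  exact hx ⟨(H ⟨w, hy⟩).2.1, (H ⟨w, hy⟩).2.2⟩

/-! ### Descent of Wang's equation to the quotient surface -/

section Quotient

variable {S : Type*} [TopologicalSpace S] [ConnectedSpace S]
  [ChartedSpace ℂ S] [IsManifold 𝓘(ℂ) ω S]
  {X : Type*} [TopologicalSpace X] [Nonempty X] [ChartedSpace ℂ X] [IsManifold 𝓘(ℂ) ω X]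
  {p : X → S} {f : X → Fin 3 → ℝ} {ρ : deckGroup p →* Matrix.SpecialLinearGroup (Fin 3) ℝ}
  {h : ConformalMetric S} {q : CubicDifferential S}

/-- Wang's equation on the quotient surface. -/
theorem IsQuotientAffineSphere.curv_eq (hf : IsQuotientAffineSphere p f ρ h q)
    {e : OpenPartialHomeomorph S ℂ} (he : e ∈ atlas ℂ S) {z : ℂ} (hz : z ∈ e.target) :
    h.curv e z = h.coeff e z - 2 * ‖q.coeff e z‖ ^ 2 / h.coeff e z ^ 2 := by
  obtain ⟨h', q', hh, hq, hbp⟩ := hf.blaschke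
  obtain ⟨x, hx⟩ := surjective_of_isCoveringMap hf.covering (e.symm z)
  set c := chartAt ℂ x
  have hc : c ∈ atlas ℂ X := chart_mem_atlas ℂ x
  have hxc : c.symm (c x) = x := c.left_inv (mem_chart_source ℂ x)
  have hcx : c x ∈ c.target := c.map_source (mem_chart_source ℂ x)
  have hpx : p (c.symm (c x)) ∈ e.source := by rw [hxc, hx]; exact e.map_target hz
  have hgz : e (p (c.symm (c x))) = z := by rw [hxc, hx]; exact e.right_inv hz
  have hg := analyticAt_written_in_charts hf.holo hc he hcx hpx
  have hev : ∀ᶠ w in 𝓝 (c x), h'.coeff c w =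
      h.coeff e (e (p (c.symm w))) * ‖deriv (fun w => e (p (c.symm w))) w‖ ^ 2 := by
    have h1 : ∀ᶠ w in 𝓝 (c x), w ∈ c.target := c.open_target.mem_nhds hcx
    have h2 : ∀ᶠ w in 𝓝 (c x), p (c.symm w) ∈ e.source :=
      ((hf.holo.continuous.continuousAt.comp (c.continuousAt_symm hcx))).eventually
        (e.open_source.mem_nhds hpx)
    filter_upwards [h1, h2] with w h1 h2 using hh c hc e he w h1 h2
  have hpos' := h'.pos c hc _ hcx
  -- Positivity of the lifted metric shows that the covering projection has no critical point.
  have hg0 : deriv (fun w => e (p (c.symm w))) (c x) ≠ 0 := by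
    intro h0
    rw [hev.self_of_nhds, h0] at hpos'
    simp at hpos'
  have hpos := h.pos e he z hz
  have ht := dbar2_wz_log_pullback hg (lam := h.coeff e) (by rw [hgz]; exact h.eventually_contDiffAt he hz)
    (by rw [hgz]; exact hpos) hg0 hev
  obtain ⟨g, Γ, hs, hgm, hqc⟩ := hbp c hc
  have hw := wang_equation c.open_target hs hgm (h'.pos c hc) (h'.smooth c hc) hqc hcx
  rw [hgz] at ht
  rw [ht] at hw
  change dbar2 (h.conn e) z * _ = _ at hw
  rw [h.dbar2_conn he hz] at hw
  have hw' := Complex.ofReal_injective ((Complex.ofReal_mul _ _).trans hw)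
  have hq1 := hq c hc e he _ hcx hpx
  have hl1 := hh c hc e he _ hcx hpx
  rw [hgz] at hq1 hl1
  rw [hq1, hl1, norm_mul, norm_pow] at hw'
  have hn : ‖deriv (fun w => e (p (c.symm w))) (c x)‖ ≠ 0 := by simpa using hg0
  -- Both sides of the equation upstairs are those downstairs multiplied by `|p'|²`.
  apply mul_right_cancel₀ (pow_ne_zero 2 hn)
  rw [hw']
  field_simp

end Quotient

/-! ### The maximum principle -/

/-- A positive second derivative would make `x` a local minimum as well, hence `u` constant near `x`
and the second derivative zero. -/
theorem deriv_deriv_nonpos_of_isLocalMax {u : ℝ → ℝ} {x : ℝ} (h : IsLocalMax u x)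
    (hc : ContinuousAt u x) : deriv (deriv u) x ≤ 0 := by
  by_contra! hpos
  have h0 := h.deriv_eq_zero
  have hmin := isLocalMin_of_deriv_deriv_pos hpos h0 hc
  have hev : u =ᶠ[𝓝 x] fun _ => u x := by
    filter_upwards [h, hmin] with y h1 h2 using le_antisymm h1 h2
  have : deriv u =ᶠ[𝓝 x] fun _ => 0 := by
    filter_upwards [hev.eventually_nhds] with y hy
    rw [Filter.EventuallyEq.deriv_eq hy]; simp
  rw [this.deriv_eq] at hpos
  simp at hpos

theorem fderiv_fderiv_nonpos_of_isLocalMax {u : ℂ → ℝ} {z : ℂ}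
    (hu' : ∀ᶠ w in 𝓝 z, ContDiffAt ℝ ∞ u w) (h : IsLocalMax u z) (v : ℂ) : fderiv ℝ (fun w => fderiv ℝ u w v) z v ≤ 0 := by
  have hu := hu'.self_of_nhds
  have hline : ∀ t : ℝ, HasDerivAt (fun s : ℝ => z + s • v) v t := fun t => by
    simpa using ((hasDerivAt_id t).smul_const v).const_add z
  have hcont : Continuous (fun s : ℝ => z + s • v) := by fun_prop
  have hz : z + (0 : ℝ) • v = z := by simp
  have htend : Filter.Tendsto (fun s : ℝ => z + s • v) (𝓝 0) (𝓝 z) := by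
    simpa using hcont.tendsto 0
  have hmax : IsLocalMax (fun s : ℝ => u (z + s • v)) 0 := by
    have := htend.eventually h
    simpa [IsLocalMax, IsMaxFilter, hz] using this
  have hd : ∀ᶠ t : ℝ in 𝓝 0, deriv (fun s : ℝ => u (z + s • v)) t = fderiv ℝ u (z + t • v) v := by
    filter_upwards [htend.eventually hu'] with t ht
    exact ((ht.differentiableAt (by simp)).hasFDerivAt.comp_hasDerivAt t (hline t)).deriv
  have h2 := deriv_deriv_nonpos_of_isLocalMax hmax
    (ContinuousAt.comp_of_eq hu.continuousAt hcont.continuousAt hz)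
  have hdd : DifferentiableAt ℝ (fun w => fderiv ℝ u w v) z :=
    (contDiffAt_dirDeriv hu v).differentiableAt (by simp)
  have h3 : HasDerivAt (fun t : ℝ => fderiv ℝ u (z + t • v) v) _ 0 :=
    HasFDerivAt.comp_hasDerivAt_of_eq (0 : ℝ) hdd.hasFDerivAt (hline 0) hz.symm
  rw [Filter.EventuallyEq.deriv_eq hd, h3.deriv] at h2
  exact h2

section MaximumPrinciple

variable {S : Type*} [TopologicalSpace S] [ChartedSpace ℂ S]

/-- The function `2 |q|² / h³` on the surface. -/
def pickRatio (h : ConformalMetric S) (q : CubicDifferential S) (x : S) : ℝ :=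
  2 * ‖q.coeff (chartAt ℂ x) (chartAt ℂ x x)‖ ^ 2 / h.coeff (chartAt ℂ x) (chartAt ℂ x x) ^ 3

/-- Both `|q|²` and `h³` scale by the sixth power of the modulus of the transition derivative, so
the ratio is a function on the surface. -/
theorem pickRatio_eq (h : ConformalMetric S) (q : CubicDifferential S)
    {e : OpenPartialHomeomorph S ℂ} (he : e ∈ atlas ℂ S) {x : S} (hx : x ∈ e.source) :
    pickRatio h q x = 2 * ‖q.coeff e (e x)‖ ^ 2 / h.coeff e (e x) ^ 3 := by
  have hc : chartAt ℂ x ∈ atlas ℂ S := chart_mem_atlas ℂ x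
  have hxc : x ∈ (chartAt ℂ x).source := mem_chart_source ℂ x
  have hz : e x ∈ (e.symm.trans (chartAt ℂ x)).source := by
    simp [hx, e.map_source hx]
  have h1 := h.transform e he _ hc _ hz
  have h2 := q.transform e he _ hc _ hz
  have h3 := deriv_transition_ne_zero h he hc hz
  have h4 := h.pos _ hc _ ((chartAt ℂ x).map_source hxc)
  rw [e.left_inv hx] at h1 h2
  rw [h1, h2, norm_mul, norm_pow, pickRatio]
  have h5 : ‖deriv (fun w => (chartAt ℂ x) (e.symm w)) (e x)‖ ≠ 0 := by simpa using h3
  field_simp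

theorem CubicDifferential.analyticAt (q : CubicDifferential S) {e : OpenPartialHomeomorph S ℂ}
    (he : e ∈ atlas ℂ S) {z : ℂ} (hz : z ∈ e.target) : AnalyticAt ℂ (q.coeff e) z :=
  (q.holo e he).analyticAt (e.open_target.mem_nhds hz)

theorem continuous_pickRatio (h : ConformalMetric S) (q : CubicDifferential S) :
    Continuous (pickRatio h q) := by
  rw [continuous_iff_continuousAt]
  intro x
  set e := chartAt ℂ x
  have he : e ∈ atlas ℂ S := chart_mem_atlas ℂ x
  have hx : x ∈ e.source := mem_chart_source ℂ x
  have hev : pickRatio h q =ᶠ[𝓝 x] fun y => 2 * ‖q.coeff e (e y)‖ ^ 2 / h.coeff e (e y) ^ 3 := by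
    filter_upwards [e.open_source.mem_nhds hx] with y hy using pickRatio_eq h q he hy
  refine ContinuousAt.congr ?_ hev.symm
  have h1 : ContinuousAt (fun y => q.coeff e (e y)) x :=
    ContinuousAt.comp (q.analyticAt he (e.map_source hx)).continuousAt (e.continuousAt hx)
  have h2 : ContinuousAt (fun y => h.coeff e (e y)) x :=
    ContinuousAt.comp (h.contDiffAt he (e.map_source hx)).continuousAt (e.continuousAt hx)
  exact ((h1.norm.pow 2).const_mul 2).div (h2.pow 3)
    (pow_ne_zero 3 (h.pos e he _ (e.map_source hx)).ne')

/-- At a local maximum of `log (|q|² / h³)` the curvature density is nonnegative. -/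
theorem curv_nonneg_of_isLocalMax (h : ConformalMetric S) (q : CubicDifferential S)
    {e : OpenPartialHomeomorph S ℂ} (he : e ∈ atlas ℂ S) {z : ℂ} (hz : z ∈ e.target)
    (hq : q.coeff e z ≠ 0)
    (hmax : IsLocalMax (fun w => 2 * ‖q.coeff e w‖ ^ 2 / h.coeff e w ^ 3) z) :
    0 ≤ h.curv e z := by
  -- Up to the additive constant `log 2` this is the logarithm of the ratio being maximized.
  set u : ℂ → ℝ := fun w => Real.log (‖q.coeff e w‖ ^ 2) + (-3) * Real.log (h.coeff e w) with hu
  have hev : ∀ᶠ w in 𝓝 z, w ∈ e.target ∧ q.coeff e w ≠ 0 :=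
    Filter.Eventually.and (e.open_target.mem_nhds hz)
      ((q.analyticAt he hz).continuousAt.eventually_ne hq)
  have hlogq : ∀ w, w ∈ e.target → q.coeff e w ≠ 0 →
      ContDiffAt ℝ ∞ (fun w => Real.log (‖q.coeff e w‖ ^ 2)) w := fun w hw hqw =>
    ((q.analyticAt he hw).contDiffAt.restrict_scalars ℝ).norm_sq ℝ |>.log (by simpa using hqw)
  have hlogh : ∀ w, w ∈ e.target → ContDiffAt ℝ ∞ (fun w => Real.log (h.coeff e w)) w :=
    fun w hw => (h.contDiffAt he hw).log (h.pos e he w hw).ne'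
  have hsm : ∀ᶠ w in 𝓝 z, ContDiffAt ℝ ∞ u w := by
    filter_upwards [hev] with w hw
    exact (hlogq w hw.1 hw.2).add (contDiffAt_const.mul (hlogh w hw.1))
  have hloc : IsLocalMax u z := by
    filter_upwards [hmax, hev] with w hw hw'
    have e1 : ∀ y, y ∈ e.target → q.coeff e y ≠ 0 →
        u y = Real.log (2 * ‖q.coeff e y‖ ^ 2 / h.coeff e y ^ 3) - Real.log 2 := by
      intro y hy hqy
      have hp := (h.pos e he y hy).ne'
      have hn : ‖q.coeff e y‖ ^ 2 ≠ 0 := by simpa using hqy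
      rw [Real.log_div (by simpa using hqy) (by simpa using hp), Real.log_mul two_ne_zero hn,
        Real.log_pow (n := 3), hu]
      push_cast
      ring
    rw [e1 w hw'.1 hw'.2, e1 z hz hq]
    have hp := h.pos e he w hw'.1
    have hn : 0 < ‖q.coeff e w‖ := by simpa using hw'.2
    have : 0 < 2 * ‖q.coeff e w‖ ^ 2 / h.coeff e w ^ 3 := by positivity
    linarith [Real.log_le_log this hw]
  -- The first summand is holomorphic, so half the Laplacian of `u` is `-3` times the curvature
  -- density.
  have hwz : wz u =ᶠ[𝓝 z] fun w =>
      deriv (q.coeff e) w / q.coeff e w + (-3 : ℂ) * h.conn e w := by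
    filter_upwards [hev] with w hw
    obtain ⟨h3, h4⟩ := hasFDerivAt_log_norm_sq (q.analyticAt he hw.1).differentiableAt hw.2
    have h5 := (hlogh w hw.1).differentiableAt (by simp)
    rw [hu, wz_add h3 (h5.const_mul _), h4, wz_const_mul _ h5]
    push_cast
    rfl
  have hdq : DifferentiableAt ℂ (fun w => deriv (q.coeff e) w / q.coeff e w) z :=
    (q.analyticAt he hz).deriv.differentiableAt.div (q.analyticAt he hz).differentiableAt hq
  have hdc := (h.contDiffAt_conn he hz).differentiableAt (by simp)
  have h1 := dbar2_wz hsm.self_of_nhds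
  rw [dbar2_congr hwz, dbar2_add (hdq.restrictScalars ℝ) (hdc.const_mul _),
    dbar2_of_differentiableAt hdq, dbar2_const_mul _ hdc, h.dbar2_conn he hz] at h1
  have h2 : -3 * h.curv e z = (fderiv ℝ (fun w => fderiv ℝ u w 1) z 1 +
        fderiv ℝ (fun w => fderiv ℝ u w Complex.I) z Complex.I) / 2 := by
    apply Complex.ofReal_injective
    push_cast
    push_cast at h1
    rw [← h1]
    ring
  have h3 := fderiv_fderiv_nonpos_of_isLocalMax hsm hloc 1
  have h4 := fderiv_fderiv_nonpos_of_isLocalMax hsm hloc Complex.I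
  linarith

end MaximumPrinciple

/-! ### The pointwise comparison of the Blaschke metric with the Pick differential -/

section Quotient

variable {S : Type*} [TopologicalSpace S] [ConnectedSpace S] [CompactSpace S]
  [ChartedSpace ℂ S] [IsManifold 𝓘(ℂ) ω S]
  {X : Type*} [TopologicalSpace X] [Nonempty X] [ChartedSpace ℂ X] [IsManifold 𝓘(ℂ) ω X]
  {p : X → S} {f : X → Fin 3 → ℝ} {ρ : deckGroup p →* Matrix.SpecialLinearGroup (Fin 3) ℝ}
  {h : ConformalMetric S} {q : CubicDifferential S}

/-- The Blaschke metric has nonpositive curvature. -/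
theorem IsQuotientAffineSphere.two_mul_norm_sq_le (hf : IsQuotientAffineSphere p f ρ h q)
    {e : OpenPartialHomeomorph S ℂ} (he : e ∈ atlas ℂ S) {z : ℂ} (hz : z ∈ e.target) :
    2 * ‖q.coeff e z‖ ^ 2 ≤ h.coeff e z ^ 3 := by
  obtain ⟨x, -, hx⟩ := isCompact_univ.exists_isMaxOn Set.univ_nonempty
    (continuous_pickRatio h q).continuousOn
  have hx' : ∀ y, pickRatio h q y ≤ pickRatio h q x := fun y => hx (Set.mem_univ y)
  suffices hle : pickRatio h q x ≤ 1 by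
    have h1 := (hx' (e.symm z)).trans hle
    rwa [pickRatio_eq h q he (e.map_target hz), e.right_inv hz,
      div_le_one (pow_pos (h.pos e he z hz) 3)] at h1
  -- A maximum above `1` forces `q ≠ 0` there, so the local maximum principle applies; Wang's
  -- equation then bounds that same maximum by `1`.
  by_contra! hlt
  set c := chartAt ℂ x
  have hc : c ∈ atlas ℂ S := chart_mem_atlas ℂ x
  have hxc : x ∈ c.source := mem_chart_source ℂ x
  have hcx := c.map_source hxc
  have hpos := h.pos c hc _ hcx
  have hmax : IsLocalMax (fun w => 2 * ‖q.coeff c w‖ ^ 2 / h.coeff c w ^ 3) (c x) := by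
    filter_upwards [c.open_target.mem_nhds hcx] with w hw
    have h1 := hx' (c.symm w)
    rwa [pickRatio_eq h q hc (c.map_target hw), c.right_inv hw, pickRatio_eq h q hc hxc] at h1
  rw [pickRatio_eq h q hc hxc] at hlt
  have hq : q.coeff c (c x) ≠ 0 := by
    intro h0
    rw [h0] at hlt
    norm_num at hlt
  have h1 := curv_nonneg_of_isLocalMax h q hc hcx hq hmax
  rw [hf.curv_eq hc hcx, sub_nonneg, div_le_iff₀ (by positivity)] at h1
  rw [one_lt_div (by positivity)] at hlt
  linarith [pow_succ (h.coeff c (c x)) 2]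

end Quotient

/-! ### Green's theorem on the standard triangle -/

/-- The standard closed triangle with vertices `0`, `1`, `1 + i`. -/
def Tri : Set ℂ := {z | 0 ≤ z.im ∧ z.im ≤ z.re ∧ z.re ≤ 1}

/-- The interior of the standard triangle. -/
def TriInt : Set ℂ := {z | 0 < z.im ∧ z.im < z.re ∧ z.re < 1}

theorem det_eq_im (L : ℂ →L[ℝ] ℂ) : L.det = (conj (L 1) * L Complex.I).im := by
  rw [ContinuousLinearMap.det, ← LinearMap.det_toMatrix Complex.basisOneI, Matrix.det_fin_two]
  simp [LinearMap.toMatrix_apply, Complex.coe_basisOneI_repr]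
  ring

theorem isClosed_tri : IsClosed Tri := by
  refine IsClosed.and ?_ (IsClosed.and ?_ ?_)
  · exact isClosed_le continuous_const Complex.continuous_im
  · exact isClosed_le Complex.continuous_im Complex.continuous_re
  · exact isClosed_le Complex.continuous_re continuous_const

theorem isCompact_tri : IsCompact Tri := by
  refine Metric.isCompact_of_isClosed_isBounded isClosed_tri
    (Metric.isBounded_closedBall (x := 0) (r := 2) |>.subset ?_)
  intro z hz
  have h1 : |z.re| ≤ 1 := by rw [abs_le]; constructor <;> linarith [hz.1, hz.2.1, hz.2.2]
  have h2 : |z.im| ≤ 1 := by rw [abs_le]; constructor <;> linarith [hz.1, hz.2.1, hz.2.2]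
  simpa using (Complex.norm_le_abs_re_add_abs_im z).trans (by linarith)

theorem isOpen_triInt : IsOpen TriInt := by
  refine IsOpen.and ?_ (IsOpen.and ?_ ?_)
  · exact isOpen_lt continuous_const Complex.continuous_im
  · exact isOpen_lt Complex.continuous_im Complex.continuous_re
  · exact isOpen_lt Complex.continuous_re continuous_const

theorem triInt_subset_tri : TriInt ⊆ Tri := fun _ hz => ⟨hz.1.le, hz.2.1.le, hz.2.2.le⟩

theorem convex_tri : Convex ℝ Tri := by
  intro x hx y hy a b ha hb hab
  obtain ⟨h1, h2, h3⟩ := hx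
  obtain ⟨k1, k2, k3⟩ := hy
  refine ⟨?_, ?_, ?_⟩ <;> simp
  · positivity
  · nlinarith
  · nlinarith

theorem tri_subset_closure : Tri ⊆ closure TriInt := by
  intro z hz
  -- Any point is approached from the interior along the segment to the centroid `(2 + i)/3`.
  have htend : Filter.Tendsto (fun s : ℝ => z + s • ((⟨2/3, 1/3⟩ : ℂ) - z)) (𝓝[>] 0) (𝓝 z) := by
    have : Continuous (fun s : ℝ => z + s • ((⟨2/3, 1/3⟩ : ℂ) - z)) := by fun_prop
    simpa using (this.tendsto 0).mono_left nhdsWithin_le_nhds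
  refine mem_closure_of_tendsto htend ?_
  filter_upwards [Ioo_mem_nhdsGT (show (0 : ℝ) < 1 by norm_num)] with s hs
  obtain ⟨h1, h2, h3⟩ := hz
  obtain ⟨k1, k2⟩ := hs
  refine ⟨?_, ?_, ?_⟩ <;> simp <;> nlinarith

/-- The map from the unit square to the triangle collapsing the left side. -/
def collapse (w : ℂ) : ℂ := ⟨w.re, w.re * w.im⟩

/-- The unit square without its left side. -/
def Sq : Set ℂ := {w | (0 < w.re ∧ w.re ≤ 1) ∧ 0 ≤ w.im ∧ w.im ≤ 1}

/-- The derivative of `collapse`. -/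
def collapseDeriv (w : ℂ) : ℂ →L[ℝ] ℂ :=
  Complex.reCLM.smulRight (1 : ℂ) +
    (w.re • Complex.imCLM + w.im • Complex.reCLM).smulRight Complex.I

theorem hasFDerivAt_collapse (w : ℂ) : HasFDerivAt collapse (collapseDeriv w) w := by
  have h1 : HasFDerivAt (fun w : ℂ => w.re) Complex.reCLM w := Complex.reCLM.hasFDerivAt
  have h2 : HasFDerivAt (fun w : ℂ => w.im) Complex.imCLM w := Complex.imCLM.hasFDerivAt
  have h3 := (h1.smul_const (1 : ℂ)).add ((h1.mul h2).smul_const Complex.I)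
  refine h3.congr_of_eventuallyEq (Filter.Eventually.of_forall fun x => ?_)
  apply Complex.ext <;> simp [collapse]

theorem det_collapseDeriv (w : ℂ) : (collapseDeriv w).det = w.re := by
  rw [det_eq_im]
  simp [collapseDeriv]

theorem injOn_collapse : Set.InjOn collapse Sq := by
  intro x hx y hy h
  have h1 := congrArg Complex.re h
  have h2 := congrArg Complex.im h
  simp only [collapse] at h1 h2
  rw [h1] at h2
  exact Complex.ext h1 (mul_left_cancel₀ hy.1.1.ne' h2)

theorem image_collapse : collapse '' Sq = Tri \ {0} := by
  ext z
  constructor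
  · rintro ⟨w, ⟨⟨h1, h2⟩, h3, h4⟩, rfl⟩
    refine ⟨⟨?_, ?_, h2⟩, fun h => ?_⟩
    · simp only [collapse]; positivity
    · simp only [collapse]; nlinarith
    · have := congrArg Complex.re h
      simp only [collapse, Complex.zero_re] at this
      linarith
  · rintro ⟨⟨h1, h2, h3⟩, h0⟩
    have hre : 0 < z.re := by
      rcases (h1.trans h2).lt_or_eq with h | h
      · exact h
      · exact absurd (Complex.ext h.symm (le_antisymm (h2.trans h.symm.le) h1)) h0
    refine ⟨⟨z.re, z.im / z.re⟩, ⟨⟨hre, h3⟩, by positivity, (div_le_one hre).2 h2⟩, ?_⟩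
    apply Complex.ext <;> simp [collapse]
    field_simp

theorem measurableSet_sq : MeasurableSet Sq := by
  refine MeasurableSet.inter (MeasurableSet.inter ?_ ?_) (MeasurableSet.inter ?_ ?_)
  · exact measurableSet_lt measurable_const Complex.measurable_re
  · exact measurableSet_le Complex.measurable_re measurable_const
  · exact measurableSet_le measurable_const Complex.measurable_im
  · exact measurableSet_le Complex.measurable_im measurable_const

/-- The triangle minus the vertex `0` is the bijective image of the square without its left side
under a map of Jacobian `re w`. This reduces integrals over the triangle to a box, where the
divergence theorem is available. -/
theorem setIntegral_tri (R : ℂ → ℝ) :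
    ∫ z in Tri, R z =
      ∫ x in Set.Icc ((0 : ℝ), (0 : ℝ)) (1, 1), x.1 * R ⟨x.1, x.1 * x.2⟩ := by
  have h1 : ∫ z in Tri, R z = ∫ z in collapse '' Sq, R z := by
    rw [image_collapse]
    refine setIntegral_congr_set ?_
    exact (sdiff_null_ae_eq_self (measure_singleton _)).symm
  rw [h1, integral_image_eq_integral_abs_det_fderiv_smul volume measurableSet_sq
    (fun w _ => (hasFDerivAt_collapse w).hasFDerivWithinAt) injOn_collapse]
  have h2 : ∫ w in Sq, |(collapseDeriv w).det| • R (collapse w) =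
      ∫ w in Sq, w.re * R ⟨w.re, w.re * w.im⟩ := by
    refine setIntegral_congr_fun measurableSet_sq fun w hw => ?_
    simp only [det_collapseDeriv, abs_of_pos hw.1.1, smul_eq_mul, collapse]
  rw [h2]
  have h3 : Sq = Complex.measurableEquivRealProd ⁻¹' (Set.Ioc (0 : ℝ) 1 ×ˢ Set.Icc (0 : ℝ) 1) := by
    ext w
    simp [Sq]
  have h4 := Complex.volume_preserving_equiv_real_prod.setIntegral_preimage_emb
    Complex.measurableEquivRealProd.measurableEmbedding
    (fun x : ℝ × ℝ => x.1 * R ⟨x.1, x.1 * x.2⟩) (Set.Ioc (0 : ℝ) 1 ×ˢ Set.Icc (0 : ℝ) 1)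
  rw [h3, show Set.Icc ((0 : ℝ), (0 : ℝ)) (1, 1) = Set.Icc (0 : ℝ) 1 ×ˢ Set.Icc (0 : ℝ) 1 from
    (Set.Icc_prod_Icc _ _ _ _).symm]
  refine Eq.trans ?_ (h4.trans ?_)
  · rfl
  · refine setIntegral_congr_set ?_
    rw [Measure.volume_eq_prod]
    exact Measure.set_prod_ae_eq Ioc_ae_eq_Icc (Filter.EventuallyEq.refl _ _)

/-- **Green's theorem** on the standard triangle. -/
theorem green_triangle {P Q R : ℂ → ℝ} (hP : ContinuousOn P Tri) (hQ : ContinuousOn Q Tri)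
    (hR : ContinuousOn R Tri)
    (hd : ∀ z ∈ TriInt, DifferentiableAt ℝ P z ∧ DifferentiableAt ℝ Q z ∧
      fderiv ℝ Q z 1 - fderiv ℝ P z Complex.I = R z) :
    ∫ z in Tri, R z = (∫ s in (0 : ℝ)..1, P s) + (∫ t in (0 : ℝ)..1, Q ⟨1, t⟩) -
      ∫ s in (0 : ℝ)..1, (P ⟨s, s⟩ + Q ⟨s, s⟩) := by
  set σ : ℝ × ℝ → ℂ := fun x => ⟨x.1, x.1 * x.2⟩ with hσ
  have hσeq : σ = fun x => (x.1 : ℂ) + ((x.1 * x.2 : ℝ) : ℂ) * Complex.I := by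
    funext x; apply Complex.ext <;> simp [hσ]
  have hσc : Continuous σ := by rw [hσeq]; fun_prop
  have hbox : Set.Icc ((0 : ℝ), (0 : ℝ)) (1, 1) = Set.Icc (0 : ℝ) 1 ×ˢ Set.Icc (0 : ℝ) 1 :=
    (Set.Icc_prod_Icc _ _ _ _).symm
  have hmaps : Set.MapsTo σ (Set.Icc ((0 : ℝ), (0 : ℝ)) (1, 1)) Tri := by
    rw [hbox]
    rintro ⟨x, y⟩ ⟨⟨h1, h2⟩, h3, h4⟩
    simp only at h1 h2 h3 h4
    exact ⟨mul_nonneg h1 h3, mul_le_of_le_one_right h1 h4, h2⟩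
  have hmapsI : Set.MapsTo σ (Set.Ioo (0 : ℝ) 1 ×ˢ Set.Ioo (0 : ℝ) 1) TriInt := by
    rintro ⟨x, y⟩ ⟨⟨h1, h2⟩, h3, h4⟩
    simp only at h1 h2 h3 h4
    exact ⟨mul_pos h1 h3, mul_lt_of_lt_one_right h1 h4, h2⟩
  have hσd : ∀ x : ℝ × ℝ, HasFDerivAt σ ((ContinuousLinearMap.fst ℝ ℝ ℝ).smulRight (1 : ℂ) +
      (x.1 • ContinuousLinearMap.snd ℝ ℝ ℝ + x.2 • ContinuousLinearMap.fst ℝ ℝ ℝ).smulRight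
        Complex.I) x := by
    intro x
    have h1 : HasFDerivAt (fun x : ℝ × ℝ => x.1) (ContinuousLinearMap.fst ℝ ℝ ℝ) x :=
      hasFDerivAt_fst
    have h2 : HasFDerivAt (fun x : ℝ × ℝ => x.2) (ContinuousLinearMap.snd ℝ ℝ ℝ) x :=
      hasFDerivAt_snd
    have h3 := (h1.smul_const (1 : ℂ)).add ((h1.mul h2).smul_const Complex.I)
    refine h3.congr_of_eventuallyEq (Filter.Eventually.of_forall fun x => ?_)
    rw [hσeq]; simp
  -- The pull-back of `P dx + Q dy` by `σ` is `(P + yQ) dx + xQ dy`. Thus `(f, g) = (xQ, -(P + yQ))`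
  -- is the field whose divergence is the pulled-back curl, and the flux through the collapsed side
  -- is zero because `f` carries the factor `x`.
  set f : ℝ × ℝ → ℝ := fun x => x.1 * Q (σ x) with hf
  set g : ℝ × ℝ → ℝ := fun x => -(P (σ x) + x.2 * Q (σ x)) with hg
  have hPc : ContinuousOn (fun x => P (σ x)) (Set.Icc ((0 : ℝ), (0 : ℝ)) (1, 1)) :=
    hP.comp hσc.continuousOn hmaps
  have hQc : ContinuousOn (fun x => Q (σ x)) (Set.Icc ((0 : ℝ), (0 : ℝ)) (1, 1)) :=
    hQ.comp hσc.continuousOn hmaps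
  have hRc : ContinuousOn (fun x => R (σ x)) (Set.Icc ((0 : ℝ), (0 : ℝ)) (1, 1)) :=
    hR.comp hσc.continuousOn hmaps
  have hfc : ContinuousOn f (Set.Icc (0, 0) (1, 1)) := continuousOn_fst.mul hQc
  have hgc : ContinuousOn g (Set.Icc (0, 0) (1, 1)) := (hPc.add (continuousOn_snd.mul hQc)).neg
  have hder : ∀ x ∈ Set.Ioo (0 : ℝ) 1 ×ˢ Set.Ioo (0 : ℝ) 1,
      DifferentiableAt ℝ f x ∧ DifferentiableAt ℝ g x ∧
        fderiv ℝ f x (1, 0) + fderiv ℝ g x (0, 1) = x.1 * R (σ x) := by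
    intro x hx
    obtain ⟨dP, dQ, hPQ⟩ := hd _ (hmapsI hx)
    have h1 : HasFDerivAt (fun x : ℝ × ℝ => x.1) (ContinuousLinearMap.fst ℝ ℝ ℝ) x :=
      hasFDerivAt_fst
    have h2 : HasFDerivAt (fun x : ℝ × ℝ => x.2) (ContinuousLinearMap.snd ℝ ℝ ℝ) x :=
      hasFDerivAt_snd
    have hPd : HasFDerivAt (fun x => P (σ x)) _ x := dP.hasFDerivAt.comp x (hσd x)
    have hQd : HasFDerivAt (fun x => Q (σ x)) _ x := dQ.hasFDerivAt.comp x (hσd x)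
    have hfd : HasFDerivAt f _ x := h1.mul hQd
    have hgd : HasFDerivAt g _ x := (hPd.add (h2.mul hQd)).neg
    refine ⟨hfd.differentiableAt, hgd.differentiableAt, ?_⟩
    rw [hfd.fderiv, hgd.fderiv, ← hPQ]
    have e1 (L : ℂ →L[ℝ] ℝ) (a : ℝ) : L (a * Complex.I) = a * L Complex.I := by
      rw [← smul_eq_mul a, ← map_smul, Complex.real_smul]
    simp [e1]
    ring
  have hae : (fun x => fderiv ℝ f x (1, 0) + fderiv ℝ g x (0, 1)) =ᵐ[volume.restrict
      (Set.Icc ((0 : ℝ), (0 : ℝ)) (1, 1))] fun x => x.1 * R (σ x) := by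
    have hset : (Set.Icc ((0 : ℝ), (0 : ℝ)) (1, 1)) =ᵐ[volume]
        Set.Ioo (0 : ℝ) 1 ×ˢ Set.Ioo (0 : ℝ) 1 := by
      rw [hbox, Measure.volume_eq_prod]
      exact Measure.set_prod_ae_eq Ioo_ae_eq_Icc.symm Ioo_ae_eq_Icc.symm
    rw [Measure.restrict_congr_set hset]
    refine (ae_restrict_iff' (measurableSet_Ioo.prod measurableSet_Ioo)).2 ?_
    exact Filter.Eventually.of_forall fun x hx => (hder x hx).2.2
  have hint : IntegrableOn (fun x => x.1 * R (σ x)) (Set.Icc ((0 : ℝ), (0 : ℝ)) (1, 1)) :=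
    (continuousOn_fst.mul hRc).integrableOn_compact isCompact_Icc
  have hdiv := integral_divergence_prod_Icc_of_hasFDerivAt_of_le f g (fderiv ℝ f) (fderiv ℝ g)
    (0, 0) (1, 1) (by simp [Prod.le_def]) hfc hgc
    (fun x hx => (hder x hx).1.hasFDerivAt) (fun x hx => (hder x hx).2.1.hasFDerivAt)
    (hint.congr hae.symm)
  rw [integral_congr_ae hae] at hdiv
  rw [setIntegral_tri]
  change (∫ x in Set.Icc ((0 : ℝ), (0 : ℝ)) (1, 1), x.1 * R (σ x)) = _
  rw [hdiv]
  have e1 : ∀ s : ℝ, σ (s, 0) = s := fun s => by apply Complex.ext <;> simp [hσ]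
  have e2 : ∀ s : ℝ, σ (s, 1) = ⟨s, s⟩ := fun s => by simp [hσ]
  have e3 : ∀ t : ℝ, σ (1, t) = ⟨1, t⟩ := fun s => by simp [hσ]
  simp only [hf, hg, e1, e2, e3, one_mul, zero_mul, add_zero, intervalIntegral.integral_neg,
    intervalIntegral.integral_zero]
  ring

/-! ### Smooth triangles in a Riemann surface -/

/-- The Jacobian determinant of a map of the plane. -/
def jac (G : ℂ → ℂ) (z : ℂ) : ℝ := (conj (dirDeriv G 1 z) * dirDeriv G Complex.I z).im

/-- The connection form, evaluated at `v`, of the frame `G_* w` in a chart where the Levi-Civita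
connection is `D + φ dz`. -/
def frameConn (φ G : ℂ → ℂ) (w v z : ℂ) : ℂ :=
  dirDeriv (dirDeriv G w) v z / dirDeriv G w z + φ (G z) * dirDeriv G v z

theorem dirDeriv_ne_zero_of_jac {G : ℂ → ℂ} {z w : ℂ} (h : jac G z ≠ 0) (hw : w ≠ 0) :
    dirDeriv G w z ≠ 0 := by
  intro h0
  rw [dirDeriv_apply] at h0
  have h1 : w.im * jac G z = 0 := by
    have := congrArg (fun x => (conj (dirDeriv G 1 z) * x).im) h0
    simp [jac] at this ⊢
    rcases eq_or_ne w.im 0 with h | h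
    · exact Or.inl h
    · right; apply mul_left_cancel₀ h; linear_combination this
  have h2 : w.re * jac G z = 0 := by
    have := congrArg (fun x => (conj x * dirDeriv G Complex.I z).im) h0
    simp [jac] at this ⊢
    rcases eq_or_ne w.re 0 with h | h
    · exact Or.inl h
    · right; apply mul_left_cancel₀ h; linear_combination this
  exact hw (Complex.ext ((mul_eq_zero.1 h2).resolve_right h) ((mul_eq_zero.1 h1).resolve_right h))

theorem jac_ne_zero_of_injective {G : ℂ → ℂ} {z : ℂ} (h : ∀ v, fderiv ℝ G z v = 0 → v = 0) :
    jac G z ≠ 0 := by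
  intro h0
  set a := dirDeriv G 1 z with ha
  set b := dirDeriv G Complex.I z with hb
  have ha0 : a ≠ 0 := fun h1 => one_ne_zero (h 1 h1)
  have hr : conj a * b = ((conj a * b).re : ℂ) := by
    apply Complex.ext
    · simp
    · simpa [jac] using h0
  have hn : conj a * a = ((Complex.normSq a : ℝ) : ℂ) := Complex.normSq_eq_conj_mul_self.symm
  set r := (conj a * b).re
  -- If `conj a * b = r` is real, then `-r a + |a|² b` vanishes after multiplication by `conj a`.
  -- This gives a nonzero kernel vector.
  have hv : dirDeriv G (⟨-r, Complex.normSq a⟩ : ℂ) z = 0 := by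
    rw [dirDeriv_apply, ← ha, ← hb]
    have hc : conj a ≠ 0 := by simpa using ha0
    apply mul_left_cancel₀ hc
    simp only [Complex.real_smul, mul_zero, mul_add]
    push_cast
    linear_combination (Complex.normSq a : ℂ) * hr - (r : ℂ) * hn
  have := congrArg Complex.im (h _ hv)
  simp at this
  exact ha0 this

section ChainRule

variable {G g : ℂ → ℂ} {z : ℂ}

theorem dirDeriv_analytic_comp (hg : DifferentiableAt ℂ g (G z)) (hG : DifferentiableAt ℝ G z)
    (v : ℂ) : dirDeriv (fun w => g (G w)) v z = deriv g (G z) * dirDeriv G v z := by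
  have h1 : HasFDerivAt g _ (G z) := hg.hasDerivAt.hasFDerivAt.restrictScalars ℝ
  have h2 : fderiv ℝ (fun w => g (G w)) z = _ := (h1.comp z hG.hasFDerivAt).fderiv
  rw [dirDeriv, h2]
  simp [dirDeriv, mul_comm]

theorem dirDeriv_dirDeriv_analytic_comp (hg : AnalyticAt ℂ g (G z)) (hG : ContDiffAt ℝ 2 G z)
    (w v : ℂ) : dirDeriv (dirDeriv (fun w => g (G w)) w) v z =
      deriv (deriv g) (G z) * dirDeriv G v z * dirDeriv G w z +
        deriv g (G z) * dirDeriv (dirDeriv G w) v z := by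
  have hd := hG.differentiableAt (by simp)
  have hev : dirDeriv (fun w => g (G w)) w =ᶠ[𝓝 z] fun x => deriv g (G x) * dirDeriv G w x := by
    filter_upwards [hd.continuousAt.eventually hg.eventually_analyticAt, hG.eventually (by simp)]
      with x h1 h2
    exact dirDeriv_analytic_comp h1.differentiableAt (h2.differentiableAt (by simp)) w
  have h3 : DifferentiableAt ℝ (fun x => deriv g (G x)) z :=
    (hg.deriv.differentiableAt.restrictScalars ℝ).comp z hd
  have h4 : DifferentiableAt ℝ (dirDeriv G w) z :=
    (contDiffAt_dirDeriv_of_le (m := 1) hG (by norm_num) w).differentiableAt (by simp)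
  rw [dirDeriv_congr hev, dirDeriv_mul h3 h4,
    dirDeriv_analytic_comp hg.deriv.differentiableAt hd]
  ring

theorem jac_analytic_comp (hg : DifferentiableAt ℂ g (G z)) (hG : DifferentiableAt ℝ G z) :
    jac (fun w => g (G w)) z = ‖deriv g (G z)‖ ^ 2 * jac G z := by
  rw [jac, dirDeriv_analytic_comp hg hG, dirDeriv_analytic_comp hg hG, jac, Complex.sq_norm,
    Complex.normSq_apply]
  simp
  ring

end ChainRule

section Derivatives

/-- The exterior derivative of the connection form of a frame. -/
theorem dirDeriv_frameConn {φ G : ℂ → ℂ} {w z : ℂ} (hG : ContDiffAt ℝ 3 G z)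
    (hφ : DifferentiableAt ℝ φ (G z)) (hw : dirDeriv G w z ≠ 0) :
    (∀ v, DifferentiableAt ℝ (frameConn φ G w v) z) ∧
    dirDeriv (frameConn φ G w Complex.I) 1 z - dirDeriv (frameConn φ G w 1) Complex.I z =
      Complex.I * (jac G z : ℂ) * dbar2 φ (G z) := by
  have hd := hG.differentiableAt (by simp)
  have hG2 : ContDiffAt ℝ 2 G z := hG.of_le (by norm_num)
  have hA : ContDiffAt ℝ 2 (dirDeriv G w) z := contDiffAt_dirDeriv_of_le hG (by norm_num) w
  have hAd := hA.differentiableAt (by simp)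
  have hAv (v : ℂ) : DifferentiableAt ℝ (dirDeriv (dirDeriv G w) v) z :=
    (contDiffAt_dirDeriv_of_le (m := 1) hA (by norm_num) v).differentiableAt (by simp)
  have hGv (v : ℂ) : DifferentiableAt ℝ (dirDeriv G v) z :=
    (contDiffAt_dirDeriv_of_le (m := 1) hG2 (by norm_num) v).differentiableAt (by simp)
  have hφG : DifferentiableAt ℝ (fun x => φ (G x)) z := hφ.comp z hd
  have hinv : DifferentiableAt ℝ (fun x => (dirDeriv G w x)⁻¹) z := hAd.inv hw
  have h1 (v : ℂ) : DifferentiableAt ℝ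
      (fun x => dirDeriv (dirDeriv G w) v x * (dirDeriv G w x)⁻¹) z := (hAv v).fun_mul hinv
  have h2 (v : ℂ) : DifferentiableAt ℝ (fun x => φ (G x) * dirDeriv G v x) z :=
    hφG.fun_mul (hGv v)
  have he (v : ℂ) : frameConn φ G w v = fun x => dirDeriv (dirDeriv G w) v x * (dirDeriv G w x)⁻¹ +
      φ (G x) * dirDeriv G v x := by
    funext x; rw [frameConn, div_eq_mul_inv]
  have hdi (v : ℂ) : dirDeriv (fun x => (dirDeriv G w x)⁻¹) v z =
      -dirDeriv (dirDeriv G w) v z / dirDeriv G w z ^ 2 := by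
    have h3 : dirDeriv (fun x => (fun y : ℂ => y⁻¹) (dirDeriv G w x)) v z = _ :=
      dirDeriv_analytic_comp (differentiableAt_inv hw) hAd v
    rw [h3, deriv_inv]
    field_simp
  have hdφ (v : ℂ) : dirDeriv (fun x => φ (G x)) v z = fderiv ℝ φ (G z) (dirDeriv G v z) := by
    have h3 : fderiv ℝ (fun x => φ (G x)) z = _ := (hφ.hasFDerivAt.comp z hd.hasFDerivAt).fderiv
    rw [dirDeriv, h3]
    rfl
  refine ⟨fun v => ?_, ?_⟩
  · rw [he v]
    exact (h1 v).fun_add (h2 v)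
  -- The first summand of `frameConn` is a logarithmic derivative, hence closed. The curl comes from
  -- the pull-back of `φ dz`, whose exterior derivative is `i · dbar2 φ · dx ∧ dy`.
  · rw [he, he, dirDeriv_add (h1 _) (h2 _), dirDeriv_add (h1 _) (h2 _),
      dirDeriv_mul (hAv _) hinv, dirDeriv_mul (hAv _) hinv, dirDeriv_mul hφG (hGv _),
      dirDeriv_mul hφG (hGv _), hdi, hdi, hdφ, hdφ, dirDeriv_comm_of_two hA 1 Complex.I,
      dirDeriv_comm_of_two hG2 1 Complex.I, real_linear_apply _ (dirDeriv G 1 z),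
      real_linear_apply _ (dirDeriv G Complex.I z), dbar2, jac]
    generalize dirDeriv G 1 z = a
    generalize dirDeriv G Complex.I z = b
    generalize fderiv ℝ φ (G z) 1 = p
    generalize fderiv ℝ φ (G z) Complex.I = q
    have ea := Complex.re_add_im a
    have eb := Complex.re_add_im b
    simp only [Complex.real_smul, Complex.mul_im, Complex.conj_re, Complex.conj_im]
    push_cast
    have hI := Complex.I_mul_I
    generalize (a.re : ℂ) = ar at *
    generalize (a.im : ℂ) = ai at *
    generalize (b.re : ℂ) = br at *
    generalize (b.im : ℂ) = bi at *
    rw [← ea, ← eb]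
    linear_combination (q * (br * ai - bi * ar)) * hI

end Derivatives

/-- Smooth extensions of a triangle agree only on the closed triangle. At a boundary point their
derivatives are compared by continuity from the interior, where agreement holds on open sets. -/
theorem eq_of_eventuallyEq_triInt {E : Type*} [TopologicalSpace E] [T2Space E] {u v : ℂ → E} {z : ℂ}
    (hz : z ∈ Tri) (hu : ContinuousAt u z) (hv : ContinuousAt v z)
    (h : ∀ᶠ w in 𝓝[TriInt] z, u w = v w) : u z = v z := by
  have : (𝓝[TriInt] z).NeBot := mem_closure_iff_nhdsWithin_neBot.1 (tri_subset_closure hz)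
  exact tendsto_nhds_unique_of_eventuallyEq (hu.tendsto.mono_left nhdsWithin_le_nhds)
    (hv.tendsto.mono_left nhdsWithin_le_nhds) h

theorem eventually_triInt_eventuallyEq {E : Type*} {u v : ℂ → E} {z : ℂ}
    (h : ∀ᶠ w in 𝓝[Tri] z, u w = v w) : ∀ᶠ w in 𝓝[TriInt] z, u =ᶠ[𝓝 w] v := by
  have h1 : ∀ᶠ w in 𝓝[TriInt] z, u w = v w :=
    h.filter_mono (nhdsWithin_mono z triInt_subset_tri)
  filter_upwards [eventually_eventually_nhdsWithin.2 h1, self_mem_nhdsWithin] with w hw hw'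
  rwa [isOpen_triInt.nhdsWithin_eq hw'] at hw

/-! ### Local smooth extensions of a triangle and independence of the chosen one -/

section Rep

variable {S : Type*} [TopologicalSpace S] [ChartedSpace ℂ S]

/-- `G` is a smooth local extension near `z` of the immersion `τ` of the standard triangle, read in
the chart `e`. -/
structure IsRep (τ : ℂ → S) (e : OpenPartialHomeomorph S ℂ) (z : ℂ) (G : ℂ → ℂ) : Prop where
  mem_atlas : e ∈ atlas ℂ S
  mem_source : τ z ∈ e.source
  smooth : ContDiffAt ℝ 3 G z
  eventually_eq : ∀ᶠ w in 𝓝[Tri] z, G w = e (τ w)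
  jac_ne : jac G z ≠ 0

/-- `τ` restricts to a smooth immersion of the standard triangle in the surface `S`. -/
structure IsSmoothTriangle (τ : ℂ → S) : Prop where
  continuousOn : ContinuousOn τ Tri
  exists_rep : ∀ z ∈ Tri, ∃ G, IsRep τ (chartAt ℂ (τ z)) z G

variable {τ : ℂ → S} {e e' : OpenPartialHomeomorph S ℂ} {z : ℂ} {G G' : ℂ → ℂ}

theorem IsRep.apply_eq (hG : IsRep τ e z G) (hz : z ∈ Tri) : G z = e (τ z) :=
  hG.eventually_eq.self_of_nhdsWithin hz

theorem IsRep.apply_mem (hG : IsRep τ e z G) (hz : z ∈ Tri) : G z ∈ e.target := by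
  rw [hG.apply_eq hz]
  exact e.map_source hG.mem_source

theorem IsRep.differentiableAt (hG : IsRep τ e z G) : DifferentiableAt ℝ G z :=
  hG.smooth.differentiableAt (by simp)

theorem IsRep.continuousAt_dirDeriv (hG : IsRep τ e z G) (v : ℂ) :
    ContinuousAt (dirDeriv G v) z :=
  (contDiffAt_dirDeriv_of_le (m := 2) hG.smooth (by norm_num) v).continuousAt

theorem IsRep.continuousAt_dirDeriv_dirDeriv (hG : IsRep τ e z G) (w v : ℂ) :
    ContinuousAt (dirDeriv (dirDeriv G w) v) z :=
  (contDiffAt_dirDeriv_of_le (m := 1)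
    (contDiffAt_dirDeriv_of_le (m := 2) hG.smooth (by norm_num) w) (by norm_num) v).continuousAt

theorem IsRep.continuousAt_jac (hG : IsRep τ e z G) : ContinuousAt (jac G) z :=
  Complex.continuous_im.continuousAt.comp
    ((Complex.continuous_conj.continuousAt.comp (hG.continuousAt_dirDeriv 1)).mul
      (hG.continuousAt_dirDeriv Complex.I))

/-- One extension serves a whole neighbourhood, so quantities defined by pointwise choices can be
differentiated using a single `G`. -/
theorem IsRep.eventually_isRep (hG : IsRep τ e z G) (hτ : ContinuousOn τ Tri) (hz : z ∈ Tri) :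
    ∀ᶠ w in 𝓝[Tri] z, IsRep τ e w G := by
  have h1 : ∀ᶠ w in 𝓝[Tri] z, τ w ∈ e.source :=
    (hτ z hz).eventually (e.open_source.mem_nhds hG.mem_source)
  have h2 : ∀ᶠ w in 𝓝[Tri] z, ContDiffAt ℝ 3 G w :=
    (hG.smooth.eventually (by simp)).filter_mono nhdsWithin_le_nhds
  have h3 : ∀ᶠ w in 𝓝[Tri] z, jac G w ≠ 0 :=
    (hG.continuousAt_jac.eventually_ne hG.jac_ne).filter_mono nhdsWithin_le_nhds
  filter_upwards [h1, h2, h3, eventually_eventually_nhdsWithin.2 hG.eventually_eq]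
    with w h1 h2 h3 h4
  exact ⟨hG.mem_atlas, h1, h2, h4, h3⟩

theorem IsRep.eventuallyEq_triInt (hG : IsRep τ e z G) (hG' : IsRep τ e z G') :
    ∀ᶠ w in 𝓝[TriInt] z, G =ᶠ[𝓝 w] G' := by
  refine eventually_triInt_eventuallyEq ?_
  filter_upwards [hG.eventually_eq, hG'.eventually_eq] with w h1 h2
  rw [h1, h2]

theorem IsRep.dirDeriv_eq (hG : IsRep τ e z G) (hG' : IsRep τ e z G') (hz : z ∈ Tri) (v : ℂ) :
    dirDeriv G v z = dirDeriv G' v z := by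
  refine eq_of_eventuallyEq_triInt hz (hG.continuousAt_dirDeriv v) (hG'.continuousAt_dirDeriv v) ?_
  filter_upwards [hG.eventuallyEq_triInt hG'] with w hw using dirDeriv_congr hw v

theorem IsRep.dirDeriv_dirDeriv_eq (hG : IsRep τ e z G) (hG' : IsRep τ e z G') (hz : z ∈ Tri)
    (w v : ℂ) : dirDeriv (dirDeriv G w) v z = dirDeriv (dirDeriv G' w) v z := by
  refine eq_of_eventuallyEq_triInt hz (hG.continuousAt_dirDeriv_dirDeriv w v)
    (hG'.continuousAt_dirDeriv_dirDeriv w v) ?_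
  filter_upwards [hG.eventuallyEq_triInt hG'] with x hx
  refine dirDeriv_congr ?_ v
  filter_upwards [hx.eventually_nhds] with y hy using dirDeriv_congr hy w

theorem IsRep.mem_transition (hG : IsRep τ e z G) (hz : z ∈ Tri) (h' : τ z ∈ e'.source) :
    G z ∈ (e.symm.trans e').source := by
  rw [hG.apply_eq hz]
  simp [hG.mem_source, e.map_source hG.mem_source, h']

variable [IsManifold 𝓘(ℂ) ω S]

theorem IsRep.transition (h : ConformalMetric S) (hG : IsRep τ e z G) (hτ : ContinuousOn τ Tri)
    (hz : z ∈ Tri) (he' : e' ∈ atlas ℂ S) (h' : τ z ∈ e'.source) :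
    IsRep τ e' z (fun w => e' (e.symm (G w))) := by
  have hm := hG.mem_transition hz h'
  have hg := analyticAt_transition hG.mem_atlas he' hm
  refine ⟨he', h', ?_, ?_, ?_⟩
  · exact ((hg.contDiffAt (n := 3)).restrict_scalars ℝ).comp z hG.smooth
  · filter_upwards [hG.eventually_eq,
      (hτ z hz).eventually (e.open_source.mem_nhds hG.mem_source)] with w h1 h2
    rw [h1, e.left_inv h2]
  · rw [jac_analytic_comp (g := fun w => e' (e.symm w)) hg.differentiableAt hG.differentiableAt]
    refine mul_ne_zero ?_ hG.jac_ne
    simpa using deriv_transition_ne_zero h hG.mem_atlas he' hm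

theorem IsRep.exists_of_mem_source (h : ConformalMetric S) (hτ : IsSmoothTriangle τ) (hz : z ∈ Tri)
    (he : e ∈ atlas ℂ S) (he' : τ z ∈ e.source) : ∃ G, IsRep τ e z G := by
  obtain ⟨G, hG⟩ := hτ.exists_rep z hz
  exact ⟨_, hG.transition h hτ.continuousOn hz he he'⟩

/-- The coefficient of the connection form does not depend on the chart. -/
theorem IsRep.frameConn_eq (h : ConformalMetric S) (hG : IsRep τ e z G) (hG' : IsRep τ e' z G')
    (hτ : ContinuousOn τ Tri) (hz : z ∈ Tri) {w : ℂ} (hw : w ≠ 0) (v : ℂ) :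
    frameConn (h.conn e') G' w v z = frameConn (h.conn e) G w v z := by
  have hT := hG.transition h hτ hz hG'.mem_atlas hG'.mem_source
  have hm := hG.mem_transition hz hG'.mem_source
  have hg := analyticAt_transition hG.mem_atlas hG'.mem_atlas hm
  have hg0 := deriv_transition_ne_zero h hG.mem_atlas hG'.mem_atlas hm
  have hc := h.conn_transform hG.mem_atlas hG'.mem_atlas hm
  have hw0 := dirDeriv_ne_zero_of_jac hG.jac_ne hw
  -- The term with `g''/g'` in the second derivative of `g ∘ G` cancels the inhomogeneous term in
  -- the transformation of the connection.
  rw [frameConn, frameConn, hG'.dirDeriv_eq hT hz, hG'.dirDeriv_eq hT hz,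
    hG'.dirDeriv_dirDeriv_eq hT hz, hG'.apply_eq hz, ← hT.apply_eq hz,
    dirDeriv_analytic_comp (g := fun w => e' (e.symm w)) hg.differentiableAt hG.differentiableAt,
    dirDeriv_analytic_comp (g := fun w => e' (e.symm w)) hg.differentiableAt hG.differentiableAt,
    dirDeriv_dirDeriv_analytic_comp (g := fun w => e' (e.symm w)) hg
      (hG.smooth.of_le (by norm_num)), hc]
  field_simp
  ring

theorem IsRep.jac_eq (h : ConformalMetric S) (hG : IsRep τ e z G) (hG' : IsRep τ e' z G')
    (hτ : ContinuousOn τ Tri) (hz : z ∈ Tri) :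
    jac G' z = ‖deriv (fun w => e' (e.symm w)) (G z)‖ ^ 2 * jac G z := by
  have hT := hG.transition h hτ hz hG'.mem_atlas hG'.mem_source
  have hm := hG.mem_transition hz hG'.mem_source
  have hg := analyticAt_transition hG.mem_atlas hG'.mem_atlas hm
  rw [← jac_analytic_comp (g := fun w => e' (e.symm w)) hg.differentiableAt hG.differentiableAt,
    jac, jac, hG'.dirDeriv_eq hT hz, hG'.dirDeriv_eq hT hz]

/-- The directional derivatives of two representatives differ by a nonzero complex factor. -/
theorem IsRep.dirDeriv_eq_mul (h : ConformalMetric S) (hG : IsRep τ e z G) (hG' : IsRep τ e' z G')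
    (hτ : ContinuousOn τ Tri) (hz : z ∈ Tri) :
    ∃ c : ℂ, c ≠ 0 ∧ ∀ v, dirDeriv G' v z = c * dirDeriv G v z := by
  have hT := hG.transition h hτ hz hG'.mem_atlas hG'.mem_source
  have hm := hG.mem_transition hz hG'.mem_source
  have hg := analyticAt_transition hG.mem_atlas hG'.mem_atlas hm
  refine ⟨_, deriv_transition_ne_zero h hG.mem_atlas hG'.mem_atlas hm, fun v => ?_⟩
  rw [hG'.dirDeriv_eq hT hz,
    dirDeriv_analytic_comp (g := fun w => e' (e.symm w)) hg.differentiableAt hG.differentiableAt]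

/-- A system of coefficients of a 2-form. -/
def IsDensity (d : OpenPartialHomeomorph S ℂ → ℂ → ℝ) : Prop :=
  ∀ e ∈ atlas ℂ S, ∀ e' ∈ atlas ℂ S, ∀ z ∈ (e.symm.trans e').source,
    d e z = d e' (e' (e.symm z)) * ‖deriv (fun w => e' (e.symm w)) z‖ ^ 2

theorem IsRep.density_eq (h : ConformalMetric S) {d : OpenPartialHomeomorph S ℂ → ℂ → ℝ}
    (hd : IsDensity d) (hG : IsRep τ e z G) (hG' : IsRep τ e' z G')
    (hτ : ContinuousOn τ Tri) (hz : z ∈ Tri) :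
    d e' (G' z) * jac G' z = d e (G z) * jac G z := by
  have hm := hG.mem_transition hz hG'.mem_source
  rw [hG.jac_eq h hG' hτ hz, hd e hG.mem_atlas e' hG'.mem_atlas _ hm, hG'.apply_eq hz,
    hG.apply_eq hz, e.left_inv hG.mem_source]
  ring

end Rep

/-! ### Connection form, curvature and orientation pulled back to a triangle -/

section Triangle

variable {S : Type*} [TopologicalSpace S] [ChartedSpace ℂ S]

/-- A chosen smooth extension of `τ` near `z`, read in the preferred chart at `τ z`. -/
def triRep (τ : ℂ → S) (z : ℂ) : ℂ → ℂ :=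
  Classical.epsilon fun G => IsRep τ (chartAt ℂ (τ z)) z G

theorem IsSmoothTriangle.isRep {τ : ℂ → S} (hτ : IsSmoothTriangle τ) {z : ℂ} (hz : z ∈ Tri) :
    IsRep τ (chartAt ℂ (τ z)) z (triRep τ z) :=
  Classical.epsilon_spec (hτ.exists_rep z hz)

/-- The connection form of the frame `τ_* w` on the triangle. -/
def triConn (h : ConformalMetric S) (τ : ℂ → S) (w v z : ℂ) : ℂ :=
  frameConn (h.conn (chartAt ℂ (τ z))) (triRep τ z) w v z

/-- The quotient of the tangent vectors `τ_* w` and `τ_* v`. -/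
def triQuot (τ : ℂ → S) (w v z : ℂ) : ℂ :=
  dirDeriv (triRep τ z) v z / dirDeriv (triRep τ z) w z

/-- The pull-back to the triangle of a 2-form. -/
def triDensity (d : OpenPartialHomeomorph S ℂ → ℂ → ℝ) (τ : ℂ → S) (z : ℂ) : ℝ :=
  d (chartAt ℂ (τ z)) (triRep τ z z) * jac (triRep τ z) z

variable {τ : ℂ → S} {e : OpenPartialHomeomorph S ℂ} {z : ℂ} {G : ℂ → ℂ}

/-- The imaginary part is the Jacobian divided by `|τ_* 1|²`; its sign records the orientation. -/
theorem im_triQuot_ne_zero (hτ : IsSmoothTriangle τ) (hz : z ∈ Tri) :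
    (triQuot τ 1 Complex.I z).im ≠ 0 := by
  have hG := hτ.isRep hz
  have h0 := dirDeriv_ne_zero_of_jac hG.jac_ne one_ne_zero
  have h1 : triQuot τ 1 Complex.I z = ((Complex.normSq (dirDeriv (triRep τ z) 1 z))⁻¹ : ℝ) *
      (conj (dirDeriv (triRep τ z) 1 z) * dirDeriv (triRep τ z) Complex.I z) := by
    rw [triQuot, Complex.ofReal_inv, Complex.normSq_eq_conj_mul_self]
    have : conj (dirDeriv (triRep τ z) 1 z) ≠ 0 := by simpa using h0
    field_simp
  rw [h1, Complex.im_ofReal_mul]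
  exact mul_ne_zero (inv_ne_zero (by simpa using h0)) hG.jac_ne

theorem continuousOn_curv (h : ConformalMetric S) {e : OpenPartialHomeomorph S ℂ}
    (he : e ∈ atlas ℂ S) : ContinuousOn (h.curv e) e.target := by
  intro z hz
  have h1 := h.contDiffAt_conn he hz
  have h2 : ∀ v, ContinuousAt (dirDeriv (h.conn e) v) z := fun v =>
    (contDiffAt_dirDeriv h1 v).continuousAt
  exact (Complex.continuous_re.continuousAt.comp
    ((h2 1).add (continuousAt_const.mul (h2 Complex.I)))).continuousWithinAt

variable [IsManifold 𝓘(ℂ) ω S]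

theorem IsRep.triConn_eq (hG : IsRep τ e z G) (h : ConformalMetric S) (hτ : IsSmoothTriangle τ)
    (hz : z ∈ Tri) {w : ℂ} (hw : w ≠ 0) (v : ℂ) :
    triConn h τ w v z = frameConn (h.conn e) G w v z :=
  hG.frameConn_eq h (hτ.isRep hz) hτ.continuousOn hz hw v

theorem IsRep.triQuot_eq (hG : IsRep τ e z G) (h : ConformalMetric S) (hτ : IsSmoothTriangle τ)
    (hz : z ∈ Tri) (w v : ℂ) : triQuot τ w v z = dirDeriv G v z / dirDeriv G w z := by
  obtain ⟨c, hc, hcv⟩ := hG.dirDeriv_eq_mul h (hτ.isRep hz) hτ.continuousOn hz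
  rw [triQuot, hcv, hcv, mul_div_mul_left _ _ hc]

theorem IsRep.triDensity_eq (hG : IsRep τ e z G) (h : ConformalMetric S) (hτ : IsSmoothTriangle τ)
    (hz : z ∈ Tri) {d : OpenPartialHomeomorph S ℂ → ℂ → ℝ} (hd : IsDensity d) :
    triDensity d τ z = d e (G z) * jac G z :=
  hG.density_eq h hd (hτ.isRep hz) hτ.continuousOn hz

theorem continuousOn_triDensity (h : ConformalMetric S) (hτ : IsSmoothTriangle τ)
    {d : OpenPartialHomeomorph S ℂ → ℂ → ℝ} (hd : IsDensity d)
    (hc : ∀ e ∈ atlas ℂ S, ContinuousOn (d e) e.target) : ContinuousOn (triDensity d τ) Tri := by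
  intro z hz
  have hG := hτ.isRep hz
  set e := chartAt ℂ (τ z)
  have h1 : ContinuousAt (fun w => d e (triRep τ z w) * jac (triRep τ z) w) z :=
    (ContinuousAt.comp ((hc e hG.mem_atlas).continuousAt
      (e.open_target.mem_nhds (hG.apply_mem hz))) hG.differentiableAt.continuousAt).mul
      hG.continuousAt_jac
  refine h1.continuousWithinAt.congr_of_eventuallyEq ?_ (hG.triDensity_eq h hτ hz hd)
  filter_upwards [hG.eventually_isRep hτ.continuousOn hz, self_mem_nhdsWithin] with w hw hwT
  exact hw.triDensity_eq h hτ hwT hd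

theorem continuousOn_triConn (h : ConformalMetric S) (hτ : IsSmoothTriangle τ) {w : ℂ}
    (hw : w ≠ 0) (v : ℂ) : ContinuousOn (triConn h τ w v) Tri := by
  intro z hz
  have hG := hτ.isRep hz
  set e := chartAt ℂ (τ z)
  have h1 : ContinuousAt (frameConn (h.conn e) (triRep τ z) w v) z :=
    ((dirDeriv_frameConn hG.smooth ((h.contDiffAt_conn hG.mem_atlas
      (hG.apply_mem hz)).differentiableAt (by simp))
        (dirDeriv_ne_zero_of_jac hG.jac_ne hw)).1 v).continuousAt
  refine h1.continuousWithinAt.congr_of_eventuallyEq ?_ (hG.triConn_eq h hτ hz hw v)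
  filter_upwards [hG.eventually_isRep hτ.continuousOn hz, self_mem_nhdsWithin] with x hx hxT
  exact hx.triConn_eq h hτ hxT hw v

theorem continuousOn_triQuot (h : ConformalMetric S) (hτ : IsSmoothTriangle τ) {w : ℂ}
    (hw : w ≠ 0) (v : ℂ) : ContinuousOn (triQuot τ w v) Tri := by
  intro z hz
  have hG := hτ.isRep hz
  have h1 := (hG.continuousAt_dirDeriv v).div (hG.continuousAt_dirDeriv w)
    (dirDeriv_ne_zero_of_jac hG.jac_ne hw)
  refine h1.continuousWithinAt.congr_of_eventuallyEq ?_ (hG.triQuot_eq h hτ hz w v)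
  filter_upwards [hG.eventually_isRep hτ.continuousOn hz, self_mem_nhdsWithin] with x hx hxT
  exact hx.triQuot_eq h hτ hxT w v

theorem isDensity_curv (h : ConformalMetric S) : IsDensity h.curv :=
  fun _ he _ he' _ hz => h.curv_transform he he' hz

/-- Green's theorem for the connection form on a smooth triangle. -/
theorem green_triConn (h : ConformalMetric S) (hτ : IsSmoothTriangle τ) :
    ∫ z in Tri, triDensity h.curv τ z =
      (∫ s in (0 : ℝ)..1, (triConn h τ 1 1 s).im) +
      (∫ t in (0 : ℝ)..1, (triConn h τ 1 Complex.I ⟨1, t⟩).im) -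
      ∫ s in (0 : ℝ)..1, ((triConn h τ 1 1 ⟨s, s⟩).im + (triConn h τ 1 Complex.I ⟨s, s⟩).im) := by
  refine green_triangle (P := fun z => (triConn h τ 1 1 z).im)
    (Q := fun z => (triConn h τ 1 Complex.I z).im)
    (Complex.continuous_im.comp_continuousOn (continuousOn_triConn h hτ one_ne_zero 1))
    (Complex.continuous_im.comp_continuousOn (continuousOn_triConn h hτ one_ne_zero Complex.I))
    (continuousOn_triDensity h hτ (isDensity_curv h) fun e he => continuousOn_curv h he) ?_
  intro z hz
  have hzT := triInt_subset_tri hz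
  have hG := hτ.isRep hzT
  set e := chartAt ℂ (τ z)
  -- The charts and extensions in `triConn` vary with the point; near an interior point they may be
  -- frozen, after which the form can be differentiated.
  have hev : ∀ v, triConn h τ 1 v =ᶠ[𝓝 z] frameConn (h.conn e) (triRep τ z) 1 v := by
    intro v
    have hn : 𝓝[Tri] z = 𝓝 z := nhdsWithin_eq_nhds.2
      (Filter.mem_of_superset (isOpen_triInt.mem_nhds hz) triInt_subset_tri)
    have h1 := hG.eventually_isRep hτ.continuousOn hzT
    rw [hn] at h1
    filter_upwards [h1, isOpen_triInt.mem_nhds hz] with x hx hxT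
    exact hx.triConn_eq h hτ (triInt_subset_tri hxT) one_ne_zero v
  obtain ⟨hd, hcurl⟩ := dirDeriv_frameConn hG.smooth ((h.contDiffAt_conn hG.mem_atlas
      (hG.apply_mem hzT)).differentiableAt (by simp))
        (dirDeriv_ne_zero_of_jac hG.jac_ne one_ne_zero)
  have hd' : ∀ v, DifferentiableAt ℝ (triConn h τ 1 v) z := fun v =>
    (hd v).congr_of_eventuallyEq (hev v)
  have him : ∀ v, HasFDerivAt (fun x => (triConn h τ 1 v x).im)
      (Complex.imCLM.comp (fderiv ℝ (triConn h τ 1 v) z)) z := fun v =>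
    Complex.imCLM.hasFDerivAt.comp z (hd' v).hasFDerivAt
  refine ⟨(him 1).differentiableAt, (him Complex.I).differentiableAt, ?_⟩
  rw [(him 1).fderiv, (him Complex.I).fderiv, (hev 1).fderiv_eq, (hev Complex.I).fderiv_eq]
  change Complex.im (dirDeriv _ _ _) - Complex.im (dirDeriv _ _ _) = _
  rw [← Complex.sub_im, hcurl, h.dbar2_conn hG.mem_atlas (hG.apply_mem hzT), triDensity]
  simp
  ring

end Triangle

/-! ### The Gauss-Bonnet theorem for a smooth triangle -/

section Angles

/-- Here `(1 + m)/m = 1 + 1/m` lies in the lower half-plane, and no branch is crossed in `arg (1 +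
m) - arg m`. -/
theorem abs_arg_one_add_div {m : ℂ} (hm : 0 < m.im) :
    |Complex.arg ((1 + m) / m)| = Complex.arg m - Complex.arg (1 + m) := by
  have h0 : m ≠ 0 := fun h => by simp [h] at hm
  have h1 : (1 + m) ≠ 0 := fun h => by
    have := congrArg Complex.im h
    simp at this
    exact hm.ne' this
  have a1 : 0 < Complex.arg m := by
    refine lt_of_le_of_ne (Complex.arg_nonneg_iff.2 hm.le) fun h => ?_
    have := (Complex.arg_eq_zero_iff.1 h.symm).2
    exact hm.ne' this
  have a1' : Complex.arg m < Real.pi := by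
    refine lt_of_le_of_ne (Complex.arg_le_pi m) fun h => ?_
    exact hm.ne' (Complex.arg_eq_pi_iff.1 h).2
  have hm1 : 0 < (1 + m).im := by simpa using hm
  have a2 : 0 ≤ Complex.arg (1 + m) := Complex.arg_nonneg_iff.2 hm1.le
  have a2' : Complex.arg (1 + m) < Real.pi := by
    refine lt_of_le_of_ne (Complex.arg_le_pi _) fun h => ?_
    exact hm1.ne' (Complex.arg_eq_pi_iff.1 h).2
  have hinv : Complex.arg m⁻¹ = -Complex.arg m := by
    rw [Complex.arg_inv, if_neg a1'.ne]
  have hq : Complex.arg ((1 + m) / m) = Complex.arg (1 + m) - Complex.arg m := by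
    rw [div_eq_mul_inv, Complex.arg_mul h1 (inv_ne_zero h0), hinv, sub_eq_add_neg]
    rw [hinv]
    constructor <;> linarith
  have hneg : Complex.arg ((1 + m) / m) < 0 := by
    rw [Complex.arg_neg_iff]
    have : (1 + m) / m = m⁻¹ + 1 := by field_simp
    rw [this]
    simp only [Complex.add_im, Complex.inv_im, Complex.one_im, add_zero]
    exact div_neg_of_neg_of_pos (by linarith) (Complex.normSq_pos.2 h0)
  rw [abs_of_neg hneg, hq]
  ring

/-- The numbers `ma`, `mb`, `mc` are the values of `τ_* i / τ_* 1` at the vertices `0`, `1`, `1 +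
i`. The angles there are `arg (1 + ma)`, `π - arg mb` and `arg mc - arg (1 + mc)`. -/
theorem angle_sum_of_pos {ma mb mc : ℂ} (ha : 0 < ma.im) (hb : 0 < mb.im) (hc : 0 < mc.im) :
    -Complex.arg mc + Complex.arg mb + Complex.arg (1 + mc) - Complex.arg (1 + ma) =
      Real.pi - (|Complex.arg (1 + ma)| + |Complex.arg (-mb)| + |Complex.arg ((1 + mc) / mc)|) := by
  have h1 : 0 ≤ Complex.arg (1 + ma) := Complex.arg_nonneg_iff.2 (by simpa using ha.le)
  rw [abs_arg_one_add_div hc, abs_of_nonneg h1,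
    Complex.arg_neg_eq_arg_sub_pi_of_im_pos hb, abs_of_nonpos (by linarith [Complex.arg_le_pi mb])]
  ring

theorem arg_conj_of_im_ne {z : ℂ} (hz : z.im ≠ 0) : Complex.arg (conj z) = -Complex.arg z := by
  rw [Complex.arg_conj, if_neg]
  intro h
  exact hz (Complex.arg_eq_pi_iff.1 h).2

theorem abs_arg_conj (z : ℂ) : |Complex.arg (conj z)| = |Complex.arg z| := by
  rw [Complex.arg_conj]
  split_ifs with h
  · rw [h]
  · rw [abs_neg]

/-- Complex conjugation reverses the orientation and preserves unsigned angles. -/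
theorem angle_sum_of_neg {ma mb mc : ℂ} (ha : ma.im < 0) (hb : mb.im < 0) (hc : mc.im < 0) :
    -(-Complex.arg mc + Complex.arg mb + Complex.arg (1 + mc) - Complex.arg (1 + ma)) =
      Real.pi - (|Complex.arg (1 + ma)| + |Complex.arg (-mb)| + |Complex.arg ((1 + mc) / mc)|) := by
  have h := angle_sum_of_pos (ma := conj ma) (mb := conj mb) (mc := conj mc)
    (by simpa using ha) (by simpa using hb) (by simpa using hc)
  have e1 : (1 : ℂ) + conj ma = conj (1 + ma) := by simp
  have e2 : (1 : ℂ) + conj mc = conj (1 + mc) := by simp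
  rw [e1, e2, ← map_neg, ← map_div₀, abs_arg_conj, abs_arg_conj, abs_arg_conj,
    arg_conj_of_im_ne hc.ne, arg_conj_of_im_ne hb.ne, arg_conj_of_im_ne (by simpa using hc.ne),
    arg_conj_of_im_ne (by simpa using ha.ne)] at h
  linarith

end Angles

/-! ### Rotation of the sides of a triangle and the argument terms -/

section Edges

variable {S : Type*} [TopologicalSpace S] [ChartedSpace ℂ S]

/-- The rotation of the velocity of a curve with respect to the Levi-Civita connection. -/
def curveRotation (h : ConformalMetric S) (γ : ℝ → S) (s : ℝ) : ℝ :=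
  (deriv (deriv fun t => chartAt ℂ (γ s) (γ t)) s / deriv (fun t => chartAt ℂ (γ s) (γ t)) s +
    h.conn (chartAt ℂ (γ s)) (chartAt ℂ (γ s) (γ s)) *
      deriv (fun t => chartAt ℂ (γ s) (γ t)) s).im

/-- The total rotation of a curve. -/
def totalRotation (h : ConformalMetric S) (γ : ℝ → S) : ℝ :=
  ∫ s in (0 : ℝ)..1, curveRotation h γ s

variable {τ : ℂ → S}

theorem hasDerivAt_line (z v : ℂ) (s : ℝ) : HasDerivAt (fun t : ℝ => z + t * v) v s := by
  simpa using ((Complex.ofRealCLM.hasDerivAt (x := s)).mul_const v).const_add z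

theorem hasDerivAt_along_line {F : ℂ → ℂ} {z v : ℂ} {s : ℝ}
    (hF : DifferentiableAt ℝ F (z + s * v)) :
    HasDerivAt (fun t : ℝ => F (z + t * v)) (dirDeriv F v (z + s * v)) s :=
  hF.hasFDerivAt.comp_hasDerivAt s (hasDerivAt_line z v s)

theorem tendsto_line_tri {z v : ℂ} (hl : ∀ t ∈ Set.Icc (0 : ℝ) 1, z + t * v ∈ Tri) {s : ℝ}
    (hs : s ∈ Set.Ioo (0 : ℝ) 1) :
    Filter.Tendsto (fun t : ℝ => z + t * v) (𝓝 s) (𝓝[Tri] (z + s * v)) := by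
  refine tendsto_nhdsWithin_iff.2 ⟨(hasDerivAt_line z v s).continuousAt, ?_⟩
  filter_upwards [Ioo_mem_nhds hs.1 hs.2] with t ht using hl t ⟨ht.1.le, ht.2.le⟩

/-- The velocity of the image of a line is the frame vector `τ_* v` itself. Endpoints are excluded
because beyond them the line may leave the triangle, where `τ` is uncontrolled. -/
theorem curveRotation_eq (h : ConformalMetric S) (hτ : IsSmoothTriangle τ) {z v : ℂ}
    (hl : ∀ t ∈ Set.Icc (0 : ℝ) 1, z + t * v ∈ Tri) {s : ℝ} (hs : s ∈ Set.Ioo (0 : ℝ) 1) :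
    curveRotation h (fun t => τ (z + t * v)) s = (triConn h τ v v (z + s * v)).im := by
  have hzT := hl s ⟨hs.1.le, hs.2.le⟩
  have hG := hτ.isRep hzT
  have htend := tendsto_line_tri hl hs
  set G := triRep τ (z + s * v) with hGdef
  have h1 : (fun t : ℝ => chartAt ℂ (τ (z + s * v)) (τ (z + t * v))) =ᶠ[𝓝 s]
      fun t => G (z + t * v) := by
    filter_upwards [htend.eventually hG.eventually_eq] with t ht using ht.symm
  have h2 : deriv (fun t : ℝ => chartAt ℂ (τ (z + s * v)) (τ (z + t * v))) =ᶠ[𝓝 s]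
      fun t => dirDeriv G v (z + t * v) := by
    have h3 := (htend.mono_right nhdsWithin_le_nhds).eventually (hG.smooth.eventually (by simp))
    filter_upwards [h1.eventually_nhds, h3] with t ht ht'
    rw [Filter.EventuallyEq.deriv_eq ht]
    exact (hasDerivAt_along_line (ht'.differentiableAt (by simp))).deriv
  have h4 : DifferentiableAt ℝ (dirDeriv G v) (z + s * v) :=
    (contDiffAt_dirDeriv_of_le (m := 2) hG.smooth (by norm_num) v).differentiableAt (by simp)
  rw [curveRotation, triConn, frameConn, h2.deriv_eq, h2.eq_of_nhds,
    (hasDerivAt_along_line h4).deriv, ← hGdef, hG.apply_eq hzT]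

theorem totalRotation_eq (h : ConformalMetric S) (hτ : IsSmoothTriangle τ) {z v : ℂ}
    (hl : ∀ t ∈ Set.Icc (0 : ℝ) 1, z + t * v ∈ Tri) :
    totalRotation h (fun t => τ (z + t * v)) =
      ∫ s in (0 : ℝ)..1, (triConn h τ v v (z + s * v)).im := by
  refine intervalIntegral.integral_congr_ae ?_
  rw [Set.uIoc_of_le zero_le_one]
  have hne : ∀ᵐ s : ℝ, s ≠ 1 := by simp [ae_iff, measure_singleton]
  filter_upwards [hne] with s hs hs'
  exact curveRotation_eq h hτ hl ⟨hs'.1, lt_of_le_of_ne hs'.2 hs⟩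

theorem triQuot_one_eq (hτ : IsSmoothTriangle τ) {z : ℂ} (hz : z ∈ Tri) (v : ℂ) :
    triQuot τ 1 v z = v.re + v.im * triQuot τ 1 Complex.I z := by
  have h0 := dirDeriv_ne_zero_of_jac (hτ.isRep hz).jac_ne one_ne_zero
  rw [triQuot, triQuot, dirDeriv_apply]
  simp only [Complex.real_smul]
  field_simp

variable [IsManifold 𝓘(ℂ) ω S]

/-- The connection forms of two frames differ by the logarithmic derivative of their quotient; the
`φ` terms cancel. The condition `v.im ≠ 0` keeps the quotient off the real axis, away from the
branch cut. -/
theorem hasDerivAt_log_triQuot (h : ConformalMetric S) (hτ : IsSmoothTriangle τ) {z v : ℂ}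
    (hl : ∀ t ∈ Set.Icc (0 : ℝ) 1, z + t * v ∈ Tri) (hv : v.im ≠ 0) {s : ℝ}
    (hs : s ∈ Set.Ioo (0 : ℝ) 1) :
    HasDerivAt (fun t : ℝ => Complex.log (triQuot τ 1 v (z + t * v)))
      (triConn h τ v v (z + s * v) - triConn h τ 1 v (z + s * v)) s := by
  have hzT := hl s ⟨hs.1.le, hs.2.le⟩
  have hG := hτ.isRep hzT
  have htend := tendsto_line_tri hl hs
  have hv0 : v ≠ 0 := fun h => hv (by simp [h])
  have him : (triQuot τ 1 v (z + s * v)).im ≠ 0 := by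
    rw [triQuot_one_eq hτ hzT]
    simpa using ⟨hv, im_triQuot_ne_zero hτ hzT⟩
  have hev : (fun t : ℝ => triQuot τ 1 v (z + t * v)) =ᶠ[𝓝 s] fun t =>
      dirDeriv (triRep τ (z + s * v)) v (z + t * v) /
        dirDeriv (triRep τ (z + s * v)) 1 (z + t * v) := by
    filter_upwards [htend.eventually (hG.eventually_isRep hτ.continuousOn hzT),
      htend.eventually self_mem_nhdsWithin] with t ht htT
    exact ht.triQuot_eq h hτ htT 1 v
  set G := triRep τ (z + s * v) with hGdef
  have hd (w : ℂ) : DifferentiableAt ℝ (dirDeriv G w) (z + s * v) :=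
    (contDiffAt_dirDeriv_of_le (m := 2) hG.smooth (by norm_num) w).differentiableAt (by simp)
  have h1 := dirDeriv_ne_zero_of_jac hG.jac_ne one_ne_zero
  have h2 := dirDeriv_ne_zero_of_jac hG.jac_ne hv0
  have hq := ((hasDerivAt_along_line (hd v)).div (hasDerivAt_along_line (hd 1))
    h1).congr_of_eventuallyEq hev
  have hlog := hq.clog_real (Or.inr him)
  convert hlog using 1
  rw [triConn, triConn, frameConn, frameConn, hev.eq_of_nhds, ← hGdef]
  field_simp
  ring

theorem integral_triConn_along (h : ConformalMetric S) (hτ : IsSmoothTriangle τ) {z v : ℂ}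
    (hl : ∀ t ∈ Set.Icc (0 : ℝ) 1, z + t * v ∈ Tri) (hv : v.im ≠ 0) :
    ∫ s in (0 : ℝ)..1, (triConn h τ 1 v (z + s * v)).im =
      totalRotation h (fun t => τ (z + t * v)) -
        (Complex.arg (triQuot τ 1 v (z + v)) - Complex.arg (triQuot τ 1 v z)) := by
  have hv0 : v ≠ 0 := fun h => hv (by simp [h])
  have hcl : Continuous (fun t : ℝ => z + t * v) := by fun_prop
  have hc (w : ℂ) (hw : w ≠ 0) :
      ContinuousOn (fun t : ℝ => (triConn h τ w v (z + t * v)).im) (Set.Icc 0 1) :=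
    Complex.continuous_im.comp_continuousOn
      ((continuousOn_triConn h hτ hw v).comp hcl.continuousOn hl)
  have hi (w : ℂ) (hw : w ≠ 0) : IntervalIntegrable
      (fun t : ℝ => (triConn h τ w v (z + t * v)).im) volume 0 1 :=
    ContinuousOn.intervalIntegrable (by rw [Set.uIcc_of_le zero_le_one]; exact hc w hw)
  have hlogc : ContinuousOn (fun t : ℝ => (Complex.log (triQuot τ 1 v (z + t * v))).im)
      (Set.Icc 0 1) := by
    refine Complex.continuous_im.comp_continuousOn (ContinuousOn.clog
      ((continuousOn_triQuot h hτ one_ne_zero v).comp hcl.continuousOn hl) fun t ht => Or.inr ?_)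
    rw [triQuot_one_eq hτ (hl t ht)]
    simpa using ⟨hv, im_triQuot_ne_zero hτ (hl t ht)⟩
  have hftc := intervalIntegral.integral_eq_sub_of_hasDerivAt_of_le zero_le_one hlogc
    (f' := fun t => (triConn h τ v v (z + t * v)).im - (triConn h τ 1 v (z + t * v)).im)
    (fun s hs => by
      have := Complex.imCLM.hasFDerivAt.comp_hasDerivAt s (hasDerivAt_log_triQuot h hτ hl hv hs)
      rw [map_sub] at this
      exact this) ((hi v hv0).sub (hi 1 one_ne_zero))
  rw [intervalIntegral.integral_sub (hi v hv0) (hi 1 one_ne_zero),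
    ← totalRotation_eq h hτ hl] at hftc
  simp only [Complex.log_im, Complex.ofReal_one, one_mul, Complex.ofReal_zero, zero_mul,
    add_zero] at hftc
  linarith

/-- The **Gauss-Bonnet formula** on a smooth triangle, in terms of arguments of quotients of
tangent vectors. -/
theorem gauss_bonnet_arg (h : ConformalMetric S) (hτ : IsSmoothTriangle τ) :
    ∫ z in Tri, triDensity h.curv τ z =
      totalRotation h (fun t => τ t) + totalRotation h (fun t => τ (1 + t * Complex.I)) -
        totalRotation h (fun t => τ (t * (1 + Complex.I))) +
      (-Complex.arg (triQuot τ 1 Complex.I (1 + Complex.I)) +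
        Complex.arg (triQuot τ 1 Complex.I 1) +
        Complex.arg (1 + triQuot τ 1 Complex.I (1 + Complex.I)) -
        Complex.arg (1 + triQuot τ 1 Complex.I 0)) := by
  have l1 : ∀ t ∈ Set.Icc (0 : ℝ) 1, (0 : ℂ) + t * 1 ∈ Tri := fun t ht => by
    simpa [Tri] using ht
  have l2 : ∀ t ∈ Set.Icc (0 : ℝ) 1, (1 : ℂ) + t * Complex.I ∈ Tri := fun t ht => by
    simpa [Tri] using ht
  have l3 : ∀ t ∈ Set.Icc (0 : ℝ) 1, (0 : ℂ) + t * (1 + Complex.I) ∈ Tri := fun t ht => by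
    simpa [Tri] using ht
  -- On the bottom side the frame `τ_* 1` is already tangent, so only the other two sides contribute
  -- arguments.
  have e1 := totalRotation_eq h hτ l1
  have e2 := integral_triConn_along h hτ l2 (by simp)
  have e3 := integral_triConn_along h hτ l3 (by simp)
  have z0 : (0 : ℂ) ∈ Tri := by norm_num [Tri]
  have z1 : (1 + Complex.I : ℂ) ∈ Tri := by norm_num [Tri]
  simp only [zero_add, mul_one] at e1 e2 e3
  rw [triQuot_one_eq hτ z1 (1 + Complex.I), triQuot_one_eq hτ z0 (1 + Complex.I)] at e3
  simp only [Complex.add_re, Complex.one_re, Complex.I_re, add_zero, Complex.add_im,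
    Complex.one_im, Complex.I_im, zero_add, Complex.ofReal_one, one_mul] at e3
  rw [green_triConn h hτ, ← e1]
  have f2 : ∫ t in (0 : ℝ)..1, (triConn h τ 1 Complex.I ⟨1, t⟩).im =
      ∫ t in (0 : ℝ)..1, (triConn h τ 1 Complex.I (1 + t * Complex.I)).im := by
    congr 1; funext t; congr 2
    apply Complex.ext <;> simp
  -- The connection form is real linear in the direction, so on the diagonal the two values add up
  -- to the value at `1 + i`.
  have f3 : ∫ s in (0 : ℝ)..1, ((triConn h τ 1 1 ⟨s, s⟩).im + (triConn h τ 1 Complex.I ⟨s, s⟩).im) =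
      ∫ s in (0 : ℝ)..1, (triConn h τ 1 (1 + Complex.I) (s * (1 + Complex.I))).im := by
    congr 1; funext s
    have hs : (⟨s, s⟩ : ℂ) = s * (1 + Complex.I) := by apply Complex.ext <;> simp
    rw [hs, ← Complex.add_im]
    congr 1
    simp only [triConn, frameConn]
    rw [dirDeriv_apply (F := dirDeriv _ 1) (1 + Complex.I),
      dirDeriv_apply (F := triRep _ _) (1 + Complex.I)]
    simp
    ring
  rw [f2, f3, e2, e3]
  ring

end Edges

/-! ### The triangles of a smooth triangulation -/

section Bary

variable {n : ℕ}

/-- The vertex `i` of the standard simplex. -/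
def vert (i : Fin n) : Fin n → ℝ := Pi.single i 1

/-- The linear part of the affine parametrization of the triangle `a b c`. -/
def triLin (a b c : Fin n) : ℂ →L[ℝ] (Fin n → ℝ) :=
  Complex.reCLM.smulRight (vert b - vert a) + Complex.imCLM.smulRight (vert c - vert b)

theorem triLin_apply (a b c : Fin n) (z : ℂ) :
    triLin a b c z = z.re • (vert b - vert a) + z.im • (vert c - vert b) := by
  simp [triLin]

/-- The affine parametrization of the triangle `a b c` by the standard triangle. -/
def triParam (a b c : Fin n) (z : ℂ) : Fin n → ℝ := vert a + triLin a b c z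

variable {a b c : Fin n}

theorem vert_self (i : Fin n) : vert i i = 1 := by simp [vert]

theorem vert_ne {i j : Fin n} (h : j ≠ i) : vert i j = 0 := by simp [vert, h]

theorem sum_vert (i : Fin n) : ∑ j, vert i j = 1 := by simp [vert]

theorem triLin_fst (hab : a ≠ b) (hac : a ≠ c) (z : ℂ) : triLin a b c z a = -z.re := by
  simp [triLin_apply, vert_self, vert_ne hab, vert_ne hac]

theorem triLin_snd (hab : a ≠ b) (hbc : b ≠ c) (z : ℂ) : triLin a b c z b = z.re - z.im := by
  simp [triLin_apply, vert_self, vert_ne hab.symm, vert_ne hbc]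
  ring

theorem triLin_trd (hac : a ≠ c) (hbc : b ≠ c) (z : ℂ) : triLin a b c z c = z.im := by
  simp [triLin_apply, vert_self, vert_ne hac.symm, vert_ne hbc.symm]

theorem triLin_of_notMem {i : Fin n} (hi : i ∉ ({a, b, c} : Finset (Fin n))) (z : ℂ) :
    triLin a b c z i = 0 := by
  simp only [Finset.mem_insert, Finset.mem_singleton, not_or] at hi
  simp [triLin_apply, vert_ne hi.1, vert_ne hi.2.1, vert_ne hi.2.2]

theorem sum_triLin (z : ℂ) : ∑ i, triLin a b c z i = 0 := by
  simp [triLin_apply, Finset.sum_add_distrib, ← Finset.mul_sum, sum_vert]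

theorem sum_three {M : Type*} [AddCommMonoid M] (hab : a ≠ b) (hac : a ≠ c) (hbc : b ≠ c)
    (f : Fin n → M) : ∑ i ∈ ({a, b, c} : Finset (Fin n)), f i = f a + f b + f c := by
  rw [Finset.sum_insert (by simp [hab, hac]), Finset.sum_insert (by simp [hbc]),
    Finset.sum_singleton, add_assoc]

theorem exists_triLin_eq (hab : a ≠ b) (hac : a ≠ c) (hbc : b ≠ c) {u : Fin n → ℝ}
    (hsum : ∑ i, u i = 0) (hu : ∀ i, i ∉ ({a, b, c} : Finset (Fin n)) → u i = 0) :
    triLin a b c ⟨-u a, u c⟩ = u := by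
  have h3 : u a + u b + u c = 0 := by
    rw [← sum_three hab hac hbc u, ← hsum]
    exact Finset.sum_subset (Finset.subset_univ _) fun i _ hi => hu i hi
  funext i
  by_cases hi : i ∈ ({a, b, c} : Finset (Fin n))
  · simp only [Finset.mem_insert, Finset.mem_singleton] at hi
    rcases hi with rfl | rfl | rfl
    · rw [triLin_fst hab hac]; simp
    · rw [triLin_snd hab hbc]; simp only; linarith
    · rw [triLin_trd hac hbc]
  · rw [triLin_of_notMem hi, hu i hi]

theorem triLin_injective (hab : a ≠ b) (hac : a ≠ c) (hbc : b ≠ c) {v : ℂ}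
    (h : triLin a b c v = 0) : v = 0 := by
  have h1 := triLin_fst hab hac v
  have h2 := triLin_trd hac hbc v
  rw [h] at h1 h2
  exact Complex.ext (by simpa using h1.symm) (by simpa using h2.symm)

theorem continuous_triParam : Continuous (triParam a b c) :=
  continuous_const.add (triLin a b c).continuous

theorem triParam_mem (hab : a ≠ b) (hac : a ≠ c) (hbc : b ≠ c) {z : ℂ} (hz : z ∈ Tri) :
    triParam a b c z ∈ simplex ({a, b, c} : Finset (Fin n)) := by
  obtain ⟨h1, h2, h3⟩ := hz
  refine ⟨fun i => ?_, ?_, fun i hi => ?_⟩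
  · by_cases hi : i ∈ ({a, b, c} : Finset (Fin n))
    · simp only [Finset.mem_insert, Finset.mem_singleton] at hi
      simp only [triParam, Pi.add_apply]
      rcases hi with rfl | rfl | rfl
      · rw [triLin_fst hab hac, vert_self]; linarith
      · rw [triLin_snd hab hbc, vert_ne hab.symm]; linarith
      · rw [triLin_trd hac hbc, vert_ne hac.symm]; linarith
    · simp only [triParam, Pi.add_apply]
      rw [triLin_of_notMem hi, vert_ne (fun h => hi (by simp [h]))]; simp
  · simp [triParam, Finset.sum_add_distrib, sum_vert, sum_triLin]
  · simp only [triParam, Pi.add_apply]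
    rw [triLin_of_notMem hi, vert_ne (fun h => hi (by simp [h]))]; simp

theorem triParam_injective (hab : a ≠ b) (hac : a ≠ c) (hbc : b ≠ c) :
    Function.Injective (triParam a b c) := by
  intro x y h
  have h1 : triLin a b c (x - y) = 0 := by
    rw [map_sub]
    exact sub_eq_zero.2 (add_left_cancel h)
  exact sub_eq_zero.1 (triLin_injective hab hac hbc h1)

theorem exists_triParam_eq (hab : a ≠ b) (hac : a ≠ c) (hbc : b ≠ c) {x : Fin n → ℝ}
    (hx : x ∈ simplex ({a, b, c} : Finset (Fin n))) : ∃ z ∈ Tri, triParam a b c z = x := by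
  obtain ⟨h1, h2, h3⟩ := hx
  have h := exists_triLin_eq hab hac hbc (u := x - vert a)
    (by simp [Finset.sum_sub_distrib, h2, sum_vert]) (fun i hi => by
      simp only [Pi.sub_apply, h3 i hi, vert_ne (fun h : i = a => hi (by simp [h])), sub_zero])
  have hs : x a + x b + x c = 1 := by
    rw [← sum_three hab hac hbc x, ← h2]
    exact Finset.sum_subset (Finset.subset_univ _) fun i _ hi => h3 i hi
  refine ⟨_, ⟨?_, ?_, ?_⟩, by rw [triParam, h]; simp⟩
  · simp only [Pi.sub_apply, vert_ne hac.symm]; linarith [h1 c]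
  · simp only [Pi.sub_apply, vert_ne hac.symm, vert_self]; linarith [h1 b]
  · simp only [Pi.sub_apply, vert_self]; linarith [h1 a]

theorem isCompact_simplex (t : Finset (Fin n)) : IsCompact (simplex t) := by
  have hc : IsClosed (simplex t) := by
    refine IsClosed.and ?_ (IsClosed.and ?_ ?_)
    · simp only [Set.ofPred_forall]
      exact isClosed_iInter fun i => isClosed_le continuous_const (continuous_apply i)
    · exact isClosed_eq (continuous_finsetSum _ fun i _ => continuous_apply i) continuous_const
    · simp only [Set.ofPred_forall]
      exact isClosed_iInter fun i => isClosed_iInter fun _ =>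
        isClosed_eq (continuous_apply i) continuous_const
  refine IsCompact.of_isClosed_subset (isCompact_univ_pi fun _ : Fin n => isCompact_Icc (a := (0:ℝ))
    (b := 1)) hc fun x hx i _ => ⟨hx.1 i, ?_⟩
  rw [← hx.2.1]
  exact Finset.single_le_sum (fun j _ => hx.1 j) (Finset.mem_univ i)

end Bary

namespace SmoothTriangulation

variable {S : Type*} [TopologicalSpace S] [ChartedSpace ℂ S] (T : SmoothTriangulation S)

/-- The geometric realization of the complex. -/
def carrier : Set (Fin T.n → ℝ) := ⋃ t ∈ T.triangles, simplex t

theorem isCompact_carrier : IsCompact T.carrier :=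
  T.triangles.isCompact_biUnion fun t _ => isCompact_simplex t

variable {T}

theorem simplex_subset {t : Finset (Fin T.n)} (ht : t ∈ T.triangles) : simplex t ⊆ T.carrier :=
  Set.subset_biUnion_of_mem (u := fun t => simplex t) ht

variable (T)

/-- A chosen smooth extension near `x` of the restriction of `φ` to the triangle `t`, read in the
preferred chart. -/
def rep (t : Finset (Fin T.n)) (x : Fin T.n → ℝ) : (Fin T.n → ℝ) → ℂ :=
  Classical.epsilon fun G => ContDiffAt ℝ ∞ G x ∧
    (∀ᶠ y in 𝓝[simplex t] x, G y = chartAt ℂ (T.φ x) (T.φ y)) ∧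
    ∀ v : Fin T.n → ℝ, ∑ i, v i = 0 → (∀ i, i ∉ t → v i = 0) → fderiv ℝ G x v = 0 → v = 0

/-- The differential at `x` of the restriction of `φ` to the triangle `t`. -/
def diff (t : Finset (Fin T.n)) (x : Fin T.n → ℝ) : (Fin T.n → ℝ) →L[ℝ] ℂ :=
  fderiv ℝ (T.rep t x) x

variable {T} {t : Finset (Fin T.n)} {x : Fin T.n → ℝ}

theorem rep_spec (ht : t ∈ T.triangles) (hx : x ∈ simplex t) : ContDiffAt ℝ ∞ (T.rep t x) x ∧
    (∀ᶠ y in 𝓝[simplex t] x, T.rep t x y = chartAt ℂ (T.φ x) (T.φ y)) ∧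
    ∀ v : Fin T.n → ℝ, ∑ i, v i = 0 → (∀ i, i ∉ t → v i = 0) → T.diff t x v = 0 → v = 0 :=
  Classical.epsilon_spec (p := fun G : (Fin T.n → ℝ) → ℂ => ContDiffAt ℝ ∞ G x ∧
    (∀ᶠ y in 𝓝[simplex t] x, G y = chartAt ℂ (T.φ x) (T.φ y)) ∧
    ∀ v : Fin T.n → ℝ, ∑ i, v i = 0 → (∀ i, i ∉ t → v i = 0) → fderiv ℝ G x v = 0 → v = 0)
    (T.smooth t ht x hx)

variable {a b c : Fin T.n}

theorem hasFDerivAt_rep_comp {z : ℂ}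
    (hx : ContDiffAt ℝ ∞ (T.rep t (triParam a b c z)) (triParam a b c z)) :
    HasFDerivAt (fun w => T.rep t (triParam a b c z) (triParam a b c w))
      ((T.diff t (triParam a b c z)).comp (triLin a b c)) z :=
  (hx.differentiableAt (by simp)).hasFDerivAt.comp z ((triLin a b c).hasFDerivAt.const_add (vert a))

theorem isRep_rep (hab : a ≠ b) (hac : a ≠ c) (hbc : b ≠ c) (ht : {a, b, c} ∈ T.triangles) {z : ℂ}
    (hz : z ∈ Tri) : IsRep (fun w => T.φ (triParam a b c w))
      (chartAt ℂ (T.φ (triParam a b c z))) z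
      (fun w => T.rep {a, b, c} (triParam a b c z) (triParam a b c w)) := by
  obtain ⟨h1, h2, h3⟩ := rep_spec ht (triParam_mem hab hac hbc hz)
  refine ⟨chart_mem_atlas ℂ _, mem_chart_source ℂ _, ?_, ?_, ?_⟩
  · exact (h1.of_le (by exact WithTop.coe_le_coe.2 (le_top : (3 : ℕ∞) ≤ ⊤))).comp z
      ((contDiff_const.add (triLin a b c).contDiff).contDiffAt)
  · have : Filter.Tendsto (triParam a b c) (𝓝[Tri] z)
        (𝓝[simplex {a, b, c}] (triParam a b c z)) :=
      continuous_triParam.continuousWithinAt.tendsto_nhdsWithin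
        fun w hw => triParam_mem hab hac hbc hw
    exact this.eventually h2
  · refine jac_ne_zero_of_injective fun v hv => ?_
    rw [(hasFDerivAt_rep_comp h1).fderiv] at hv
    exact triLin_injective hab hac hbc
      (h3 _ (sum_triLin v) (fun i hi => triLin_of_notMem hi v) hv)

theorem isSmoothTriangle (hab : a ≠ b) (hac : a ≠ c) (hbc : b ≠ c) (ht : {a, b, c} ∈ T.triangles) :
    IsSmoothTriangle fun w => T.φ (triParam a b c w) :=
  ⟨T.continuousOn.comp continuous_triParam.continuousOn fun _ hz =>
    simplex_subset ht (triParam_mem hab hac hbc hz),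
    fun _ hz => ⟨_, isRep_rep hab hac hbc ht hz⟩⟩

theorem triQuot_eq_diff [IsManifold 𝓘(ℂ) ω S] (h : ConformalMetric S) (hab : a ≠ b) (hac : a ≠ c)
    (hbc : b ≠ c) (ht : {a, b, c} ∈ T.triangles) {z : ℂ} (hz : z ∈ Tri) (w v : ℂ) :
    triQuot (fun w => T.φ (triParam a b c w)) w v z =
      T.diff {a, b, c} (triParam a b c z) (triLin a b c v) /
        T.diff {a, b, c} (triParam a b c z) (triLin a b c w) := by
  have h1 := (rep_spec ht (triParam_mem hab hac hbc hz)).1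
  rw [(isRep_rep hab hac hbc ht hz).triQuot_eq h (isSmoothTriangle hab hac hbc ht) hz w v]
  simp only [dirDeriv, (hasFDerivAt_rep_comp h1).fderiv]
  rfl

end SmoothTriangulation

/-! ### Tangent cones of the triangles at a point -/

/-- The preimage of a ray under a local diffeomorphism of the plane. -/
theorem exists_ray_preimage {G : ℂ → ℂ} {L : ℂ →L[ℝ] ℂ} (hG : HasStrictFDerivAt G L 0)
    (hL : ∀ v, L v = 0 → v = 0) (d : ℂ) :
    ∃ v₀, L v₀ = d ∧ ∃ c : ℝ → ℂ, Filter.Tendsto (fun s : ℝ => s⁻¹ • c s) (𝓝[>] 0) (𝓝 v₀) ∧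
      Filter.Tendsto c (𝓝[>] 0) (𝓝 0) ∧
      (∀ᶠ s : ℝ in 𝓝[>] 0, G (c s) = G 0 + s * d) ∧
      ∃ N ∈ 𝓝 (0 : ℂ), ∀ s : ℝ, ∀ v ∈ N, G v = G 0 + s * d → v = c s := by
  have hinj : Function.Injective (L : ℂ →ₗ[ℝ] ℂ) := by
    rw [← LinearMap.ker_eq_bot, LinearMap.ker_eq_bot']
    exact hL
  -- An injective real-linear endomorphism of the plane is invertible, so the inverse function
  -- theorem applies and `c` is the local inverse applied to the ray.
  set E : ℂ ≃L[ℝ] ℂ :=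
    (LinearEquiv.ofInjectiveEndo (L : ℂ →ₗ[ℝ] ℂ) hinj).toContinuousLinearEquiv with hE
  have hEL : (E : ℂ →L[ℝ] ℂ) = L := by
    ext v; simp [hE]
  rw [← hEL] at hG
  have hline : HasDerivAt (fun s : ℝ => G 0 + s * d) d 0 := by
    simpa using ((Complex.ofRealCLM.hasDerivAt (x := 0)).mul_const d).const_add (G 0)
  have hinv0 : hG.localInverse G E 0 (G 0) = 0 := hG.localInverse_apply_image
  have hder : HasDerivAt (fun s : ℝ => hG.localInverse G E 0 (G 0 + s * d)) (E.symm d) 0 := by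
    have h1 := hG.to_localInverse.hasFDerivAt
    exact HasFDerivAt.comp_hasDerivAt_of_eq (0 : ℝ) h1 hline (by simp)
  refine ⟨E.symm d, ?_, fun s => hG.localInverse G E 0 (G 0 + s * d), ?_, ?_, ?_, ?_⟩
  · rw [← hEL]; simp
  · have := hasDerivAt_iff_tendsto_slope_zero.1 hder
    refine (this.mono_left (nhdsWithin_mono _ fun s hs => ne_of_gt hs)).congr fun s => ?_
    simp
  · have := hder.continuousAt.tendsto
    simp only [Complex.ofReal_zero, zero_mul, add_zero, hinv0] at this
    exact this.mono_left nhdsWithin_le_nhds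
  · have h1 : Filter.Tendsto (fun s : ℝ => G 0 + s * d) (𝓝[>] 0) (𝓝 (G 0)) := by
      have := hline.continuousAt.tendsto
      simp only [Complex.ofReal_zero, zero_mul, add_zero] at this
      exact this.mono_left nhdsWithin_le_nhds
    exact h1.eventually hG.eventually_right_inverse
  · refine ⟨_, hG.eventually_left_inverse, fun s v hv h => ?_⟩
    show v = hG.localInverse G E 0 (G 0 + s * d)
    rw [← h]
    exact hv.symm

namespace SmoothTriangulation

variable {S : Type*} [TopologicalSpace S] [ChartedSpace ℂ S] (T : SmoothTriangulation S)

/-- The interior of the tangent cone at `φ x` of the image of the triangle `t`. -/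
def cone (t : Finset (Fin T.n)) (x : Fin T.n → ℝ) : Set ℂ :=
  {d | ∃ u : Fin T.n → ℝ, ∑ i, u i = 0 ∧ (∀ i, i ∉ t → u i = 0) ∧
    (∀ i ∈ t, x i = 0 → 0 < u i) ∧ T.diff t x u = d}

/-- The tangent cone at `φ x` of the image of the triangle `t`. -/
def closedCone (t : Finset (Fin T.n)) (x : Fin T.n → ℝ) : Set ℂ :=
  {d | ∃ u : Fin T.n → ℝ, ∑ i, u i = 0 ∧ (∀ i, i ∉ t → u i = 0) ∧
    (∀ i ∈ t, x i = 0 → 0 ≤ u i) ∧ T.diff t x u = d}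

variable {T} {t t' : Finset (Fin T.n)} {x : Fin T.n → ℝ}

theorem exists_labels (ht : t ∈ T.triangles) :
    ∃ a b c, a ≠ b ∧ a ≠ c ∧ b ≠ c ∧ t = {a, b, c} :=
  Finset.card_eq_three.1 (T.card_eq t ht)

/-- The preimage of a ray in the plane of a triangle. -/
theorem exists_ray (ht : t ∈ T.triangles) (hx : x ∈ simplex t) (d : ℂ) :
    ∃ u : Fin T.n → ℝ, ∑ i, u i = 0 ∧ (∀ i, i ∉ t → u i = 0) ∧ T.diff t x u = d ∧
    ∃ y : ℝ → Fin T.n → ℝ, Filter.Tendsto (fun s : ℝ => s⁻¹ • (y s - x)) (𝓝[>] 0) (𝓝 u) ∧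
      Filter.Tendsto y (𝓝[>] 0) (𝓝 x) ∧ (∀ s, ∑ i, y s i = 1) ∧ (∀ s i, i ∉ t → y s i = 0) ∧
      (∀ᶠ s : ℝ in 𝓝[>] 0, T.rep t x (y s) = chartAt ℂ (T.φ x) (T.φ x) + s * d) ∧
      ∃ N ∈ 𝓝 x, ∀ s : ℝ, ∀ y' ∈ N ∩ simplex t,
        chartAt ℂ (T.φ x) (T.φ y') = chartAt ℂ (T.φ x) (T.φ x) + s * d → y' = y s := by
  obtain ⟨a, b, c, hab, hac, hbc, rfl⟩ := exists_labels ht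
  obtain ⟨h1, h2, h3⟩ := rep_spec ht hx
  set G : ℂ → ℂ := fun v => T.rep {a, b, c} x (x + triLin a b c v) with hGdef
  have hG0 : G 0 = chartAt ℂ (T.φ x) (T.φ x) := by
    simp only [hGdef, map_zero, add_zero]
    exact h2.self_of_nhdsWithin hx
  have hs : HasStrictFDerivAt G ((T.diff {a, b, c} x).comp (triLin a b c)) 0 := by
    have e1 : HasStrictFDerivAt (fun v => x + triLin a b c v) (triLin a b c) 0 :=
      (triLin a b c).hasStrictFDerivAt.const_add x
    have e2 : HasStrictFDerivAt (T.rep {a, b, c} x) (T.diff {a, b, c} x)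
        (x + triLin a b c 0) := by
      rw [map_zero, add_zero]
      exact h1.hasStrictFDerivAt (by simp)
    exact e2.comp 0 e1
  obtain ⟨v₀, hv₀, c', hc1, hc2, hc3, N, hN, hc4⟩ := exists_ray_preimage hs (fun v hv =>
    triLin_injective hab hac hbc (h3 _ (sum_triLin v) (fun i hi => triLin_of_notMem hi v) hv)) d
  have hcont := (triLin a b c).continuous
  refine ⟨triLin a b c v₀, sum_triLin v₀, fun i hi => triLin_of_notMem hi v₀, hv₀,
    fun s => x + triLin a b c (c' s), ?_, ?_, ?_, ?_, ?_, ?_⟩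
  · refine ((hcont.tendsto v₀).comp hc1).congr fun s => ?_
    simp only [Function.comp_apply, add_sub_cancel_left, map_smul]
  · have := (hcont.tendsto 0).comp hc2
    simpa using this.const_add x
  · intro s
    simp [Finset.sum_add_distrib, hx.2.1, sum_triLin]
  · intro s i hi
    simp only [Pi.add_apply]
    rw [triLin_of_notMem hi, hx.2.2 i hi, add_zero]
  · rw [← hG0]
    exact hc3
  · have hm : ∀ᶠ y' in 𝓝 x, (⟨-(y' - x) a, (y' - x) c⟩ : ℂ) ∈ N := by
      have : Filter.Tendsto (fun y' : Fin T.n → ℝ => (⟨-(y' - x) a, (y' - x) c⟩ : ℂ)) (𝓝 x)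
          (𝓝 0) := by
        have h4 : Continuous fun y' : Fin T.n → ℝ =>
            ((-(y' - x) a : ℝ) : ℂ) + ((y' - x) c : ℝ) * Complex.I := by fun_prop
        have h5 := h4.tendsto x
        simp only [sub_self, Pi.zero_apply, neg_zero, Complex.ofReal_zero, zero_mul,
          add_zero] at h5
        refine h5.congr fun y' => ?_
        apply Complex.ext <;> simp
      exact this.eventually hN
    obtain ⟨M, hM, hM'⟩ := (eventually_nhdsWithin_iff.1 h2).exists_mem
    refine ⟨{y' | (⟨-(y' - x) a, (y' - x) c⟩ : ℂ) ∈ N} ∩ M, Filter.inter_mem hm hM, ?_⟩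
    rintro s y' ⟨⟨hy1, hy2⟩, hy3⟩ hy4
    have h6 := exists_triLin_eq hab hac hbc (u := y' - x)
      (by simp [Finset.sum_sub_distrib, hy3.2.1, hx.2.1])
      (fun i hi => by simp [hy3.2.2 i hi, hx.2.2 i hi])
    have h7 := hc4 s _ hy1 (by
      simp only [hGdef]
      rw [h6, add_sub_cancel, hM' y' hy2 hy3, hy4]
      simp only [hGdef] at hG0
      rw [hG0])
    show y' = x + triLin a b c (c' s)
    rw [← h7, h6, add_sub_cancel]

/-- A direction in the open cone of `t` is realized by points of the open triangle. -/
theorem eventually_of_mem_cone (ht : t ∈ T.triangles) (hx : x ∈ simplex t) {d : ℂ}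
    (hd : d ∈ T.cone t x) : ∀ᶠ s : ℝ in 𝓝[>] 0, ∃ y ∈ simplex t, (∀ i, i ∈ t ↔ y i ≠ 0) ∧
      T.φ y = (chartAt ℂ (T.φ x)).symm (chartAt ℂ (T.φ x) (T.φ x) + s * d) := by
  obtain ⟨u', hu1', hu2', hu3', hu4'⟩ := hd
  obtain ⟨u, hu1, hu2, hu3, y, hy1, hy2, hy3, hy4, hy5, -⟩ := exists_ray ht hx d
  obtain ⟨-, h2, h3⟩ := rep_spec ht hx
  have huu : u' = u := by
    rw [← sub_eq_zero]
    refine h3 _ (by simp [Finset.sum_sub_distrib, hu1, hu1'])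
      (fun i hi => by simp [hu2 i hi, hu2' i hi]) ?_
    rw [map_sub, hu3, hu4', sub_self]
  subst huu
  -- A coordinate positive at `x` stays positive by continuity; one vanishing at `x` becomes
  -- positive because its derivative along the ray is positive.
  have hpos : ∀ᶠ s : ℝ in 𝓝[>] 0, ∀ i ∈ t, 0 < y s i := by
    rw [Filter.eventually_all_finset]
    intro i hi
    rcases (hx.1 i).lt_or_eq with h | h
    · exact ((tendsto_pi_nhds.1 hy2) i).eventually (lt_mem_nhds h)
    · have h4 := ((tendsto_pi_nhds.1 hy1) i).eventually (lt_mem_nhds (hu3' i hi h.symm))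
      filter_upwards [h4, self_mem_nhdsWithin] with s hs hs0
      simp only [Pi.smul_apply, Pi.sub_apply, ← h, sub_zero, smul_eq_mul] at hs
      exact (pos_iff_pos_of_mul_pos hs).1 (inv_pos.2 hs0)
  have hmem : ∀ᶠ s : ℝ in 𝓝[>] 0, y s ∈ simplex t := by
    filter_upwards [hpos] with s hs
    refine ⟨fun i => ?_, hy3 s, hy4 s⟩
    by_cases hi : i ∈ t
    · exact (hs i hi).le
    · rw [hy4 s i hi]
  have htend : Filter.Tendsto y (𝓝[>] 0) (𝓝[simplex t] x) := tendsto_nhdsWithin_iff.2 ⟨hy2, hmem⟩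
  have hsrc : ∀ᶠ y' in 𝓝[simplex t] x, T.φ y' ∈ (chartAt ℂ (T.φ x)).source :=
    ((T.continuousOn.mono (simplex_subset ht)) x hx).eventually
      ((chartAt ℂ (T.φ x)).open_source.mem_nhds (mem_chart_source ℂ _))
  filter_upwards [hpos, hmem, htend.eventually hsrc, htend.eventually h2, hy5]
    with s h4 h5 h6 h7 h8
  refine ⟨y s, h5, fun i => ⟨fun hi => (h4 i hi).ne', fun hi => ?_⟩, ?_⟩
  · by_contra h
    exact hi (hy4 s i h)
  · rw [← h8, h7, (chartAt ℂ (T.φ x)).left_inv h6]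

/-- The open cones of two triangles at a common point are disjoint. -/
theorem eq_of_mem_cone (ht : t ∈ T.triangles) (ht' : t' ∈ T.triangles) (hx : x ∈ simplex t)
    (hx' : x ∈ simplex t') {d : ℂ} (hd : d ∈ T.cone t x) (hd' : d ∈ T.cone t' x) : t = t' := by
  -- A common direction produces one point of `S` interior to both triangles. Injectivity of `φ`
  -- identifies the barycentric points, and their support recovers the triangle.
  obtain ⟨s, ⟨y, h1, hsupp, h3⟩, y', h1', hsupp', h3'⟩ :=
    ((eventually_of_mem_cone ht hx hd).and (eventually_of_mem_cone ht' hx' hd')).exists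
  have : y = y' := T.bijOn.injOn (simplex_subset ht h1) (simplex_subset ht' h1') (h3.trans h3'.symm)
  subst this
  ext i
  rw [hsupp, hsupp']

/-- A map inverse to a continuous injection of a compact set is continuous. -/
theorem tendsto_of_tendsto_comp [T2Space S] {ι : Type*} {l : Filter ι} {y : ι → Fin T.n → ℝ}
    (hx : x ∈ T.carrier) (hy : ∀ s, y s ∈ T.carrier)
    (h : Filter.Tendsto (fun s => T.φ (y s)) l (𝓝 (T.φ x))) : Filter.Tendsto y l (𝓝 x) := by
  rw [tendsto_nhds]
  intro O hO hxO
  -- The image of the complement of `O` is compact, hence closed, and misses `φ x`; points mapped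
  -- near `φ x` must lie in `O`.
  have hK : IsCompact (T.φ '' (T.carrier \ O)) :=
    (T.isCompact_carrier.diff hO).image_of_continuousOn (T.continuousOn.mono Set.sdiff_subset)
  have hnot : T.φ x ∉ T.φ '' (T.carrier \ O) := by
    rintro ⟨x', ⟨h1, h2⟩, h3⟩
    rw [T.bijOn.injOn h1 hx h3] at h2
    exact h2 hxO
  filter_upwards [h.eventually (hK.isClosed.isOpen_compl.mem_nhds hnot)] with s hs
  by_contra hsO
  exact hs ⟨y s, ⟨hy s, hsO⟩, rfl⟩

/-- The closed cones of the triangles at a point cover the tangent plane. -/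
theorem exists_mem_closedCone [T2Space S] (hx : x ∈ T.carrier) (d : ℂ) :
    ∃ t ∈ T.triangles, x ∈ simplex t ∧ d ∈ T.closedCone t x := by
  set e := chartAt ℂ (T.φ x)
  have hsrc : T.φ x ∈ e.source := mem_chart_source ℂ _
  have htgt := e.map_source hsrc
  have hlc : Continuous (fun s : ℝ => e (T.φ x) + s * d) := by fun_prop
  have hl : Filter.Tendsto (fun s : ℝ => e (T.φ x) + s * d) (𝓝[>] 0) (𝓝 (e (T.φ x))) := by
    have := (hlc.tendsto 0).mono_left (nhdsWithin_le_nhds (s := Set.Ioi 0))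
    simpa using this
  choose y hy hyφ using fun s : ℝ => T.bijOn.surjOn (Set.mem_univ (e.symm (e (T.φ x) + s * d)))
  have hφ : Filter.Tendsto (fun s => T.φ (y s)) (𝓝[>] 0) (𝓝 (T.φ x)) := by
    have := (e.continuousAt_symm htgt).tendsto.comp hl
    rw [e.left_inv hsrc] at this
    exact this.congr fun s => (hyφ s).symm
  have hyx := tendsto_of_tendsto_comp hx hy hφ
  -- There are finitely many triangles, so one of them meets the ray at arbitrarily small
  -- parameters; its closed cone contains the direction by passage to the limit.
  have hfreq : ∃ t ∈ T.triangles, ∃ᶠ s in 𝓝[>] (0 : ℝ), y s ∈ simplex t := by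
    by_contra! hcon
    have h1 : ∀ᶠ s in 𝓝[>] (0 : ℝ), ∀ t ∈ T.triangles, y s ∉ simplex t := by
      rw [Filter.eventually_all_finset]
      intro t ht
      simpa using hcon t ht
    obtain ⟨s, hs⟩ := h1.exists
    obtain ⟨t, ht, hst⟩ := Set.mem_iUnion₂.1 (hy s)
    exact hs t ht hst
  obtain ⟨t, ht, hf⟩ := hfreq
  have hxt : x ∈ simplex t :=
    (isCompact_simplex t).isClosed.mem_of_frequently_of_tendsto hf hyx
  refine ⟨t, ht, hxt, ?_⟩
  obtain ⟨u, hu1, hu2, hu3, y', hy1', hy2', -, -, -, N, hN, hy6'⟩ := exists_ray ht hxt d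
  refine ⟨u, hu1, hu2, fun i hi hxi => ?_, hu3⟩
  have hev : ∀ᶠ s in 𝓝[>] (0 : ℝ), y s ∈ simplex t → y s = y' s := by
    filter_upwards [hyx.eventually hN, hl.eventually (e.open_target.mem_nhds htgt)]
      with s h1 h2 h3
    refine hy6' s _ ⟨h1, h3⟩ ?_
    rw [hyφ, e.right_inv h2]
  have hf' : ∃ᶠ s in 𝓝[>] (0 : ℝ), 0 ≤ (s⁻¹ • (y' s - x)) i := by
    refine (hf.and_eventually (hev.and self_mem_nhdsWithin)).mono ?_
    rintro s ⟨h1, h2, h3⟩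
    simp only [Pi.smul_apply, Pi.sub_apply, hxi, sub_zero, smul_eq_mul]
    rw [← h2 h1]
    exact mul_nonneg (inv_nonneg.2 (le_of_lt h3)) (h1.1 i)
  exact isClosed_Ici.mem_of_frequently_of_tendsto hf' ((tendsto_pi_nhds.1 hy1') i)

end SmoothTriangulation

/-! ### The angles at a vertex add up to `2π` -/

section Sector

/-- The open sector spanned by `U` and `W`. -/
def sector (U W : ℂ) : Set ℂ := {d | ∃ p r : ℝ, 0 < p ∧ 0 < r ∧ d = p * U + r * W}

variable {U W : ℂ}

theorem sector_comm : sector U W = sector W U := by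
  ext d
  constructor <;> rintro ⟨p, r, hp, hr, rfl⟩ <;> exact ⟨r, p, hr, hp, add_comm _ _⟩

theorem exists_eq_mul_add_mul (h : (W / U).im ≠ 0) (d : ℂ) : ∃ p r : ℝ, d = p * U + r * W := by
  have hU : U ≠ 0 := by rintro rfl; simp at h
  refine ⟨(d / U).re - (d / U).im / (W / U).im * (W / U).re, (d / U).im / (W / U).im, ?_⟩
  have h1 : d / U = ((d / U).re - (d / U).im / (W / U).im * (W / U).re : ℝ) +
      ((d / U).im / (W / U).im : ℝ) * (W / U) := by
    apply Complex.ext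
    · simp only [Complex.add_re, Complex.ofReal_re, Complex.re_ofReal_mul]
      ring
    · simp only [Complex.add_im, Complex.ofReal_im, Complex.im_ofReal_mul]
      field_simp
      ring
  have h2 := congrArg (· * U) h1
  simp only [div_mul_cancel₀ d hU, add_mul, mul_assoc, div_mul_cancel₀ W hU] at h2
  exact h2

theorem im_div_div_eq (h : (W / U).im ≠ 0) (p r : ℝ) :
    ((p * U + r * W) / U).im / (W / U).im = r := by
  have hU : U ≠ 0 := by rintro rfl; simp at h
  rw [add_div, mul_div_assoc, mul_div_assoc, div_self hU, mul_one, Complex.add_im,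
    Complex.ofReal_im, Complex.im_ofReal_mul, zero_add, mul_div_cancel_right₀ _ h]

/-- The two quotients of imaginary parts are the coordinates of `d` along `W` and `U`. -/
theorem mem_sector_iff (h : (W / U).im ≠ 0) (d : ℂ) :
    d ∈ sector U W ↔ 0 < (d / U).im / (W / U).im ∧ 0 < (d / W).im / (U / W).im := by
  have hU : U ≠ 0 := by rintro rfl; simp at h
  have hW : W ≠ 0 := by rintro rfl; simp at h
  have h' : (U / W).im ≠ 0 := by
    rw [← inv_div, Complex.inv_im]
    exact div_ne_zero (neg_ne_zero.2 h) (Complex.normSq_pos.2 (div_ne_zero hW hU)).ne'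
  have key1 := im_div_div_eq h
  have key2 : ∀ p r : ℝ, ((p * U + r * W) / W).im / (U / W).im = p := fun p r => by
    rw [add_comm]
    exact im_div_div_eq h' r p
  constructor
  · rintro ⟨p, r, hp, hr, rfl⟩
    rw [key1, key2]
    exact ⟨hr, hp⟩
  · rintro ⟨hr, hp⟩
    obtain ⟨p, r, hd⟩ := exists_eq_mul_add_mul h d
    rw [hd, key1] at hr
    rw [hd, key2] at hp
    exact ⟨p, r, hp, hr, hd⟩

theorem isOpen_sector (h : (W / U).im ≠ 0) : IsOpen (sector U W) := by
  have : sector U W =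
      {d | 0 < (d / U).im / (W / U).im} ∩ {d | 0 < (d / W).im / (U / W).im} := by
    ext d
    exact mem_sector_iff h d
  rw [this]
  refine IsOpen.inter (isOpen_lt continuous_const ?_) (isOpen_lt continuous_const ?_) <;> fun_prop

/-- The angle of a set of directions. -/
def directionAngle (A : Set ℂ) : ℝ :=
  ∫ θ in -Real.pi..Real.pi, A.indicator (fun _ => (1 : ℝ)) (Complex.exp (θ * Complex.I))

/-- After rotating by `β`, positivity of the two coordinates reads `sin θ > 0` and `sin (α - θ) >
0`, which on the interval `(-π, π]` singles out `0 < θ < α`. -/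
theorem exp_mem_sector_iff {R ρ α θ β : ℝ} (hR : 0 < R) (hρ : 0 < ρ) (hα : 0 < α)
    (hα' : α < Real.pi) (hθ : θ ∈ Set.Ioc (-Real.pi) Real.pi) :
    Complex.exp ((θ + β : ℝ) * Complex.I) ∈ sector (R * Complex.exp (β * Complex.I))
      (R * Complex.exp (β * Complex.I) * (ρ * Complex.exp (α * Complex.I))) ↔ θ ∈ Set.Ioo 0 α := by
  have him : ∀ s t : ℝ, ((s : ℂ) * Complex.exp (t * Complex.I)).im = s * Real.sin t := fun s t => by
    rw [Complex.im_ofReal_mul, Complex.exp_ofReal_mul_I_im]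
  have hR0 : (R : ℂ) ≠ 0 := by exact_mod_cast hR.ne'
  have hρ0 : (ρ : ℂ) ≠ 0 := by exact_mod_cast hρ.ne'
  have hs : 0 < Real.sin α := Real.sin_pos_of_pos_of_lt_pi hα hα'
  have hU0 : (R : ℂ) * Complex.exp (β * Complex.I) ≠ 0 := mul_ne_zero hR0 (Complex.exp_ne_zero _)
  have e1 : (R : ℂ) * Complex.exp (β * Complex.I) * (ρ * Complex.exp (α * Complex.I)) /
      (R * Complex.exp (β * Complex.I)) = ρ * Complex.exp (α * Complex.I) :=
    mul_div_cancel_left₀ _ hU0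
  have e2 : Complex.exp ((θ + β : ℝ) * Complex.I) / (R * Complex.exp (β * Complex.I)) =
      (R⁻¹ : ℝ) * Complex.exp (θ * Complex.I) := by
    rw [div_eq_iff hU0]
    push_cast
    rw [add_mul, Complex.exp_add]
    field_simp
  have e3 : Complex.exp ((θ + β : ℝ) * Complex.I) /
      (R * Complex.exp (β * Complex.I) * (ρ * Complex.exp (α * Complex.I))) =
      (R⁻¹ * ρ⁻¹ : ℝ) * Complex.exp ((θ - α : ℝ) * Complex.I) := by
    rw [div_eq_iff (mul_ne_zero hU0 (mul_ne_zero hρ0 (Complex.exp_ne_zero _)))]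
    push_cast
    rw [add_mul, sub_mul, Complex.exp_add, Complex.exp_sub]
    have := Complex.exp_ne_zero (α * Complex.I)
    field_simp
  have e4 : (R : ℂ) * Complex.exp (β * Complex.I) /
      (R * Complex.exp (β * Complex.I) * (ρ * Complex.exp (α * Complex.I))) =
      (ρ⁻¹ : ℝ) * Complex.exp ((-α : ℝ) * Complex.I) := by
    rw [div_mul_eq_div_div, div_self hU0, one_div, mul_inv, ← Complex.exp_neg]
    push_cast
    rw [neg_mul]
  rw [mem_sector_iff (by rw [e1, him]; positivity), e1, e2, e3, e4, him, him, him, him,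
    Real.sin_neg]
  have h1 : 0 < R⁻¹ * Real.sin θ / (ρ * Real.sin α) ↔ 0 < Real.sin θ := by
    rw [show R⁻¹ * Real.sin θ / (ρ * Real.sin α) = (R⁻¹ / (ρ * Real.sin α)) * Real.sin θ by ring]
    exact mul_pos_iff_of_pos_left (by positivity)
  have h2 : 0 < R⁻¹ * ρ⁻¹ * Real.sin (θ - α) / (ρ⁻¹ * -Real.sin α) ↔ 0 < Real.sin (α - θ) := by
    rw [show R⁻¹ * ρ⁻¹ * Real.sin (θ - α) / (ρ⁻¹ * -Real.sin α) =
      (R⁻¹ * ρ⁻¹ / (ρ⁻¹ * Real.sin α)) * Real.sin (α - θ) by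
        rw [← neg_sub α θ, Real.sin_neg]; field_simp]
    exact mul_pos_iff_of_pos_left (by positivity)
  rw [h1, h2]
  constructor
  · rintro ⟨h3, h4⟩
    have h5 : 0 < θ := by
      by_contra! h
      exact h3.not_ge (Real.sin_nonpos_of_nonpos_of_neg_pi_le h hθ.1.le)
    refine ⟨h5, ?_⟩
    by_contra! h
    exact h4.not_ge (Real.sin_nonpos_of_nonpos_of_neg_pi_le (by linarith) (by linarith [hθ.2]))
  · rintro ⟨h3, h4⟩
    exact ⟨Real.sin_pos_of_pos_of_lt_pi h3 (by linarith),
      Real.sin_pos_of_pos_of_lt_pi (by linarith) (by linarith)⟩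

theorem directionAngle_sector_of_pos (h : 0 < (W / U).im) :
    directionAngle (sector U W) = Complex.arg (W / U) := by
  have hU : U ≠ 0 := by rintro rfl; simp at h
  have hW : W ≠ 0 := by rintro rfl; simp at h
  set α := Complex.arg (W / U) with hα
  set β := Complex.arg U
  have hα0 : 0 < α := by
    refine lt_of_le_of_ne (Complex.arg_nonneg_iff.2 h.le) fun h0 => ?_
    exact h.ne' (Complex.arg_eq_zero_iff.1 h0.symm).2
  have hα1 : α < Real.pi := by
    refine lt_of_le_of_ne (Complex.arg_le_pi _) fun h0 => ?_
    exact h.ne' (Complex.arg_eq_pi_iff.1 h0).2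
  have hUe : U = ‖U‖ * Complex.exp (β * Complex.I) := (Complex.norm_mul_exp_arg_mul_I U).symm
  have hWe : W = ‖U‖ * Complex.exp (β * Complex.I) *
      (‖W / U‖ * Complex.exp (α * Complex.I)) := by
    rw [← hUe, hα, Complex.norm_mul_exp_arg_mul_I, mul_div_cancel₀ _ hU]
  have hper : Function.Periodic (fun θ : ℝ => (sector U W).indicator (fun _ => (1 : ℝ))
      (Complex.exp (θ * Complex.I))) (2 * Real.pi) := by
    intro θ
    simp only [Complex.ofReal_add, add_mul, Complex.exp_add]
    push_cast
    rw [Complex.exp_two_pi_mul_I, mul_one]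
  -- Periodicity permits a shift by `arg U`, so that the sector starts at angle `0` and does not
  -- wrap around.
  have e1 : directionAngle (sector U W) = ∫ θ in -Real.pi..Real.pi,
      (sector U W).indicator (fun _ => (1 : ℝ)) (Complex.exp ((θ + β : ℝ) * Complex.I)) := by
    rw [intervalIntegral.integral_comp_add_right (fun θ : ℝ => (sector U W).indicator
      (fun _ => (1 : ℝ)) (Complex.exp (θ * Complex.I)))]
    have := hper.intervalIntegral_add_eq (-Real.pi) (-Real.pi + β)
    rw [show -Real.pi + 2 * Real.pi = Real.pi by ring,
      show -Real.pi + β + 2 * Real.pi = Real.pi + β by ring] at this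
    exact this
  have hpi := Real.pi_pos
  rw [e1, intervalIntegral.integral_of_le (by linarith)]
  have e2 : ∫ θ in Set.Ioc (-Real.pi) Real.pi, (sector U W).indicator (fun _ => (1 : ℝ))
      (Complex.exp ((θ + β : ℝ) * Complex.I)) =
      ∫ θ in Set.Ioc (-Real.pi) Real.pi, (Set.Ioo 0 α).indicator (fun _ => (1 : ℝ)) θ := by
    refine setIntegral_congr_fun measurableSet_Ioc fun θ hθ => ?_
    have := exp_mem_sector_iff (β := β) (norm_pos_iff.2 hU) (norm_pos_iff.2 (div_ne_zero hW hU))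
      hα0 hα1 hθ
    rw [← hWe, ← hUe] at this
    simp only [Set.indicator, this]
  rw [e2, setIntegral_indicator measurableSet_Ioo,
    Set.inter_eq_right.2 (show Set.Ioo 0 α ⊆ Set.Ioc (-Real.pi) Real.pi from
      fun θ hθ => ⟨by linarith [hθ.1], by linarith [hθ.2]⟩)]
  simp [hα0.le]

theorem directionAngle_sector (h : (W / U).im ≠ 0) :
    directionAngle (sector U W) = |Complex.arg (W / U)| := by
  rcases h.lt_or_gt with h1 | h1
  · have hU : U ≠ 0 := by rintro rfl; simp at h
    have hW : W ≠ 0 := by rintro rfl; simp at h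
    have h2 : 0 < (U / W).im := by
      rw [← inv_div, Complex.inv_im]
      exact div_pos (by linarith) (Complex.normSq_pos.2 (div_ne_zero hW hU))
    rw [sector_comm, directionAngle_sector_of_pos h2, ← Complex.abs_arg_inv, inv_div,
      abs_of_nonneg (Complex.arg_nonneg_iff.2 h2.le)]
  · rw [directionAngle_sector_of_pos h1, abs_of_nonneg (Complex.arg_nonneg_iff.2 h1.le)]

theorem arg_exp_of_mem {θ : ℝ} (hθ : θ ∈ Set.Ioc (-Real.pi) Real.pi) :
    Complex.arg (Complex.exp (θ * Complex.I)) = θ := by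
  rw [Complex.arg_exp_mul_I, (toIocMod_eq_self _).2]
  rwa [show -Real.pi + 2 * Real.pi = Real.pi by ring]

theorem arg_of_eq_ofReal_mul {θ p : ℝ} (hθ : θ ∈ Set.Ioc (-Real.pi) Real.pi) (hp : 0 ≤ p)
    (h : Complex.exp (θ * Complex.I) = p * U) : θ = Complex.arg U := by
  have hp' : 0 < p := by
    refine lt_of_le_of_ne hp ?_
    rintro rfl
    simp at h
  rw [← arg_exp_of_mem hθ, h, Complex.arg_real_mul _ hp']

end Sector

namespace SmoothTriangulation

variable {S : Type*} [TopologicalSpace S] [ChartedSpace ℂ S] {T : SmoothTriangulation S}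
  {i j k : Fin T.n} {t : Finset (Fin T.n)}

theorem vert_mem_simplex_iff {n : ℕ} {i : Fin n} {t : Finset (Fin n)} :
    vert i ∈ simplex t ↔ i ∈ t := by
  constructor
  · intro h
    by_contra hi
    have := h.2.2 i hi
    simp [vert_self] at this
  · intro h
    refine ⟨fun j => ?_, sum_vert i, fun j hj => vert_ne ?_⟩
    · by_cases hj : j = i
      · rw [hj, vert_self]; norm_num
      · rw [vert_ne hj]
    · rintro rfl
      exact hj h

/-- The linear part of barycentric coordinates based at one vertex. -/
theorem eq_smul_add_smul {n : ℕ} {i j k : Fin n} (hij : i ≠ j) (hik : i ≠ k) (hjk : j ≠ k)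
    {u : Fin n → ℝ} (h0 : ∑ l, u l = 0) (h1 : ∀ l, l ∉ ({i, j, k} : Finset (Fin n)) → u l = 0) :
    u = u j • (vert j - vert i) + u k • (vert k - vert i) := by
  have h3 : u i + u j + u k = 0 := by
    rw [← sum_three hij hik hjk u, ← h0]
    exact Finset.sum_subset (Finset.subset_univ _) fun l _ hl => h1 l hl
  have := exists_triLin_eq hij hik hjk h0 h1
  rw [triLin_apply] at this
  have h4 : -u i = u j + u k := by linarith
  simp only [h4] at this
  conv_lhs => rw [← this]
  module

theorem im_diff_div_ne_zero {x : Fin T.n → ℝ} (hij : i ≠ j) (hik : i ≠ k) (hjk : j ≠ k)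
    (ht : {i, j, k} ∈ T.triangles) (hx : x ∈ simplex {i, j, k}) :
    (T.diff {i, j, k} x (vert k - vert i) / T.diff {i, j, k} x (vert j - vert i)).im ≠ 0 := by
  intro h
  obtain ⟨-, -, h3⟩ := rep_spec ht hx
  set m := T.diff {i, j, k} x (vert k - vert i) / T.diff {i, j, k} x (vert j - vert i) with hm
  have hj0 : T.diff {i, j, k} x (vert j - vert i) ≠ 0 := by
    intro h0
    have := h3 _ (by simp [Finset.sum_sub_distrib, sum_vert]) (fun l hl => by
      simp only [Finset.mem_insert, Finset.mem_singleton, not_or] at hl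
      simp [vert_ne hl.1, vert_ne hl.2.1]) h0
    have := congrFun this j
    simp [vert_self, vert_ne hij.symm] at this
  have hmr : m = (m.re : ℂ) := Complex.ext (by simp) (by simp [h])
  have h4 : T.diff {i, j, k} x ((vert k - vert i) - m.re • (vert j - vert i)) = 0 := by
    rw [map_sub, map_smul, Complex.real_smul, ← hmr, hm, div_mul_cancel₀ _ hj0, sub_self]
  have := h3 _ (by simp [Finset.sum_sub_distrib, ← Finset.mul_sum, sum_vert]) (fun l hl => by
    simp only [Finset.mem_insert, Finset.mem_singleton, not_or] at hl
    simp [vert_ne hl.1, vert_ne hl.2.1, vert_ne hl.2.2]) h4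
  have := congrFun this k
  simp [vert_self, vert_ne hik.symm, vert_ne hjk.symm] at this

theorem cone_vert (hij : i ≠ j) (hik : i ≠ k) (hjk : j ≠ k) :
    T.cone {i, j, k} (vert i) = sector (T.diff {i, j, k} (vert i) (vert j - vert i))
      (T.diff {i, j, k} (vert i) (vert k - vert i)) := by
  ext d
  constructor
  · rintro ⟨u, h0, h1, h2, rfl⟩
    refine ⟨u j, u k, h2 j (by simp) (vert_ne hij.symm), h2 k (by simp) (vert_ne hik.symm), ?_⟩
    conv_lhs => rw [eq_smul_add_smul hij hik hjk h0 h1]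
    simp only [map_add, map_smul, Complex.real_smul]
  · rintro ⟨p, r, hp, hr, rfl⟩
    refine ⟨p • (vert j - vert i) + r • (vert k - vert i), ?_, fun l hl => ?_, fun l hl hl' => ?_, ?_⟩
    · simp [Finset.sum_add_distrib, ← Finset.mul_sum, sum_vert]
    · simp only [Finset.mem_insert, Finset.mem_singleton, not_or] at hl
      simp [vert_ne hl.1, vert_ne hl.2.1, vert_ne hl.2.2]
    · simp only [Finset.mem_insert, Finset.mem_singleton] at hl
      rcases hl with rfl | rfl | rfl
      · simp [vert_self] at hl'
      · simpa [vert_self, vert_ne hij.symm, vert_ne hjk] using hp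
      · simpa [vert_self, vert_ne hik.symm, vert_ne hjk.symm] using hr
    · simp only [map_add, map_smul, Complex.real_smul]

variable (T) in
/-- The angle at the vertex `i` of the triangle `t`. -/
def angle (t : Finset (Fin T.n)) (i : Fin T.n) : ℝ := directionAngle (T.cone t (vert i))

theorem angle_eq (hij : i ≠ j) (hik : i ≠ k) (hjk : j ≠ k) (ht : t ∈ T.triangles)
    (htl : t = {i, j, k}) :
    T.angle t i = |Complex.arg (T.diff t (vert i) (vert k - vert i) /
      T.diff t (vert i) (vert j - vert i))| := by
  subst htl
  rw [angle, cone_vert hij hik hjk, directionAngle_sector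
    (im_diff_div_ne_zero hij hik hjk ht (vert_mem_simplex_iff.2 (by simp)))]

theorem exists_labels_of_mem (ht : t ∈ T.triangles) (hi : i ∈ t) :
    ∃ j k, i ≠ j ∧ i ≠ k ∧ j ≠ k ∧ t = {i, j, k} := by
  have h2 : (t.erase i).card = 2 := by rw [Finset.card_erase_of_mem hi, T.card_eq t ht]
  obtain ⟨j, k, hjk, h⟩ := Finset.card_eq_two.1 h2
  have hj : j ∈ t.erase i := by simp [h]
  have hk : k ∈ t.erase i := by simp [h]
  exact ⟨j, k, (Finset.ne_of_mem_erase hj).symm, (Finset.ne_of_mem_erase hk).symm, hjk,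
    by rw [← h, Finset.insert_erase hi]⟩

theorem isOpen_cone_vert (ht : t ∈ T.triangles) (hi : i ∈ t) : IsOpen (T.cone t (vert i)) := by
  obtain ⟨j, k, hij, hik, hjk, rfl⟩ := exists_labels_of_mem ht hi
  rw [cone_vert hij hik hjk]
  exact isOpen_sector (im_diff_div_ne_zero hij hik hjk ht (vert_mem_simplex_iff.2 hi))

/-- A direction in the closed but not the open cone lies along one of the two sides at the vertex,
which leaves at most two arguments. -/
theorem finite_boundary_directions (ht : t ∈ T.triangles) (hi : i ∈ t) :
    {θ : ℝ | θ ∈ Set.Ioc (-Real.pi) Real.pi ∧ Complex.exp (θ * Complex.I) ∈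
      T.closedCone t (vert i) \ T.cone t (vert i)}.Finite := by
  obtain ⟨j, k, hij, hik, hjk, rfl⟩ := exists_labels_of_mem ht hi
  refine (Set.toFinite {Complex.arg (T.diff {i, j, k} (vert i) (vert j - vert i)),
    Complex.arg (T.diff {i, j, k} (vert i) (vert k - vert i))}).subset ?_
  rintro θ ⟨hθ, ⟨u, h0, h1, h2, h3⟩, hn⟩
  rw [eq_smul_add_smul hij hik hjk h0 h1] at h3
  simp only [map_add, map_smul, Complex.real_smul] at h3
  have hj := h2 j (by simp) (vert_ne hij.symm)
  have hk := h2 k (by simp) (vert_ne hik.symm)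
  rcases hj.lt_or_eq with hj' | hj'
  · rcases hk.lt_or_eq with hk' | hk'
    · rw [cone_vert hij hik hjk] at hn
      exact absurd ⟨_, _, hj', hk', h3.symm⟩ hn
    · rw [← hk', Complex.ofReal_zero, zero_mul, add_zero] at h3
      exact Or.inl (arg_of_eq_ofReal_mul hθ hj h3.symm)
  · rw [← hj', Complex.ofReal_zero, zero_mul, zero_add] at h3
    exact Or.inr (arg_of_eq_ofReal_mul hθ hk h3.symm)

/-- Outside finitely many boundary directions, each direction lies in exactly one open cone at the
vertex, by covering and disjointness. The indicators therefore add up to `1` almost everywhere on an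
interval of length `2π`. -/
theorem sum_angle [T2Space S] (i : Fin T.n) :
    ∑ t ∈ T.triangles with i ∈ t, T.angle t i = 2 * Real.pi := by
  have hpi := Real.pi_pos
  have hle : -Real.pi ≤ Real.pi := by linarith
  simp only [angle, directionAngle, intervalIntegral.integral_of_le hle]
  have hmem : ∀ t ∈ T.triangles.filter (i ∈ ·), t ∈ T.triangles ∧ i ∈ t := fun t ht =>
    Finset.mem_filter.1 ht
  rw [← integral_finsetSum]
  · have : ∫ θ in Set.Ioc (-Real.pi) Real.pi, (1 : ℝ) = 2 * Real.pi := by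
      simp only [integral_const, MeasurableSet.univ, measureReal_restrict_apply, Set.univ_inter,
        Real.volume_real_Ioc_of_le hle, smul_eq_mul, mul_one]
      ring
    rw [← this]
    refine integral_congr_ae ?_
    set B : Set ℝ := ⋃ t ∈ T.triangles.filter (i ∈ ·),
      {θ : ℝ | θ ∈ Set.Ioc (-Real.pi) Real.pi ∧ Complex.exp (θ * Complex.I) ∈
        T.closedCone t (vert i) \ T.cone t (vert i)} with hB
    have hBf : B.Finite := Set.Finite.biUnion (Finset.finite_toSet _) fun t ht =>
      finite_boundary_directions (hmem t ht).1 (hmem t ht).2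
    have hae : ∀ᵐ θ ∂(volume.restrict (Set.Ioc (-Real.pi) Real.pi)), θ ∉ B :=
      ae_restrict_of_ae (measure_eq_zero_iff_ae_notMem.1 (hBf.measure_zero volume))
    filter_upwards [hae, ae_restrict_mem measurableSet_Ioc] with θ h1 h2
    obtain ⟨t₀, ht₀, hx, hc⟩ := exists_mem_closedCone (T := T) (x := vert i) (by
      obtain ⟨t, ht, hi⟩ := T.vertex_mem i
      exact simplex_subset ht (vert_mem_simplex_iff.2 hi)) (Complex.exp (θ * Complex.I))
    have hi₀ := vert_mem_simplex_iff.1 hx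
    have ht₀' : t₀ ∈ T.triangles.filter (i ∈ ·) := Finset.mem_filter.2 ⟨ht₀, hi₀⟩
    have hc' : Complex.exp (θ * Complex.I) ∈ T.cone t₀ (vert i) := by
      by_contra hn
      exact h1 (Set.mem_biUnion ht₀' ⟨h2, hc, hn⟩)
    rw [Finset.sum_eq_single_of_mem t₀ ht₀', Set.indicator_of_mem hc']
    intro t ht hne
    refine Set.indicator_of_notMem (fun h => hne ?_) _
    exact eq_of_mem_cone (hmem t ht).1 ht₀ (vert_mem_simplex_iff.2 (hmem t ht).2) hx h hc'
  · intro t ht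
    have hm : MeasurableSet ((fun θ : ℝ => Complex.exp (θ * Complex.I)) ⁻¹' T.cone t (vert i)) :=
      ((isOpen_cone_vert (hmem t ht).1 (hmem t ht).2).preimage (by fun_prop)).measurableSet
    exact (integrable_const (1 : ℝ)).indicator hm

end SmoothTriangulation

/-! ### Each edge lies in two triangles, on opposite sides -/

namespace SmoothTriangulation

/-- The midpoint of the edge `i j`. -/
def mid {n : ℕ} (i j : Fin n) : Fin n → ℝ := (1 / 2 : ℝ) • (vert i + vert j)

theorem vert_nonneg {n : ℕ} (i l : Fin n) : 0 ≤ vert i l := by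
  by_cases h : l = i
  · rw [h, vert_self]; norm_num
  · rw [vert_ne h]

theorem vert_of_notMem {n : ℕ} {i l : Fin n} {t : Finset (Fin n)} (hi : i ∈ t) (hl : l ∉ t) :
    vert i l = 0 :=
  vert_ne (by rintro rfl; exact hl hi)

theorem mid_mem_simplex_iff {n : ℕ} {i j : Fin n} {t : Finset (Fin n)} :
    mid i j ∈ simplex t ↔ i ∈ t ∧ j ∈ t := by
  have hnn := vert_nonneg (n := n)
  constructor
  · intro h
    constructor <;> by_contra hi
    · have := h.2.2 i hi
      simp only [mid, Pi.smul_apply, Pi.add_apply, vert_self, smul_eq_mul] at this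
      linarith [hnn j i]
    · have := h.2.2 j hi
      simp only [mid, Pi.smul_apply, Pi.add_apply, vert_self, smul_eq_mul] at this
      linarith [hnn i j]
  · rintro ⟨hi, hj⟩
    refine ⟨fun l => ?_, ?_, fun l hl => ?_⟩
    · simp only [mid, Pi.smul_apply, Pi.add_apply, smul_eq_mul]
      linarith [hnn i l, hnn j l]
    · simp only [mid, Pi.smul_apply, Pi.add_apply, smul_eq_mul, ← Finset.mul_sum,
        Finset.sum_add_distrib, sum_vert]
      norm_num
    · simp only [mid, Pi.smul_apply, Pi.add_apply]
      rw [vert_of_notMem hi hl, vert_of_notMem hj hl]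
      simp

theorem mid_add_smul_mem_simplex {n : ℕ} {i j : Fin n} {t : Finset (Fin n)} (hi : i ∈ t)
    (hj : j ∈ t) {s : ℝ} (hs : |s| ≤ 1 / 2) : mid i j + s • (vert j - vert i) ∈ simplex t := by
  have hnn := vert_nonneg (n := n)
  obtain ⟨h1, h2⟩ := abs_le.1 hs
  have e : mid i j + s • (vert j - vert i) = (1 / 2 - s) • vert i + (1 / 2 + s) • vert j := by
    simp only [mid]; module
  rw [e]
  refine ⟨fun l => ?_, ?_, fun l hl => ?_⟩
  · simp only [Pi.smul_apply, Pi.add_apply, smul_eq_mul]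
    exact add_nonneg (mul_nonneg (by linarith) (hnn i l)) (mul_nonneg (by linarith) (hnn j l))
  · simp only [Pi.smul_apply, Pi.add_apply, smul_eq_mul, ← Finset.mul_sum,
      Finset.sum_add_distrib, sum_vert]
    ring
  · simp only [Pi.smul_apply, Pi.add_apply]
    rw [vert_of_notMem hi hl, vert_of_notMem hj hl]
    simp

variable {S : Type*} [TopologicalSpace S] [ChartedSpace ℂ S] {T : SmoothTriangulation S}
  {i j k : Fin T.n} {t t' : Finset (Fin T.n)}

/-- The tangent vector of an edge does not depend on the triangle. -/
theorem hasDerivAt_edge (ht : t ∈ T.triangles) (hi : i ∈ t) (hj : j ∈ t) :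
    HasDerivAt (fun s : ℝ => chartAt ℂ (T.φ (mid i j)) (T.φ (mid i j + s • (vert j - vert i))))
      (T.diff t (mid i j) (vert j - vert i)) 0 := by
  obtain ⟨h1, h2, -⟩ := rep_spec ht (mid_mem_simplex_iff.2 ⟨hi, hj⟩)
  have e1 : HasDerivAt (fun s : ℝ => mid i j + s • (vert j - vert i)) (vert j - vert i) 0 := by
    simpa using ((hasDerivAt_id (0 : ℝ)).smul_const (vert j - vert i)).const_add (mid i j)
  have e2 := HasFDerivAt.comp_hasDerivAt_of_eq (0 : ℝ)
    (h1.differentiableAt (by simp)).hasFDerivAt e1 (by simp)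
  refine e2.congr_of_eventuallyEq ?_
  -- Working at the midpoint makes the derivative two-sided: near it, in both directions, the edge
  -- stays inside every triangle containing it.
  have h3 : Filter.Tendsto (fun s : ℝ => mid i j + s • (vert j - vert i)) (𝓝 0)
      (𝓝[simplex t] (mid i j)) := by
    refine tendsto_nhdsWithin_iff.2 ⟨by simpa using e1.continuousAt.tendsto, ?_⟩
    filter_upwards [Metric.ball_mem_nhds (0 : ℝ) (by norm_num : (0 : ℝ) < 1 / 2)] with s hs
    exact mid_add_smul_mem_simplex hi hj (by simpa using (mem_ball_zero_iff.1 hs).le)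
  filter_upwards [h3.eventually h2] with s hs
  exact hs.symm

theorem diff_edge_eq (ht : t ∈ T.triangles) (ht' : t' ∈ T.triangles) (hi : i ∈ t) (hj : j ∈ t)
    (hi' : i ∈ t') (hj' : j ∈ t') :
    T.diff t (mid i j) (vert j - vert i) = T.diff t' (mid i j) (vert j - vert i) :=
  (hasDerivAt_edge ht hi hj).unique (hasDerivAt_edge ht' hi' hj')

theorem mid_trd (hik : i ≠ k) (hjk : j ≠ k) : mid i j k = 0 := by
  simp [mid, vert_ne hik.symm, vert_ne hjk.symm]

/-- At the midpoint only the third barycentric coordinate vanishes, so the cone is the open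
half-plane on the side of the third vertex. -/
theorem mem_cone_mid_iff (hij : i ≠ j) (hik : i ≠ k) (hjk : j ≠ k) (ht : {i, j, k} ∈ T.triangles)
    (d : ℂ) : d ∈ T.cone {i, j, k} (mid i j) ↔
      0 < (d / T.diff {i, j, k} (mid i j) (vert j - vert i)).im /
        (T.diff {i, j, k} (mid i j) (vert k - vert i) /
          T.diff {i, j, k} (mid i j) (vert j - vert i)).im := by
  have him := im_diff_div_ne_zero hij hik hjk ht ((mid_mem_simplex_iff (i := i) (j := j)).2 (by simp))
  constructor
  · rintro ⟨u, h0, h1, h2, rfl⟩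
    rw [eq_smul_add_smul hij hik hjk h0 h1]
    simp only [map_add, map_smul, Complex.real_smul]
    rw [im_div_div_eq him]
    exact h2 k (by simp) (mid_trd hik hjk)
  · intro hd
    obtain ⟨p, r, rfl⟩ := exists_eq_mul_add_mul him d
    rw [im_div_div_eq him] at hd
    refine ⟨p • (vert j - vert i) + r • (vert k - vert i), ?_, fun l hl => ?_, fun l hl hl' => ?_, ?_⟩
    · simp [Finset.sum_add_distrib, ← Finset.mul_sum, sum_vert]
    · simp only [Finset.mem_insert, Finset.mem_singleton, not_or] at hl
      simp [vert_ne hl.1, vert_ne hl.2.1, vert_ne hl.2.2]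
    · simp only [Finset.mem_insert, Finset.mem_singleton] at hl
      rcases hl with rfl | rfl | rfl
      · simp [mid, vert_self, vert_ne hij] at hl'
      · simp [mid, vert_self, vert_ne hij.symm] at hl'
      · simpa [vert_self, vert_ne hik.symm, vert_ne hjk.symm] using hd
    · simp only [map_add, map_smul, Complex.real_smul]

theorem mem_cone_mid_of_mem_closedCone (hij : i ≠ j) (hik : i ≠ k) (hjk : j ≠ k)
    (ht : {i, j, k} ∈ T.triangles) {d : ℂ} (hd : d ∈ T.closedCone {i, j, k} (mid i j))
    (him : (d / T.diff {i, j, k} (mid i j) (vert j - vert i)).im ≠ 0) :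
    d ∈ T.cone {i, j, k} (mid i j) := by
  have him' := im_diff_div_ne_zero hij hik hjk ht ((mid_mem_simplex_iff (i := i) (j := j)).2 (by simp))
  rw [mem_cone_mid_iff hij hik hjk ht]
  refine lt_of_le_of_ne ?_ (div_ne_zero him him').symm
  obtain ⟨u, h0, h1, h2, rfl⟩ := hd
  rw [eq_smul_add_smul hij hik hjk h0 h1]
  simp only [map_add, map_smul, Complex.real_smul]
  rw [im_div_div_eq him']
  exact h2 k (by simp) (mid_trd hik hjk)

variable (T) in
open Classical in
/-- The side of the edge `i j` on which the triangle `t` lies. -/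
def edgeSign (t : Finset (Fin T.n)) (i j : Fin T.n) : ℝ :=
  if Complex.I * T.diff t (mid i j) (vert j - vert i) ∈ T.cone t (mid i j) then 1 else -1

theorem diff_edge_ne_zero (hij : i ≠ j) (ht : t ∈ T.triangles) (hi : i ∈ t) (hj : j ∈ t) :
    T.diff t (mid i j) (vert j - vert i) ≠ 0 := by
  intro h0
  have := (rep_spec ht (mid_mem_simplex_iff.2 ⟨hi, hj⟩)).2.2 _
    (by simp [Finset.sum_sub_distrib, sum_vert]) (fun l hl => by
      rw [Pi.sub_apply, vert_of_notMem hj hl, vert_of_notMem hi hl, sub_zero]) h0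
  have := congrFun this j
  simp [vert_self, vert_ne hij.symm] at this

theorem edgeSign_of_pos (hij : i ≠ j) (hik : i ≠ k) (hjk : j ≠ k) (ht : t ∈ T.triangles)
    (htl : t = {i, j, k})
    (h : 0 < (T.diff t (mid i j) (vert k - vert i) / T.diff t (mid i j) (vert j - vert i)).im) :
    T.edgeSign t i j = 1 := by
  subst htl
  rw [edgeSign, if_pos]
  rw [mem_cone_mid_iff hij hik hjk ht,
    mul_div_cancel_right₀ _ (diff_edge_ne_zero hij ht (by simp) (by simp)), Complex.I_im]
  positivity

theorem edgeSign_of_neg (hij : i ≠ j) (hik : i ≠ k) (hjk : j ≠ k) (ht : t ∈ T.triangles)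
    (htl : t = {i, j, k})
    (h : (T.diff t (mid i j) (vert k - vert i) / T.diff t (mid i j) (vert j - vert i)).im < 0) :
    T.edgeSign t i j = -1 := by
  subst htl
  rw [edgeSign, if_neg]
  rw [mem_cone_mid_iff hij hik hjk ht,
    mul_div_cancel_right₀ _ (diff_edge_ne_zero hij ht (by simp) (by simp)), Complex.I_im, not_lt]
  exact (div_neg_of_pos_of_neg one_pos h).le

theorem exists_labels_of_mem_of_mem (hij : i ≠ j) (ht : t ∈ T.triangles) (hi : i ∈ t) (hj : j ∈ t) :
    ∃ k, i ≠ k ∧ j ≠ k ∧ t = {i, j, k} := by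
  obtain ⟨a, b, hia, hib, hab, rfl⟩ := exists_labels_of_mem ht hi
  simp only [Finset.mem_insert, Finset.mem_singleton] at hj
  rcases hj with rfl | rfl | rfl
  · exact absurd rfl hij
  · exact ⟨b, hib, hab, rfl⟩
  · exact ⟨a, hia, hab.symm, by rw [Finset.pair_comm]⟩

/-- An open half-plane bounded by the edge contains exactly one of its two normals. -/
theorem mem_cone_mid_or (hij : i ≠ j) (ht : t ∈ T.triangles) (hi : i ∈ t) (hj : j ∈ t) :
    (Complex.I * T.diff t (mid i j) (vert j - vert i) ∈ T.cone t (mid i j) ∧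
      -Complex.I * T.diff t (mid i j) (vert j - vert i) ∉ T.cone t (mid i j)) ∨
    (Complex.I * T.diff t (mid i j) (vert j - vert i) ∉ T.cone t (mid i j) ∧
      -Complex.I * T.diff t (mid i j) (vert j - vert i) ∈ T.cone t (mid i j)) := by
  have hU := diff_edge_ne_zero hij ht hi hj
  obtain ⟨k, hik, hjk, rfl⟩ := exists_labels_of_mem_of_mem hij ht hi hj
  have him := im_diff_div_ne_zero hij hik hjk ht ((mid_mem_simplex_iff (i := i) (j := j)).2 (by simp))
  simp only [mem_cone_mid_iff hij hik hjk ht, mul_div_cancel_right₀ _ hU, Complex.neg_im,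
    Complex.I_im, not_lt]
  rcases him.lt_or_gt with h | h
  · exact Or.inr ⟨(div_neg_of_pos_of_neg one_pos h).le, div_pos_of_neg_of_neg (by norm_num) h⟩
  · exact Or.inl ⟨div_pos one_pos h, (div_neg_of_neg_of_pos (by norm_num) h).le⟩

/-- An edge lies in exactly two triangles, one on each side. -/
theorem exists_two_triangles [T2Space S] (hij : i ≠ j) (ht : t ∈ T.triangles) (hi : i ∈ t)
    (hj : j ∈ t) : ∃ t₁ t₂, t₁ ≠ t₂ ∧ T.edgeSign t₁ i j = 1 ∧ T.edgeSign t₂ i j = -1 ∧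
      T.triangles.filter (fun t => i ∈ t ∧ j ∈ t) = {t₁, t₂} := by
  set U := T.diff t (mid i j) (vert j - vert i) with hUdef
  have hU : U ≠ 0 := diff_edge_ne_zero hij ht hi hj
  have hall : ∀ t' ∈ T.triangles, i ∈ t' → j ∈ t' →
      T.diff t' (mid i j) (vert j - vert i) = U := fun t' ht' hi' hj' =>
    diff_edge_eq ht' ht hi' hj' hi hj
  -- Every direction transverse to the edge lies in some closed cone, hence in an open one. Applied
  -- to the two normals this gives a triangle on each side; disjointness of open cones excludes a
  -- third triangle.
  have key : ∀ v : ℂ, v.im ≠ 0 → ∃ t' ∈ T.triangles, i ∈ t' ∧ j ∈ t' ∧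
      v * U ∈ T.cone t' (mid i j) := by
    intro v hv
    obtain ⟨t', ht', hx, hc⟩ := exists_mem_closedCone (T := T)
      (simplex_subset ht (mid_mem_simplex_iff.2 ⟨hi, hj⟩)) (v * U)
    obtain ⟨hi', hj'⟩ := mid_mem_simplex_iff.1 hx
    refine ⟨t', ht', hi', hj', ?_⟩
    have h1 := hall t' ht' hi' hj'
    obtain ⟨k, hik, hjk, rfl⟩ := exists_labels_of_mem_of_mem hij ht' hi' hj'
    refine mem_cone_mid_of_mem_closedCone hij hik hjk ht' hc ?_
    rwa [h1, mul_div_cancel_right₀ _ hU]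
  obtain ⟨t₁, ht₁, hi₁, hj₁, hc₁⟩ := key Complex.I (by simp)
  obtain ⟨t₂, ht₂, hi₂, hj₂, hc₂⟩ := key (-Complex.I) (by simp)
  have or₁ := mem_cone_mid_or hij ht₁ hi₁ hj₁
  have or₂ := mem_cone_mid_or hij ht₂ hi₂ hj₂
  rw [hall t₁ ht₁ hi₁ hj₁] at or₁
  rw [hall t₂ ht₂ hi₂ hj₂] at or₂
  refine ⟨t₁, t₂, ?_, ?_, ?_, ?_⟩
  · rintro rfl
    tauto
  · rw [edgeSign, hall t₁ ht₁ hi₁ hj₁, if_pos hc₁]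
  · rw [edgeSign, hall t₂ ht₂ hi₂ hj₂, if_neg (by tauto)]
  · ext t'
    simp only [Finset.mem_filter, Finset.mem_insert, Finset.mem_singleton]
    constructor
    · rintro ⟨ht', hi', hj'⟩
      have hx := mid_mem_simplex_iff.2 ⟨hi', hj'⟩
      have or' := mem_cone_mid_or hij ht' hi' hj'
      rw [hall t' ht' hi' hj'] at or'
      rcases or' with ⟨h1, -⟩ | ⟨-, h1⟩
      · exact Or.inl (eq_of_mem_cone ht' ht₁ hx (mid_mem_simplex_iff.2 ⟨hi₁, hj₁⟩) h1 hc₁)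
      · exact Or.inr (eq_of_mem_cone ht' ht₂ hx (mid_mem_simplex_iff.2 ⟨hi₂, hj₂⟩) h1 hc₂)
    · rintro (rfl | rfl)
      · exact ⟨ht₁, hi₁, hj₁⟩
      · exact ⟨ht₂, hi₂, hj₂⟩

theorem sum_edgeSign [T2Space S] (hij : i ≠ j) :
    ∑ t ∈ T.triangles with i ∈ t ∧ j ∈ t, T.edgeSign t i j = 0 := by
  rcases (T.triangles.filter fun t => i ∈ t ∧ j ∈ t).eq_empty_or_nonempty with h | ⟨t, ht⟩
  · rw [h, Finset.sum_empty]
  · obtain ⟨ht, hi, hj⟩ := Finset.mem_filter.1 ht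
    obtain ⟨t₁, t₂, hne, h1, h2, h3⟩ := exists_two_triangles hij ht hi hj
    rw [h3, Finset.sum_pair hne, h1, h2, add_neg_cancel]

/-- Double counting of the pairs of an edge and a triangle. -/
theorem three_mul_card_triangles [T2Space S] : 3 * T.triangles.card = 2 * T.edges.card := by
  have h1 : ∀ t ∈ T.triangles, (T.edges.filter (· ⊆ t)).card = 3 := by
    intro t ht
    have : T.edges.filter (· ⊆ t) = t.powersetCard 2 := by
      ext s
      simp only [Finset.mem_filter, edges, Finset.mem_biUnion, Finset.mem_powersetCard]
      constructor
      · rintro ⟨⟨t', -, -, h⟩, h'⟩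
        exact ⟨h', h⟩
      · rintro ⟨h', h⟩
        exact ⟨⟨t, ht, h', h⟩, h'⟩
    rw [this, Finset.card_powersetCard, T.card_eq t ht]
    rfl
  have h2 : ∀ s ∈ T.edges, (T.triangles.filter (s ⊆ ·)).card = 2 := by
    intro s hs
    simp only [edges, Finset.mem_biUnion, Finset.mem_powersetCard] at hs
    obtain ⟨t, ht, hst, hs2⟩ := hs
    obtain ⟨i, j, hij, rfl⟩ := Finset.card_eq_two.1 hs2
    obtain ⟨t₁, t₂, hne, -, -, h3⟩ :=
      exists_two_triangles hij ht (hst (by simp)) (hst (by simp))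
    have : T.triangles.filter (({i, j} : Finset (Fin T.n)) ⊆ ·) =
        T.triangles.filter (fun t => i ∈ t ∧ j ∈ t) := by
      ext t'
      simp [Finset.insert_subset_iff]
    rw [this, h3, Finset.card_pair hne]
  have h3 := Finset.sum_card_bipartiteAbove_eq_sum_card_bipartiteBelow
    (s := T.edges) (t := T.triangles) (fun s t => s ⊆ t)
  simp only [Finset.bipartiteAbove, Finset.bipartiteBelow] at h3
  rw [Finset.sum_congr rfl h2, Finset.sum_congr rfl h1] at h3
  simp only [Finset.sum_const, smul_eq_mul] at h3
  linarith

end SmoothTriangulation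

/-! ### The Gauss-Bonnet theorem for a triangulated surface -/

section Sign

variable {S : Type*} [TopologicalSpace S] [ChartedSpace ℂ S] {τ : ℂ → S} {z : ℂ}

/-- The orientation of a triangle. -/
def triSign (τ : ℂ → S) : ℝ := SignType.sign (triQuot τ 1 Complex.I 0).im

theorem zero_mem_tri : (0 : ℂ) ∈ Tri := by norm_num [Tri]

theorem jac_triRep_eq (hτ : IsSmoothTriangle τ) (hz : z ∈ Tri) :
    jac (triRep τ z) z =
      Complex.normSq (dirDeriv (triRep τ z) 1 z) * (triQuot τ 1 Complex.I z).im := by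
  have h0 := dirDeriv_ne_zero_of_jac (hτ.isRep hz).jac_ne one_ne_zero
  rw [← Complex.im_ofReal_mul, triQuot, Complex.normSq_eq_conj_mul_self, mul_assoc,
    mul_div_cancel₀ _ h0]
  rfl

variable [IsManifold 𝓘(ℂ) ω S]

/-- The orientation function is continuous and nowhere zero on a connected set, so it keeps its sign
at the vertex `0`. -/
theorem triSign_cases (h : ConformalMetric S) (hτ : IsSmoothTriangle τ) :
    (triSign τ = 1 ∧ ∀ z ∈ Tri, 0 < (triQuot τ 1 Complex.I z).im) ∨
    (triSign τ = -1 ∧ ∀ z ∈ Tri, (triQuot τ 1 Complex.I z).im < 0) := by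
  have hc : ContinuousOn (fun z => (triQuot τ 1 Complex.I z).im) Tri :=
    Complex.continuous_im.comp_continuousOn (continuousOn_triQuot h hτ one_ne_zero Complex.I)
  have hconn : IsPreconnected Tri := convex_tri.isPreconnected
  have hne : ∀ z ∈ Tri, (triQuot τ 1 Complex.I z).im ≠ 0 := fun z hz => im_triQuot_ne_zero hτ hz
  rcases (hne 0 zero_mem_tri).lt_or_gt with h0 | h0
  · refine Or.inr ⟨by simp [triSign, sign_neg h0], fun z hz => ?_⟩
    by_contra! hz'
    obtain ⟨w, hw, hw0⟩ := hconn.intermediate_value zero_mem_tri hz hc ⟨h0.le, hz'⟩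
    exact hne w hw hw0
  · refine Or.inl ⟨by simp [triSign, sign_pos h0], fun z hz => ?_⟩
    by_contra! hz'
    obtain ⟨w, hw, hw0⟩ := hconn.intermediate_value hz zero_mem_tri hc ⟨hz', h0.le⟩
    exact hne w hw hw0

/-- The pull-back of a nonnegative 2-form has the sign of the orientation of the triangle. -/
theorem abs_triDensity (h : ConformalMetric S) (hτ : IsSmoothTriangle τ) (hz : z ∈ Tri)
    {d : OpenPartialHomeomorph S ℂ → ℂ → ℝ}
    (hd : ∀ e ∈ atlas ℂ S, ∀ z ∈ e.target, 0 ≤ d e z) :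
    |triDensity d τ z| = triSign τ * triDensity d τ z := by
  have h1 := hd _ (chart_mem_atlas ℂ (τ z)) _ ((hτ.isRep hz).apply_mem hz)
  have h2 := jac_triRep_eq hτ hz
  have h3 := Complex.normSq_nonneg (dirDeriv (triRep τ z) 1 z)
  rw [triDensity, abs_mul, abs_of_nonneg h1]
  rcases triSign_cases h hτ with ⟨hs, hp⟩ | ⟨hs, hn⟩
  · rw [hs, one_mul, abs_of_nonneg]
    rw [h2]
    exact mul_nonneg h3 (hp z hz).le
  · rw [hs, abs_of_nonpos]
    · ring
    rw [h2]
    exact mul_nonpos_of_nonneg_of_nonpos h3 (hn z hz).le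

end Sign

namespace SmoothTriangulation

variable {S : Type*} [TopologicalSpace S] [ChartedSpace ℂ S] {T : SmoothTriangulation S}

/-- Listing vertices in increasing order makes all triangles parametrize a shared edge in the same
direction, so its rotation is one number for both. -/
theorem exists_sorted_labels {t : Finset (Fin T.n)} (ht : t ∈ T.triangles) :
    ∃ a b c, a < b ∧ b < c ∧ t = {a, b, c} := by
  obtain ⟨a, b, c, hab, hac, hbc, rfl⟩ := exists_labels ht
  rcases hab.lt_or_gt with h1 | h1 <;> rcases hac.lt_or_gt with h2 | h2 <;>
    rcases hbc.lt_or_gt with h3 | h3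
  · exact ⟨a, b, c, h1, h3, rfl⟩
  · exact ⟨a, c, b, h2, h3, by ext; simp; tauto⟩
  · exact absurd (h1.trans h3) h2.asymm
  · exact ⟨c, a, b, h2, h1, by ext; simp; tauto⟩
  · exact ⟨b, a, c, h1, h2, by ext; simp; tauto⟩
  · exact absurd (h3.trans h1) h2.asymm
  · exact ⟨b, c, a, h3, h2, by ext; simp; tauto⟩
  · exact ⟨c, b, a, h3, h1, by ext; simp; tauto⟩

theorem triParam_ofReal {n : ℕ} (a b c : Fin n) (s : ℝ) :
    triParam a b c s = vert a + s • (vert b - vert a) := by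
  simp [triParam, triLin_apply]

theorem triParam_one_add {n : ℕ} (a b c : Fin n) (s : ℝ) :
    triParam a b c (1 + s * Complex.I) = vert b + s • (vert c - vert b) := by
  simp [triParam, triLin_apply]
  abel

theorem triParam_diagonal {n : ℕ} (a b c : Fin n) (s : ℝ) :
    triParam a b c (s * (1 + Complex.I)) = vert a + s • (vert c - vert a) := by
  simp only [triParam, triLin_apply, Complex.re_ofReal_mul, Complex.im_ofReal_mul, Complex.add_re,
    Complex.add_im, Complex.one_re, Complex.one_im, Complex.I_re, Complex.I_im]
  module

variable (T) in
/-- The total rotation of the edge from `i` to `j`. -/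
def edgeRotation (h : ConformalMetric S) (i j : Fin T.n) : ℝ :=
  totalRotation h fun s => T.φ (vert i + s • (vert j - vert i))

variable [IsManifold 𝓘(ℂ) ω S] {a b c : Fin T.n}

/-- The Gauss-Bonnet formula for one triangle. -/
theorem triSign_mul_integral (h : ConformalMetric S) (hab : a ≠ b) (hac : a ≠ c) (hbc : b ≠ c)
    (ht : {a, b, c} ∈ T.triangles) :
    triSign (fun w => T.φ (triParam a b c w)) *
        ∫ z in Tri, triDensity h.curv (fun w => T.φ (triParam a b c w)) z =
      (T.edgeSign {a, b, c} a b * T.edgeRotation h a b +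
        T.edgeSign {a, b, c} b c * T.edgeRotation h b c +
        T.edgeSign {a, b, c} a c * T.edgeRotation h a c) +
      (Real.pi - (T.angle {a, b, c} a + T.angle {a, b, c} b + T.angle {a, b, c} c)) := by
  set τ : ℂ → S := fun w => T.φ (triParam a b c w) with hτdef
  have hτ : IsSmoothTriangle τ := isSmoothTriangle hab hac hbc ht
  have hD : ∀ z ∈ Tri, ∀ w v, triQuot τ w v z =
      T.diff {a, b, c} (triParam a b c z) (triLin a b c v) /
        T.diff {a, b, c} (triParam a b c z) (triLin a b c w) := fun z hz w v =>
    triQuot_eq_diff h hab hac hbc ht hz w v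
  have hset1 : ({a, b, c} : Finset (Fin T.n)) = {b, c, a} := by ext; simp; tauto
  have hset2 : ({a, b, c} : Finset (Fin T.n)) = {a, c, b} := by ext; simp; tauto
  have hset3 : ({a, b, c} : Finset (Fin T.n)) = {b, a, c} := by ext; simp; tauto
  have hset4 : ({a, b, c} : Finset (Fin T.n)) = {c, b, a} := by ext; simp; tauto
  have l1 : triLin a b c 1 = vert b - vert a := by simp [triLin_apply]
  have lI : triLin a b c Complex.I = vert c - vert b := by simp [triLin_apply]
  have l1I : triLin a b c (1 + Complex.I) = vert c - vert a := by simp [triLin_apply]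
  have p0 : triParam a b c 0 = vert a := by simp [triParam]
  have p1 : triParam a b c 1 = vert b := by simp [triParam, l1]
  have p1I : triParam a b c (1 + Complex.I) = vert c := by
    rw [triParam, l1I]; abel
  have pab : triParam a b c (1 / 2 : ℝ) = mid a b := by
    rw [triParam_ofReal, mid]; module
  have pbc : triParam a b c (1 + (1 / 2 : ℝ) * Complex.I) = mid b c := by
    rw [triParam_one_add, mid]; module
  have pac : triParam a b c ((1 / 2 : ℝ) * (1 + Complex.I)) = mid a c := by
    rw [triParam_diagonal, mid]; module
  have z1 : (1 : ℂ) ∈ Tri := by norm_num [Tri]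
  have z1I : (1 + Complex.I : ℂ) ∈ Tri := by norm_num [Tri]
  have zab : (((1 / 2 : ℝ) : ℂ)) ∈ Tri := by
    refine ⟨?_, ?_, ?_⟩ <;> simp; norm_num
  have zbc : (1 + ((1 / 2 : ℝ) : ℂ) * Complex.I : ℂ) ∈ Tri := by
    refine ⟨?_, ?_, ?_⟩ <;> simp; norm_num
  have zac : (((1 / 2 : ℝ) : ℂ) * (1 + Complex.I) : ℂ) ∈ Tri := by
    refine ⟨?_, ?_, ?_⟩ <;> simp; norm_num
  have hD1 : ∀ z ∈ Tri, 1 + triQuot τ 1 Complex.I z = triQuot τ 1 (1 + Complex.I) z :=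
    fun z hz => by rw [triQuot_one_eq hτ hz (1 + Complex.I)]; simp
  have ha : |Complex.arg (1 + triQuot τ 1 Complex.I 0)| = T.angle {a, b, c} a := by
    rw [angle_eq hab hac hbc ht rfl, hD1 0 zero_mem_tri, hD 0 zero_mem_tri, p0, l1, l1I]
  have hb : |Complex.arg (-triQuot τ 1 Complex.I 1)| = T.angle {a, b, c} b := by
    rw [angle_eq hab.symm hbc hac ht hset3, hD 1 z1, p1, l1, lI, ← neg_sub (vert b) (vert a),
      map_neg, div_neg]
  have hc : |Complex.arg ((1 + triQuot τ 1 Complex.I (1 + Complex.I)) /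
      triQuot τ 1 Complex.I (1 + Complex.I))| = T.angle {a, b, c} c := by
    have h0 : T.diff {a, b, c} (vert c) (vert b - vert a) ≠ 0 := by
      have := im_diff_div_ne_zero hab hac hbc ht (vert_mem_simplex_iff (i := c).2 (by simp))
      intro h0
      simp [h0] at this
    rw [angle_eq hbc.symm hac.symm hab.symm ht hset4, hD1 _ z1I, hD _ z1I, hD _ z1I, p1I, l1, lI,
      l1I, div_div_div_cancel_right₀ h0, ← neg_sub (vert c) (vert a), ← neg_sub (vert c) (vert b),
      map_neg, map_neg, neg_div_neg_eq]
  have key := gauss_bonnet_arg h hτ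
  have r1 : totalRotation h (fun t => τ t) = T.edgeRotation h a b := by
    simp only [hτdef, triParam_ofReal, edgeRotation]
  have r2 : totalRotation h (fun t => τ (1 + t * Complex.I)) = T.edgeRotation h b c := by
    simp only [hτdef, triParam_one_add, edgeRotation]
  have r3 : totalRotation h (fun t => τ (t * (1 + Complex.I))) = T.edgeRotation h a c := by
    simp only [hτdef, triParam_diagonal, edgeRotation]
  rw [r1, r2, r3] at key
  -- The sign of an edge is decided by the quotient of the direction to the third vertex by the edge
  -- tangent at the midpoint. Each such quotient is expressed through `τ_* i / τ_* 1`, whose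
  -- imaginary part has a known sign.
  have mab : T.diff {a, b, c} (mid a b) (vert c - vert a) /
      T.diff {a, b, c} (mid a b) (vert b - vert a) = 1 + triQuot τ 1 Complex.I (1 / 2 : ℝ) := by
    rw [hD1 _ zab, hD _ zab, pab, l1, l1I]
  have mbc : T.diff {a, b, c} (mid b c) (vert a - vert b) /
      T.diff {a, b, c} (mid b c) (vert c - vert b) =
      -(triQuot τ 1 Complex.I (1 + (1 / 2 : ℝ) * Complex.I))⁻¹ := by
    rw [hD _ zbc, pbc, l1, lI, inv_div, ← neg_sub (vert b) (vert a), map_neg, neg_div]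
  have mac : T.diff {a, b, c} (mid a c) (vert b - vert a) /
      T.diff {a, b, c} (mid a c) (vert c - vert a) =
      (1 + triQuot τ 1 Complex.I ((1 / 2 : ℝ) * (1 + Complex.I)))⁻¹ := by
    rw [hD1 _ zac, hD _ zac, pac, l1, l1I, inv_div]
  have hnz : ∀ w : ℂ, w.im ≠ 0 → 0 < Complex.normSq w := fun w hw =>
    Complex.normSq_pos.2 fun h => by simp [h] at hw
  -- The boundary of the standard triangle runs through `a b` and `b c` forwards and through `a c`
  -- backwards, so the edge signs are `1, 1, -1` or their negatives.
  rcases triSign_cases h hτ with ⟨hs, hp⟩ | ⟨hs, hn⟩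
  · have e1 : T.edgeSign {a, b, c} a b = 1 := by
      refine edgeSign_of_pos hab hac hbc ht rfl ?_
      rw [mab, Complex.add_im, Complex.one_im, zero_add]
      exact hp _ zab
    have e2 : T.edgeSign {a, b, c} b c = 1 := by
      refine edgeSign_of_pos hbc hab.symm hac.symm ht hset1 ?_
      have := hp _ zbc
      rw [mbc, Complex.neg_im, Complex.inv_im, neg_div, neg_neg]
      exact div_pos this (hnz _ this.ne')
    have e3 : T.edgeSign {a, b, c} a c = -1 := by
      refine edgeSign_of_neg hac hab hbc.symm ht hset2 ?_
      have := hp _ zac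
      have h1 : 0 < (1 + triQuot τ 1 Complex.I ((1 / 2 : ℝ) * (1 + Complex.I))).im := by
        rwa [Complex.add_im, Complex.one_im, zero_add]
      rw [mac, Complex.inv_im, neg_div, neg_lt_zero]
      exact div_pos h1 (hnz _ h1.ne')
    rw [hs, key, e1, e2, e3, angle_sum_of_pos (hp _ zero_mem_tri) (hp _ z1) (hp _ z1I), ha, hb, hc]
    ring
  · have e1 : T.edgeSign {a, b, c} a b = -1 := by
      refine edgeSign_of_neg hab hac hbc ht rfl ?_
      rw [mab, Complex.add_im, Complex.one_im, zero_add]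
      exact hn _ zab
    have e2 : T.edgeSign {a, b, c} b c = -1 := by
      refine edgeSign_of_neg hbc hab.symm hac.symm ht hset1 ?_
      have := hn _ zbc
      rw [mbc, Complex.neg_im, Complex.inv_im, neg_div, neg_neg]
      exact div_neg_of_neg_of_pos this (hnz _ this.ne)
    have e3 : T.edgeSign {a, b, c} a c = 1 := by
      refine edgeSign_of_pos hac hab hbc.symm ht hset2 ?_
      have := hn _ zac
      have h1 : (1 + triQuot τ 1 Complex.I ((1 / 2 : ℝ) * (1 + Complex.I))).im < 0 := by
        rwa [Complex.add_im, Complex.one_im, zero_add]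
      rw [mac, Complex.inv_im]
      exact div_pos (by linarith) (hnz _ h1.ne)
    have := angle_sum_of_neg (hn _ zero_mem_tri) (hn _ z1) (hn _ z1I)
    rw [ha, hb, hc] at this
    rw [hs, key, e1, e2, e3, ← this]
    ring

/-- The **Gauss-Bonnet theorem** for a triangulated surface. -/
theorem gauss_bonnet [T2Space S] (h : ConformalMetric S) {a b c : Finset (Fin T.n) → Fin T.n}
    (hab : ∀ t ∈ T.triangles, a t < b t) (hbc : ∀ t ∈ T.triangles, b t < c t)
    (hl : ∀ t ∈ T.triangles, t = {a t, b t, c t}) :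
    ∑ t ∈ T.triangles, triSign (fun w => T.φ (triParam (a t) (b t) (c t) w)) *
        ∫ z in Tri, triDensity h.curv (fun w => T.φ (triParam (a t) (b t) (c t) w)) z =
      -(2 * Real.pi * T.eulerChar) := by
  -- Rewriting each contribution as a sum over all ordered pairs and all vertices lets the sums be
  -- interchanged with the sum over triangles.
  have h1 : ∀ t ∈ T.triangles, triSign (fun w => T.φ (triParam (a t) (b t) (c t) w)) *
      ∫ z in Tri, triDensity h.curv (fun w => T.φ (triParam (a t) (b t) (c t) w)) z =
      (∑ i, ∑ j, if i < j ∧ i ∈ t ∧ j ∈ t then T.edgeSign t i j * T.edgeRotation h i j else 0) +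
        (Real.pi - ∑ i, if i ∈ t then T.angle t i else 0) := by
    intro t ht
    have hab' := hab t ht
    have hbc' := hbc t ht
    have hl' := hl t ht
    have hac' := hab'.trans hbc'
    have e1 : (∑ i, ∑ j, if i < j ∧ i ∈ t ∧ j ∈ t then T.edgeSign t i j * T.edgeRotation h i j
        else 0) = ∑ i ∈ t, ∑ j ∈ t, if i < j then T.edgeSign t i j * T.edgeRotation h i j
        else 0 := by
      rw [← Finset.sum_filter_add_sum_filter_not Finset.univ (· ∈ t), Finset.filter_univ_mem]
      rw [Finset.sum_eq_zero (s := Finset.univ.filter (· ∉ t)), add_zero]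
      · refine Finset.sum_congr rfl fun i hi => ?_
        rw [← Finset.sum_filter_add_sum_filter_not Finset.univ (· ∈ t), Finset.filter_univ_mem]
        rw [Finset.sum_eq_zero (s := Finset.univ.filter (· ∉ t)), add_zero]
        · refine Finset.sum_congr rfl fun j hj => ?_
          simp [hi, hj]
        · intro j hj
          simp [(Finset.mem_filter.1 hj).2]
      · intro i hi
        simp [(Finset.mem_filter.1 hi).2]
    have e2 : (∑ i, if i ∈ t then T.angle t i else 0) = ∑ i ∈ t, T.angle t i := by
      rw [Finset.sum_ite_mem, Finset.univ_inter]
    have key := triSign_mul_integral h hab'.ne hac'.ne hbc'.ne (by rwa [← hl'])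
    rw [← hl'] at key
    rw [key, e1, e2]
    congr 1
    · conv_rhs =>
        rw [hl', sum_three hab'.ne hac'.ne hbc'.ne]
        simp only [sum_three hab'.ne hac'.ne hbc'.ne]
      simp only [lt_irrefl, if_false, hab', hbc', hac', if_true, hab'.not_gt, hbc'.not_gt,
        hac'.not_gt, ← hl']
      ring
    · congr 1
      conv_rhs => rw [hl', sum_three hab'.ne hac'.ne hbc'.ne]
      rw [← hl']
  rw [Finset.sum_congr rfl h1, Finset.sum_add_distrib, Finset.sum_sub_distrib]
  have h2 : ∑ t ∈ T.triangles, ∑ i, ∑ j, (if i < j ∧ i ∈ t ∧ j ∈ t then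
      T.edgeSign t i j * T.edgeRotation h i j else 0) = 0 := by
    rw [Finset.sum_comm]
    refine Finset.sum_eq_zero fun i _ => ?_
    rw [Finset.sum_comm]
    refine Finset.sum_eq_zero fun j _ => ?_
    by_cases hij : i < j
    · simp only [hij, true_and]
      rw [← Finset.sum_filter, ← Finset.sum_mul, sum_edgeSign hij.ne, zero_mul]
    · simp [hij]
  have h3 : ∑ t ∈ T.triangles, ∑ i, (if i ∈ t then T.angle t i else 0) = T.n * (2 * Real.pi) := by
    rw [Finset.sum_comm]
    simp only [← Finset.sum_filter, sum_angle, Finset.sum_const, Finset.card_univ,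
      Fintype.card_fin, nsmul_eq_mul]
  rw [h2, h3, Finset.sum_const, nsmul_eq_mul, eulerChar]
  -- The total is `π F - 2π V`, which equals `-2π (V - E + F)` because `3F = 2E`.
  have h4 : (3 * T.triangles.card : ℝ) = 2 * T.edges.card := by
    exact_mod_cast T.three_mul_card_triangles
  push_cast
  linear_combination Real.pi * h4

end SmoothTriangulation

/-! ### Areas -/

section Area

theorem measurableSet_inter_preimage {α β : Type*} [TopologicalSpace α] [MeasurableSpace α]
    [OpensMeasurableSpace α] [TopologicalSpace β] [MeasurableSpace β] [BorelSpace β] {f : α → β}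
    {s : Set α} (hf : ContinuousOn f s) (hs : MeasurableSet s) {B : Set β} (hB : MeasurableSet B) :
    MeasurableSet (s ∩ f ⁻¹' B) := by
  have := hs.subtype_image ((continuousOn_iff_continuous_domRestrict.1 hf).measurable hB)
  have e : Subtype.val '' (s.domRestrict f ⁻¹' B) = s ∩ f ⁻¹' B :=
    Subtype.image_preimage_coe s (f ⁻¹' B)
  rwa [e] at this

variable {S : Type*} [TopologicalSpace S] [MeasurableSpace S] [BorelSpace S]

theorem measurableSet_chart (e : OpenPartialHomeomorph S ℂ) {B : Set S} (hB : MeasurableSet B) :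
    MeasurableSet (e.symm ⁻¹' B ∩ e.target) := by
  rw [Set.inter_comm]
  exact measurableSet_inter_preimage e.symm.continuousOn e.open_target.measurableSet hB

theorem chartMeasure_apply (e : OpenPartialHomeomorph S ℂ) (d : ℂ → ℝ) {B : Set S}
    (hB : MeasurableSet B) :
    Measure.map e.symm ((volume.restrict e.target).withDensity fun z => ENNReal.ofReal (d z)) B =
      ∫⁻ z in e.symm ⁻¹' B ∩ e.target, ENNReal.ofReal (d z) := by
  have hm : AEMeasurable e.symm
      ((volume.restrict e.target).withDensity fun z => ENNReal.ofReal (d z)) :=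
    (e.symm.continuousOn.aemeasurable e.open_target.measurableSet).mono_ac
      (withDensity_absolutelyContinuous _ _)
  rw [Measure.map_apply_of_aemeasurable hm hB, withDensity_apply',
    Measure.restrict_restrict' e.open_target.measurableSet]

variable [ChartedSpace ℂ S]

theorem chartMeasure_le_areaMeasure {e : OpenPartialHomeomorph S ℂ} (he : e ∈ atlas ℂ S)
    (d : OpenPartialHomeomorph S ℂ → ℂ → ℝ) {B : Set S} (hB : MeasurableSet B) :
    ∫⁻ z in e.symm ⁻¹' B ∩ e.target, ENNReal.ofReal (d e z) ≤ areaMeasure d B := by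
  rw [← chartMeasure_apply e (d e) hB]
  exact Measure.le_iff'.1 (le_iSup₂ (f := fun (e : OpenPartialHomeomorph S ℂ) (_ : e ∈ atlas ℂ S) =>
    Measure.map e.symm ((volume.restrict e.target).withDensity fun z => ENNReal.ofReal (d e z)))
    e he) B

theorem areaMeasure_le {d : OpenPartialHomeomorph S ℂ → ℂ → ℝ} {ν : Measure S}
    (h : ∀ e ∈ atlas ℂ S, ∀ B, MeasurableSet B →
      ∫⁻ z in e.symm ⁻¹' B ∩ e.target, ENNReal.ofReal (d e z) ≤ ν B) : areaMeasure d ≤ ν := by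
  refine iSup₂_le fun e he => Measure.le_iff.2 fun B hB => ?_
  rw [chartMeasure_apply e (d e) hB]
  exact h e he B hB

theorem areaMeasure_le_smul {d d₁ : OpenPartialHomeomorph S ℂ → ℂ → ℝ} {k : ℝ} (hk : 0 ≤ k)
    (h : ∀ e ∈ atlas ℂ S, ∀ z ∈ e.target, d e z ≤ k * d₁ e z) :
    areaMeasure d ≤ ENNReal.ofReal k • areaMeasure d₁ := by
  refine areaMeasure_le fun e he B hB => ?_
  rw [Measure.smul_apply, smul_eq_mul]
  refine le_trans ?_ (mul_le_mul_right (chartMeasure_le_areaMeasure he d₁ hB) _)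
  rw [← lintegral_const_mul' _ _ ENNReal.ofReal_ne_top]
  refine setLIntegral_mono' (measurableSet_chart e hB) fun z hz => ?_
  rw [← ENNReal.ofReal_mul hk]
  exact ENNReal.ofReal_le_ofReal (h e he z hz.2)

/-- The area measure is a supremum of chart measures, so an upper bound may be checked in one chart
at a time. Continuity of `d₂` provides the measurability needed to split the lower integral. -/
theorem areaMeasure_le_add {d d₁ d₂ : OpenPartialHomeomorph S ℂ → ℂ → ℝ} {k : ℝ} (hk : 0 ≤ k)
    (hd₂ : ∀ e ∈ atlas ℂ S, ContinuousOn (d₂ e) e.target)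
    (h : ∀ e ∈ atlas ℂ S, ∀ z ∈ e.target, d e z ≤ k * d₁ e z + d₂ e z) :
    areaMeasure d ≤ ENNReal.ofReal k • areaMeasure d₁ + areaMeasure d₂ := by
  refine areaMeasure_le fun e he B hB => ?_
  rw [Measure.add_apply, Measure.smul_apply, smul_eq_mul]
  refine le_trans ?_ (add_le_add (mul_le_mul_right (chartMeasure_le_areaMeasure he d₁ hB) _)
    (chartMeasure_le_areaMeasure he d₂ hB))
  have hm : AEMeasurable (fun z => ENNReal.ofReal (d₂ e z))
      (volume.restrict (e.symm ⁻¹' B ∩ e.target)) :=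
    (((hd₂ e he).mono Set.inter_subset_right).aemeasurable (measurableSet_chart e hB)).ennreal_ofReal
  rw [← lintegral_const_mul' _ _ ENNReal.ofReal_ne_top, ← lintegral_add_right' _ hm]
  refine setLIntegral_mono' (measurableSet_chart e hB) fun z hz => ?_
  rw [← ENNReal.ofReal_mul hk]
  exact (ENNReal.ofReal_le_ofReal (h e he z hz.2)).trans ENNReal.ofReal_add_le

variable [IsManifold 𝓘(ℂ) ω S] {τ : ℂ → S}

/-- The area formula for the part of an embedded triangle in the domain of a chart. -/
theorem lintegral_image_triangle (h : ConformalMetric S) (hτ : IsSmoothTriangle τ)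
    (hinj : Set.InjOn τ Tri) {d : OpenPartialHomeomorph S ℂ → ℂ → ℝ} (hd : IsDensity d)
    (hd0 : ∀ e ∈ atlas ℂ S, ∀ z ∈ e.target, 0 ≤ d e z) {e : OpenPartialHomeomorph S ℂ}
    (he : e ∈ atlas ℂ S) {B : Set S} (hB : MeasurableSet B) :
    ∫⁻ z in (fun w => e (τ w)) '' (Tri ∩ τ ⁻¹' (e.source ∩ B)), ENNReal.ofReal (d e z) =
      ∫⁻ z in Tri ∩ τ ⁻¹' (e.source ∩ B), ENNReal.ofReal |triDensity d τ z| := by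
  set A := Tri ∩ τ ⁻¹' (e.source ∩ B) with hA
  have hAm : MeasurableSet A := measurableSet_inter_preimage hτ.continuousOn
    isClosed_tri.measurableSet (e.open_source.measurableSet.inter hB)
  -- The extension may vary from point to point: the area formula uses only its derivative at `z`,
  -- as a derivative within the triangle.
  have hex : ∀ z ∈ A, ∃ G, IsRep τ e z G := fun z hz =>
    IsRep.exists_of_mem_source h hτ hz.1 he hz.2.1
  choose! G hG using hex
  rw [lintegral_image_eq_lintegral_abs_det_fderiv_mul volume hAm
    (f' := fun z => fderiv ℝ (G z) z)]
  · refine setLIntegral_congr_fun hAm fun z hz => ?_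
    have hr := hG z hz
    have h0 : 0 ≤ d e (G z z) := hd0 e he _ (hr.apply_mem hz.1)
    have hdet : (fderiv ℝ (G z) z).det = jac (G z) z := det_eq_im _
    rw [hr.triDensity_eq h hτ hz.1 hd, hdet, ← hr.apply_eq hz.1, abs_mul, abs_of_nonneg h0,
      mul_comm, ENNReal.ofReal_mul h0]
  · intro z hz
    have hr := hG z hz
    have h1 : HasFDerivWithinAt (fun w => e (τ w)) (fderiv ℝ (G z) z) Tri z :=
      hr.differentiableAt.hasFDerivAt.hasFDerivWithinAt.congr_of_eventuallyEq
        (hr.eventually_eq.mono fun w hw => hw.symm) (hr.apply_eq hz.1).symm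
    exact h1.mono Set.inter_subset_left
  · intro z hz w hw hzw
    exact hinj hz.1 hw.1 (e.injOn hz.2.1 hw.2.1 hzw)

/-- The area of a surface covered by embedded triangles is at most the sum of their areas. -/
theorem areaMeasure_le_sum_triangles {ι : Type*} (I : Finset ι) {τ : ι → ℂ → S}
    (h : ConformalMetric S) (hτ : ∀ t ∈ I, IsSmoothTriangle (τ t))
    (hinj : ∀ t ∈ I, Set.InjOn (τ t) Tri) (hcov : ∀ x, ∃ t ∈ I, ∃ z ∈ Tri, τ t z = x)
    {d : OpenPartialHomeomorph S ℂ → ℂ → ℝ} (hd : IsDensity d)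
    (hd0 : ∀ e ∈ atlas ℂ S, ∀ z ∈ e.target, 0 ≤ d e z) :
    areaMeasure d Set.univ ≤
      ∑ t ∈ I, ∫⁻ z in Tri, ENNReal.ofReal |triDensity d (τ t) z| := by
  set ν : Measure S := ∑ t ∈ I, Measure.map (τ t)
    ((volume.restrict Tri).withDensity fun z => ENNReal.ofReal |triDensity d (τ t) z|) with hν
  have hνB : ∀ B, MeasurableSet B → ν B =
      ∑ t ∈ I, ∫⁻ z in (τ t) ⁻¹' B ∩ Tri, ENNReal.ofReal |triDensity d (τ t) z| := by
    intro B hB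
    rw [hν, Measure.finsetSum_apply]
    refine Finset.sum_congr rfl fun t ht => ?_
    have hm : AEMeasurable (τ t) ((volume.restrict Tri).withDensity
        fun z => ENNReal.ofReal |triDensity d (τ t) z|) :=
      ((hτ t ht).continuousOn.aemeasurable isClosed_tri.measurableSet).mono_ac
        (withDensity_absolutelyContinuous _ _)
    rw [Measure.map_apply_of_aemeasurable hm hB, withDensity_apply',
      Measure.restrict_restrict' isClosed_tri.measurableSet]
  have hle : areaMeasure d ≤ ν := by
    refine areaMeasure_le fun e he B hB => ?_
    have hsub : e.symm ⁻¹' B ∩ e.target ⊆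
        ⋃ t ∈ I, (fun w => e (τ t w)) '' (Tri ∩ (τ t) ⁻¹' (e.source ∩ B)) := by
      rintro z ⟨hz1, hz2⟩
      obtain ⟨t, ht, w, hw, hwz⟩ := hcov (e.symm z)
      refine Set.mem_biUnion ht ⟨w, ⟨hw, ?_⟩, ?_⟩
      · simp only [Set.mem_preimage, hwz]
        exact ⟨e.map_target hz2, hz1⟩
      · simp only [hwz, e.right_inv hz2]
    -- Subadditivity over the covering images suffices; overlaps only enlarge the right-hand side.
    rw [← withDensity_apply']
    refine (measure_mono hsub).trans ((measure_biUnion_finset_le I _).trans ?_)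
    rw [hνB B hB]
    refine Finset.sum_le_sum fun t ht => ?_
    rw [withDensity_apply', lintegral_image_triangle h (hτ t ht) (hinj t ht) hd hd0 he hB]
    exact lintegral_mono_set fun z hz => ⟨hz.2.2, hz.1⟩
  refine (Measure.le_iff'.1 hle _).trans ?_
  rw [hνB _ MeasurableSet.univ]
  simp

end Area

namespace SmoothTriangulation

variable {S : Type*} [TopologicalSpace S] [ChartedSpace ℂ S] [MeasurableSpace S]
  [BorelSpace S] [IsManifold 𝓘(ℂ) ω S] {T : SmoothTriangulation S}

/-- For a nonnegative density, the orientation sign turns the signed integral over each triangle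
into the integral of the absolute value. This bounds the total curvature by the Gauss-Bonnet sum and
shows that areas are finite. -/
theorem areaMeasure_le_ofReal (h : ConformalMetric S) {a b c : Finset (Fin T.n) → Fin T.n}
    (hab : ∀ t ∈ T.triangles, a t < b t) (hbc : ∀ t ∈ T.triangles, b t < c t)
    (hl : ∀ t ∈ T.triangles, t = {a t, b t, c t}) {d : OpenPartialHomeomorph S ℂ → ℂ → ℝ}
    (hd : IsDensity d) (hd0 : ∀ e ∈ atlas ℂ S, ∀ z ∈ e.target, 0 ≤ d e z)
    (hc : ∀ e ∈ atlas ℂ S, ContinuousOn (d e) e.target) :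
    areaMeasure d Set.univ ≤ ENNReal.ofReal
      (∑ t ∈ T.triangles, triSign (fun w => T.φ (triParam (a t) (b t) (c t) w)) *
        ∫ z in Tri, triDensity d (fun w => T.φ (triParam (a t) (b t) (c t) w)) z) := by
  have hne : ∀ t ∈ T.triangles, a t ≠ b t ∧ a t ≠ c t ∧ b t ≠ c t := fun t ht =>
    ⟨(hab t ht).ne, ((hab t ht).trans (hbc t ht)).ne, (hbc t ht).ne⟩
  have hτ : ∀ t ∈ T.triangles,
      IsSmoothTriangle fun w => T.φ (triParam (a t) (b t) (c t) w) := fun t ht =>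
    isSmoothTriangle (hne t ht).1 (hne t ht).2.1 (hne t ht).2.2 (by rwa [← hl t ht])
  have hmem : ∀ t ∈ T.triangles, ∀ z ∈ Tri, triParam (a t) (b t) (c t) z ∈ simplex t :=
    fun t ht z hz => by
      have := triParam_mem (hne t ht).1 (hne t ht).2.1 (hne t ht).2.2 hz
      rwa [← hl t ht] at this
  have hsum := areaMeasure_le_sum_triangles T.triangles h hτ
    (fun t ht z hz w hw hzw => triParam_injective (hne t ht).1 (hne t ht).2.1 (hne t ht).2.2
      (T.bijOn.injOn (simplex_subset ht (hmem t ht z hz)) (simplex_subset ht (hmem t ht w hw)) hzw))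
    (fun x => by
      obtain ⟨y, hy, rfl⟩ := T.bijOn.surjOn (Set.mem_univ x)
      obtain ⟨t, ht, hyt⟩ := Set.mem_iUnion₂.1 hy
      rw [hl t ht] at hyt
      obtain ⟨z, hz, hzy⟩ :=
        exists_triParam_eq (hne t ht).1 (hne t ht).2.1 (hne t ht).2.2 hyt
      exact ⟨t, ht, z, hz, by rw [hzy]⟩) hd hd0
  refine hsum.trans (le_of_eq ?_)
  have heq : ∀ t ∈ T.triangles, triSign (fun w => T.φ (triParam (a t) (b t) (c t) w)) *
        ∫ z in Tri, triDensity d (fun w => T.φ (triParam (a t) (b t) (c t) w)) z =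
      ∫ z in Tri, |triDensity d (fun w => T.φ (triParam (a t) (b t) (c t) w)) z| := by
    intro t ht
    rw [← integral_const_mul]
    exact setIntegral_congr_fun isClosed_tri.measurableSet fun z hz =>
      (abs_triDensity h (hτ t ht) hz hd0).symm
  rw [Finset.sum_congr rfl heq,
    ENNReal.ofReal_sum_of_nonneg fun t _ => integral_nonneg fun z => abs_nonneg _]
  refine Finset.sum_congr rfl fun t ht => ?_
  rw [ofReal_integral_eq_lintegral_ofReal]
  · exact (continuousOn_triDensity h (hτ t ht) hd hc).abs.integrableOn_compact isCompact_tri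
  · exact Filter.Eventually.of_forall fun z => abs_nonneg _

end SmoothTriangulation

/-! ### Pointwise inequalities between the two area densities -/

section Estimates

theorem two_rpow_mul_rpow_cube {Q : ℝ} (hQ : 0 ≤ Q) :
    ((2 : ℝ) ^ (1 / 3 : ℝ) * Q ^ (2 / 3 : ℝ)) ^ 3 = 2 * Q ^ 2 := by
  rw [mul_pow, ← Real.rpow_mul_natCast (by norm_num), ← Real.rpow_mul_natCast hQ]
  norm_num

theorem two_rpow_mul_rpow_le {Q l : ℝ} (hQ : 0 ≤ Q) (hl : 0 < l) (h : 2 * Q ^ 2 ≤ l ^ 3) :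
    (2 : ℝ) ^ (1 / 3 : ℝ) * Q ^ (2 / 3 : ℝ) ≤ l := by
  rw [← two_rpow_mul_rpow_cube hQ] at h
  exact le_of_pow_le_pow_left₀ (by norm_num) hl.le h

/-- With `a = 2^(1/3) Q^(2/3)` one has `a³ = 2Q²` and `a ≤ l`, so `a³/l² ≤ a`. -/
theorem div_le_two_rpow_mul_rpow {Q l : ℝ} (hQ : 0 ≤ Q) (hl : 0 < l) (h : 2 * Q ^ 2 ≤ l ^ 3) :
    2 * Q ^ 2 / l ^ 2 ≤ (2 : ℝ) ^ (1 / 3 : ℝ) * Q ^ (2 / 3 : ℝ) := by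
  have h1 := two_rpow_mul_rpow_le hQ hl h
  have h0 : 0 ≤ (2 : ℝ) ^ (1 / 3 : ℝ) * Q ^ (2 / 3 : ℝ) := by positivity
  rw [← two_rpow_mul_rpow_cube hQ, div_le_iff₀ (by positivity), pow_succ']
  exact mul_le_mul_of_nonneg_left (pow_le_pow_left₀ h0 h1 2) h0

end Estimates

end AffineSphere

end

/-! ### The area inequalities -/

theorem mainTheorem9
    {S : Type*} [TopologicalSpace S] [T2Space S] [CompactSpace S] [ConnectedSpace S]
    [ChartedSpace ℂ S] [IsManifold 𝓘(ℂ) ω S] [MeasurableSpace S] [BorelSpace S]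
    (T : AffineSphere.SmoothTriangulation S) (hχ : T.eulerChar < 0)
    {X : Type*} [TopologicalSpace X] [SimplyConnectedSpace X]
    [ChartedSpace ℂ X] [IsManifold 𝓘(ℂ) ω X]
    (p : X → S) (f : X → Fin 3 → ℝ)
    (ρ : AffineSphere.deckGroup p →* Matrix.SpecialLinearGroup (Fin 3) ℝ)
    (h : AffineSphere.ConformalMetric S) (q : AffineSphere.CubicDifferential S)
    (hf : AffineSphere.IsQuotientAffineSphere p f ρ h q) :
    q.flatArea ≠ ⊤ ∧ h.area ≠ ⊤ ∧
      (2 : ℝ) ^ (1 / 3 : ℝ) * q.flatArea.toReal ≤ h.area.toReal ∧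
      h.area.toReal ≤
        (2 : ℝ) ^ (1 / 3 : ℝ) * q.flatArea.toReal + 2 * Real.pi * |(T.eulerChar : ℝ)| := by
  -- The vertex set must be inhabited so that the labels can be chosen as total functions of the
  -- triangle.
  have : Nonempty (Fin T.n) := by
    obtain ⟨x⟩ := (inferInstance : Nonempty S)
    obtain ⟨y, hy, -⟩ := T.bijOn.surjOn (Set.mem_univ x)
    obtain ⟨t, ht, -⟩ := Set.mem_iUnion₂.1 hy
    obtain ⟨a, -⟩ := AffineSphere.SmoothTriangulation.exists_sorted_labels ht
    exact ⟨a⟩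
  choose! a b c hab hbc hl using fun t (ht : t ∈ T.triangles) =>
    AffineSphere.SmoothTriangulation.exists_sorted_labels ht
  have hk : (0 : ℝ) < 2 ^ (1 / 3 : ℝ) := by positivity
  have hpick := fun e (he : e ∈ atlas ℂ S) z (hz : z ∈ e.target) => hf.two_mul_norm_sq_le he hz
  have hcurv : ∀ e ∈ atlas ℂ S, ∀ z ∈ e.target, 0 ≤ h.curv e z := by
    intro e he z hz
    have hl := h.pos e he z hz
    rw [hf.curv_eq he hz, sub_nonneg, div_le_iff₀ (by positivity)]
    calc 2 * ‖q.coeff e z‖ ^ 2 ≤ h.coeff e z ^ 3 := hpick e he z hz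
      _ = h.coeff e z * h.coeff e z ^ 2 := by ring
  have harea : h.area ≠ ⊤ := ne_top_of_le_ne_top ENNReal.ofReal_ne_top
    (AffineSphere.SmoothTriangulation.areaMeasure_le_ofReal h hab hbc hl h.transform
      (fun e he z hz => (h.pos e he z hz).le) fun e he => (h.smooth e he).continuousOn)
  have htot : AffineSphere.areaMeasure h.curv Set.univ ≤ ENNReal.ofReal (2 * Real.pi * |(T.eulerChar : ℝ)|) := by
    refine (AffineSphere.SmoothTriangulation.areaMeasure_le_ofReal h hab hbc hl (AffineSphere.isDensity_curv h) hcurv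
      fun e he => AffineSphere.continuousOn_curv h he).trans (le_of_eq ?_)
    rw [AffineSphere.SmoothTriangulation.gauss_bonnet h hab hbc hl, abs_of_neg (by exact_mod_cast hχ)]
    ring_nf
  have hflat : q.flatArea ≤ ENNReal.ofReal ((2 : ℝ) ^ (1 / 3 : ℝ))⁻¹ * h.area := by
    refine Measure.le_iff'.1 (AffineSphere.areaMeasure_le_smul (inv_nonneg.2 hk.le) fun e he z hz => ?_) _
    rw [le_inv_mul_iff₀ hk]
    exact AffineSphere.two_rpow_mul_rpow_le (norm_nonneg _) (h.pos e he z hz) (hpick e he z hz)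
  have hflat' : q.flatArea ≠ ⊤ :=
    ne_top_of_le_ne_top (ENNReal.mul_ne_top ENNReal.ofReal_ne_top harea) hflat
  -- Wang's equation splits the density of `h` as `2|q|²/h²` plus the curvature density; the first
  -- part is at most `2^(1/3)|q|^(2/3)`, and the second has total mass at most `2π|χ|`.
  have hupper : h.area ≤ ENNReal.ofReal ((2 : ℝ) ^ (1 / 3 : ℝ)) * q.flatArea +
      ENNReal.ofReal (2 * Real.pi * |(T.eulerChar : ℝ)|) := by
    have := AffineSphere.areaMeasure_le_add (d := h.coeff) (d₁ := fun e z => ‖q.coeff e z‖ ^ (2 / 3 : ℝ))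
      (d₂ := h.curv) hk.le (fun e he => AffineSphere.continuousOn_curv h he) fun e he z hz => by
        have h1 := AffineSphere.div_le_two_rpow_mul_rpow (norm_nonneg (q.coeff e z)) (h.pos e he z hz)
          (hpick e he z hz)
        rw [hf.curv_eq he hz]
        linarith
    exact (Measure.le_iff'.1 this Set.univ).trans (add_le_add le_rfl htot)
  refine ⟨hflat', harea, ?_, ?_⟩
  · have := ENNReal.toReal_mono (ENNReal.mul_ne_top ENNReal.ofReal_ne_top harea) hflat
    rw [ENNReal.toReal_mul, ENNReal.toReal_ofReal (inv_nonneg.2 hk.le), le_inv_mul_iff₀ hk] at this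
    exact this
  · have hnn : 0 ≤ 2 * Real.pi * |(T.eulerChar : ℝ)| := by positivity
    have h1 := ENNReal.mul_ne_top (ENNReal.ofReal_ne_top (r := (2 : ℝ) ^ (1 / 3 : ℝ))) hflat'
    have := ENNReal.toReal_mono (ENNReal.add_ne_top.2 ⟨h1, ENNReal.ofReal_ne_top⟩) hupper
    rw [ENNReal.toReal_add h1 ENNReal.ofReal_ne_top, ENNReal.toReal_mul,
      ENNReal.toReal_ofReal hk.le, ENNReal.toReal_ofReal hnn] at this
    exact this
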